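/- Fix a base field $k$. A modulus pair $M=(\overline M,M^\infty)$ consists of a separated $k$-scheme $\overline M$ of finite type and an effective Cartier divisor $M^\infty$ on it whose complement, the interior $M^\circ=\overline M\setminus|M^\infty|$, is smooth over $k$. An admissible morphism $f:M\to N$ is a $k$-morphism $f^\circ:M^\circ\to N^\circ$ such that, with $\Gamma\subset\overline M\times_k\overline N$ the closure of the graph of $f^\circ$ and $\Gamma^N$ its normalization, $\Gamma\to\overline M$ is proper and $M^\infty|_{\Gamma^N}\ge N^\infty|_{\Gamma^N}$. Let $\mathbf{\underline{M}Sm}$ be the resulting category and $\mathbf{MSm}$ its full subcategory of proper modulus pairs ($\overline M$ proper over $k$). A morphism $f$ is minimal if $f^\circ$ extends to a $k$-morphism $\overline f:\overline M\to\overline N$ with $M^\infty=\overline f^*N^\infty$. A commutative square $T$ is written with corners $T(00),T(01),T(10),T(11)$ and morphisms $v_T:T(00)\to T(01)$, $q_T:T(00)\to T(10)$, $p_T:T(01)\to T(11)$, $u_T:T(10)\to T(11)$. An elementary Nisnevich square of schemes is a cartesian square with $u,v$ open immersions and $p,q$ étale such that $p$ induces an isomorphism of reduced complements $(X(01)\setminus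 X(00))_{\mathrm{red}}\to (X(11)\setminus X(10))_{\mathrm{red}}$. An $\underline{\mathrm{MV}}$-square is a square in $\mathbf{\underline{M}Sm}$ isomorphic to a square of minimal morphisms whose square of ambient spaces is an elementary Nisnevich square. For $f:M\to N$ in $\mathbf{MSm}$ with $f^\circ$ étale, the off-diagonal $\mathrm{OD}(f)$ is the complement of the diagonal in a decomposition $M\times_N M\cong M\sqcup\mathrm{OD}(f)$. An $\mathrm{MV}$-square is a square $T$ in $\mathbf{MSm}$ such that: (1) $T$ is cartesian in $\mathbf{MSm}$; (2) there are an $\underline{\mathrm{MV}}$-square $S$ with $S(11)\in\mathbf{MSm}$ and a morphism $S\to T$ in $\mathbf{\underline{M}Sm}^{\mathbf{Sq}}$ such that $S(ij)^\circ\to T(ij)^\circ$ is an isomorphism for all $i,j$ and $S(11)\to T(11)$ is an isomorphism; (3) the induced morphism $\mathrm{OD}(q_T)\to\mathrm{OD}(p_T)$ is an isomorphism. Let $P_{\mathrm{MV}}$ be the class of $\mathrm{MV}$-squares. **Theorem.** (a) For every $f:M\to N$ in $\mathbf{MSm}$ with $f^\circ$ étale, the fibre product $M\times_N M$ exists in $\mathbf{MSm}$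 and has a decomposition $M\times_N M\cong M\sqcup\mathrm{OD}(f)$ as a coproduct in $\mathbf{MSm}$ in which $M$ is embedded by the diagonal. (b) $P_{\mathrm{MV}}$ is a regular cd-structure on $\mathbf{MSm}$. That is, it is closed under isomorphism of squares, and for every $T\in P_{\mathrm{MV}}$ the square $T$ is cartesian, $u_T$ is a monomorphism, and the morphism of sheaves $$\rho(T(01))\sqcup \bigl(\rho(T(00))\times_{\rho(T(10))}\rho(T(00))\bigr)\to \rho(T(01))\times_{\rho(T(11))}\rho(T(01))$$ given by the diagonal and by $\rho(v_T)\times\rho(v_T)$ is surjective. Here $\rho(X)$ is the sheaf of sets associated with the presheaf represented by $X$, for the smallest Grothendieck topology on $\mathbf{MSm}$ in which the empty sieve covers every initial object and $\{u_T,p_T\}$ covers $T(11)$ for every $T\in P_{\mathrm{MV}}$. (c) For every $T\in P_{\mathrm{MV}}$, the square $T$ is cartesian, $u_T$ is a monomorphism, the fibre products $T(01)\times_{T(11)}T(01)$ and $T(00)\times_{T(10)}T(00)$ exist in $\mathbf{MSm}$, and the derived square with corners $T(00)$, $T(01)$, $T(00)\times_{T(10)}T(00)$, $T(01)\times_{T(11)}T(01)$,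 with vertical morphisms the diagonals and horizontal morphisms induced by $v_T$, is again in $P_{\mathrm{MV}}$. -/

import Mathlib

open CategoryTheory Limits AlgebraicGeometry
universe u
namespace MotivicModulus

theorem comap_ideal_top {X Y : Scheme.{u}} [IsAffine X] [IsAffine Y] (I : Y.IdealSheafData) (h : X ⟶ Y) :
    (I.comap h).ideal ⟨⊤, isAffineOpen_top X⟩
      = (I.ideal ⟨⊤, isAffineOpen_top Y⟩).map h.appTop.hom := by
  apply le_antisymm
  · have : I.comap h ≤ Scheme.IdealSheafData.ofIdealTop
        ((I.ideal ⟨⊤, isAffineOpen_top Y⟩).map h.appTop.hom) := by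
      rw [← Scheme.IdealSheafData.le_map_iff_comap_le]
      apply Scheme.IdealSheafData.le_of_isAffine
      rw [Scheme.IdealSheafData.ideal_map _ _ _ (isAffineOpen_top X)]
      rw [← Ideal.map_le_iff_le_comap]
      simp only [Scheme.IdealSheafData.ofIdealTop_ideal]
      erw [X.presheaf.map_id]
      exact (Ideal.map_id _).ge
    refine (this ⟨⊤, isAffineOpen_top X⟩).trans ?_
    simp only [Scheme.IdealSheafData.ofIdealTop_ideal]
    erw [X.presheaf.map_id]
    exact (Ideal.map_id _).le
  · have := Scheme.IdealSheafData.le_map_comap I h ⟨⊤, isAffineOpen_top Y⟩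
    rw [Scheme.IdealSheafData.ideal_map _ _ _ (isAffineOpen_top X)] at this
    exact Ideal.map_le_iff_le_comap.mpr this

theorem comap_ι_ideal {X : Scheme.{u}} (I : X.IdealSheafData) (U : X.affineOpens) :
    haveI : IsAffine U.1 := U.2
    (I.comap U.1.ι).ideal ⟨⊤, isAffineOpen_top U.1.toScheme⟩
      = (I.ideal U).map U.1.topIso.inv.hom := by
  have : IsAffine U.1 := U.2
  rw [Scheme.IdealSheafData.ideal_comap_of_isOpenImmersion]
  have e : (⟨U.1.ι ''ᵁ ⊤, (isAffineOpen_top U.1.toScheme).image_of_isOpenImmersion U.1.ι⟩ : X.affineOpens) = U :=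
    Subtype.ext (by simp)
  have h2 := I.map_ideal (le_of_eq e)
  rw [← h2]
  simp
  exact Ideal.comap_id _

theorem comap_ideal {X Y : Scheme.{u}} (I : Y.IdealSheafData) (f : X ⟶ Y)
    (U : X.affineOpens) (V : Y.affineOpens) (h : U.1 ≤ f ⁻¹ᵁ V.1) :
    (I.comap f).ideal U = (I.ideal V).map (f.appLE V.1 U.1 h).hom := by
  have : IsAffine U.1 := U.2
  have : IsAffine V.1 := V.2
  have key : (I.comap f).comap U.1.ι = (I.comap V.1.ι).comap (f.resLE V.1 U.1 h) := by
    rw [← Scheme.IdealSheafData.comap_comp, ← Scheme.IdealSheafData.comap_comp,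
      Scheme.Hom.resLE_comp_ι]
  have k2 := congrArg (fun J : Scheme.IdealSheafData _ => J.ideal ⟨⊤, isAffineOpen_top U.1.toScheme⟩) key
  simp only [comap_ι_ideal, comap_ideal_top, Ideal.map_map] at k2
  have k3 := congrArg (Ideal.map U.1.topIso.hom.hom) k2
  simp only [Ideal.map_map, ← CommRingCat.hom_comp] at k3
  simp only [Iso.inv_hom_id, CommRingCat.hom_id, Ideal.map_id] at k3
  rw [k3]
  congr 2
  rw [show (f.resLE V.1 U.1 h).appTop = _ from Scheme.Hom.resLE_app_top f h]
  simp only [Category.assoc, Iso.inv_hom_id_assoc, Iso.inv_hom_id, Category.comp_id]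

/-- Divisibility of sections by a section that is nowhere a zero divisor is a local question. -/
theorem exists_eq_mul_of_locally {X : Scheme.{u}} (O : X.Opens) (A B : Γ(X, O))
    (hB : ∀ (W : X.Opens) (h : W ≤ O) (x : Γ(X, W)),
      x * X.presheaf.map (homOfLE h).op B = 0 → x = 0)
    (hA : ∀ (W : X.affineOpens) (h : W.1 ≤ O),
      X.presheaf.map (homOfLE h).op A ∈ Ideal.span {X.presheaf.map (homOfLE h).op B}) :
    ∃ c : Γ(X, O), A = c * B := by
  have hA' : ∀ W : {W : X.affineOpens // W.1 ≤ O}, ∃ c : Γ(X, W.1.1),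
      c * X.presheaf.map (homOfLE W.2).op B = X.presheaf.map (homOfLE W.2).op A :=
    fun W => Ideal.mem_span_singleton'.mp (hA W.1 W.2)
  choose c hc using hA'
  have hcover : O ≤ ⨆ W : {W : X.affineOpens // W.1 ≤ O}, W.1.1 := by
    intro x hx
    obtain ⟨_, ⟨W, hW, rfl⟩, hxW, hWO⟩ :=
      X.isBasis_affineOpens.exists_subset_of_mem_open hx O.2
    exact TopologicalSpace.Opens.mem_iSup.mpr ⟨⟨⟨W, hW⟩, hWO⟩, hxW⟩
  have res : ∀ {W W' : X.Opens} (h : W ≤ O) (h' : W' ≤ W) (s : Γ(X, O)),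
      X.presheaf.map (homOfLE h').op (X.presheaf.map (homOfLE h).op s)
        = X.presheaf.map (homOfLE (h'.trans h)).op s := by
    intro W W' h h' s
    rw [← CommRingCat.comp_apply, ← X.presheaf.map_comp]
    rfl
  obtain ⟨s, hs, -⟩ := X.sheaf.existsUnique_gluing'
    (fun W : {W : X.affineOpens // W.1 ≤ O} => W.1.1) O (fun W => homOfLE W.2) hcover c (by
      intro W W'
      have h1 : W.1.1 ⊓ W'.1.1 ≤ W.1.1 := inf_le_left
      have h2 : W.1.1 ⊓ W'.1.1 ≤ W'.1.1 := inf_le_right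
      change X.presheaf.map (homOfLE h1).op (c W) = X.presheaf.map (homOfLE h2).op (c W')
      rw [← sub_eq_zero]
      apply hB _ (h1.trans W.2)
      have e1 := congrArg (X.presheaf.map (homOfLE h1).op) (hc W)
      have e2 := congrArg (X.presheaf.map (homOfLE h2).op) (hc W')
      rw [map_mul, res, res] at e1 e2
      rw [sub_mul, e1, e2, sub_self])
  refine ⟨s, ?_⟩
  refine X.sheaf.eq_of_locally_eq' (fun W : {W : X.affineOpens // W.1 ≤ O} => W.1.1) O
    (fun W => homOfLE W.2) hcover _ _ fun W => ?_
  let s' : Γ(X, O) := s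
  change X.presheaf.map (homOfLE W.2).op A = X.presheaf.map (homOfLE W.2).op (s' * B)
  rw [map_mul, ← hc W]
  congr 1
  exact (hs W).symm

/-- An ideal sheaf is locally principal if every point has an affine open neighbourhood on which
the ideal is generated by one section. -/
def IsLocallyPrincipal {X : Scheme.{u}} (I : X.IdealSheafData) : Prop :=
  ∀ x : X, ∃ U : X.affineOpens, x ∈ U.1 ∧ ∃ t : Γ(X, U.1), I.ideal U = Ideal.span {t}

theorem IsLocallyPrincipal.comap {X Y : Scheme.{u}} {I : Y.IdealSheafData}
    (hI : IsLocallyPrincipal I) (f : X ⟶ Y) : IsLocallyPrincipal (I.comap f) := by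
  intro x
  obtain ⟨V, hV, t, ht⟩ := hI (f x)
  obtain ⟨_, ⟨W, hW, rfl⟩, hxW, hWO⟩ :=
    X.isBasis_affineOpens.exists_subset_of_mem_open (show x ∈ f ⁻¹ᵁ V.1 from hV) (f ⁻¹ᵁ V.1).2
  refine ⟨⟨W, hW⟩, hxW, (f.appLE V.1 W hWO).hom t, ?_⟩
  rw [comap_ideal I f ⟨W, hW⟩ V hWO, ht, Ideal.map_span, Set.image_singleton]

theorem isUnit_app_of_comap_eq_top {U G : Scheme.{u}} (j : U ⟶ G) (J : G.IdealSheafData)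
    (hJ : J.comap j = ⊤) (V : G.affineOpens) (b : Γ(G, V.1)) (hb : J.ideal V = Ideal.span {b}) :
    IsUnit (j.app V.1 b) := by
  apply RingedSpace.isUnit_of_isUnit_germ
  intro x hx
  obtain ⟨_, ⟨W, hW, rfl⟩, hxW, hWO⟩ :=
    U.isBasis_affineOpens.exists_subset_of_mem_open hx (j ⁻¹ᵁ V.1).2
  have h := comap_ideal J j ⟨W, hW⟩ V hWO
  rw [hJ, hb, Ideal.map_span, Set.image_singleton] at h
  have h1 : IsUnit (j.appLE V.1 W hWO b) := Ideal.span_singleton_eq_top.mp h.symm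
  have h2 := h1.map (U.presheaf.germ W x hxW).hom
  convert h2 using 1
  exact (TopCat.Presheaf.germ_res_apply U.presheaf (homOfLE hWO) x hxW (j.app V.1 b)).symm

theorem comap_le_comap_normalization_aux {U N G : Scheme.{u}} (τ : U ⟶ N) (q : N ⟶ G)
    [QuasiCompact τ] [IsSchemeTheoreticallyDominant τ] [UniversallyClosed q]
    [QuasiCompact (τ ≫ q)] [QuasiSeparated (τ ≫ q)]
    (I J : G.IdealSheafData) (hJ : IsLocallyPrincipal J) (hJU : J.comap (τ ≫ q) = ⊤)
    (H : I.comap q ≤ J.comap q) :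
    I.comap (τ ≫ q).fromNormalization ≤ J.comap (τ ≫ q).fromNormalization := by
  rw [← Scheme.IdealSheafData.le_map_iff_comap_le]
  choose V hxV b hb using hJ
  apply Scheme.IdealSheafData.le_of_iSup_eq_top V
  · exact top_le_iff.mp fun x _ => TopologicalSpace.Opens.mem_iSup.mpr ⟨x, hxV x⟩
  intro x a ha
  rw [Scheme.IdealSheafData.ideal_map_of_isAffineHom]
  have hunit : IsUnit (τ.app (q ⁻¹ᵁ (V x).1) (q.app (V x).1 (b x))) := by
    have := isUnit_app_of_comap_eq_top (τ ≫ q) J hJU (V x) (b x) (hb x)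
    rw [Scheme.Hom.comp_app] at this
    exact this
  obtain ⟨c, hc⟩ := exists_eq_mul_of_locally (q ⁻¹ᵁ (V x).1) (q.app (V x).1 a) (q.app (V x).1 (b x))
    (by
      intro W h y hy
      apply τ.app_injective W
      have h1 := congrArg (τ.app W) hy
      rw [map_mul, map_zero] at h1
      rw [map_zero]
      have h2 := hunit.map (U.presheaf.map (homOfLE (τ.preimage_mono h)).op).hom
      have h3 := ConcreteCategory.congr_hom (τ.naturality (homOfLE h).op) (q.app (V x).1 (b x))
      refine (IsUnit.mul_left_eq_zero ?_).mp h1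
      exact h3 ▸ h2)
    (by
      intro W h
      have h1 := H W (show q.appLE (V x).1 W.1 h a ∈ _ by
        rw [comap_ideal I q W (V x) h]; exact Ideal.mem_map_of_mem _ ha)
      rw [comap_ideal J q W (V x) h, hb x, Ideal.map_span, Set.image_singleton] at h1
      exact h1)
  -- the quotient is integral over the sections on `V x`
  have hint : (q.app (V x).1).hom.IsIntegral := by
    have : IsAffine (V x).1 := (V x).2
    have h1 := isIntegral_appTop_of_universallyClosed (q ∣_ (V x).1)
    have h2 : q.app (V x).1 = (V x).1.topIso.inv ≫ (q ∣_ (V x).1).appTop ≫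
        (q ⁻¹ᵁ (V x).1).topIso.hom := by
      rw [← Scheme.Hom.resLE_eq_morphismRestrict,
        show (q.resLE (V x).1 (q ⁻¹ᵁ (V x).1) le_rfl).appTop = _ from
          Scheme.Hom.resLE_app_top q le_rfl]
      simp only [Category.assoc, Iso.inv_hom_id_assoc, Iso.inv_hom_id, Category.comp_id,
        Scheme.Hom.appLE_eq_app]
    rw [h2]
    exact RingHom.isIntegral_respectsIso.1 _ (q ⁻¹ᵁ (V x).1).topIso.commRingCatIsoToRingEquiv
      (RingHom.isIntegral_respectsIso.2 _ (V x).1.topIso.symm.commRingCatIsoToRingEquiv h1)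
  let : Algebra Γ(G, (V x).1) Γ(U, (τ ≫ q) ⁻¹ᵁ (V x).1) := ((τ ≫ q).app (V x).1).hom.toAlgebra
  let t : Γ(U, (τ ≫ q) ⁻¹ᵁ (V x).1) := τ.app (q ⁻¹ᵁ (V x).1) c
  have ht : t ∈ integralClosure Γ(G, (V x).1) Γ(U, (τ ≫ q) ⁻¹ᵁ (V x).1) := by
    have h1 : ((τ.app (q ⁻¹ᵁ (V x).1)).hom.comp (q.app (V x).1).hom).IsIntegralElem t :=
      (hint c).map (τ.app (q ⁻¹ᵁ (V x).1)).hom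
    have h2 : ((τ ≫ q).app (V x).1).hom =
        (τ.app (q ⁻¹ᵁ (V x).1)).hom.comp (q.app (V x).1).hom := by
      rw [Scheme.Hom.comp_app]; rfl
    change ((τ ≫ q).app (V x).1).hom.IsIntegralElem t
    rw [h2]
    exact h1
  rw [comap_ideal J _ ⟨_, (V x).2.preimage (τ ≫ q).fromNormalization⟩ (V x) le_rfl, hb x,
    Ideal.map_span, Set.image_singleton, Ideal.mem_comap, Ideal.mem_span_singleton']
  refine ⟨((τ ≫ q).normalizationObjIso (V x).2).inv ⟨t, ht⟩, ?_⟩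
  rw [Scheme.Hom.appLE_eq_app, Scheme.Hom.fromNormalization_app _ (V x).2]
  change _ * ((τ ≫ q).normalizationObjIso (V x).2).inv (algebraMap _ _ (b x)) =
    ((τ ≫ q).normalizationObjIso (V x).2).inv (algebraMap _ _ a)
  rw [← map_mul]
  congr 1
  apply Subtype.ext
  have h4 := congrArg (τ.app (q ⁻¹ᵁ (V x).1)) hc
  rw [map_mul] at h4
  have h5 : ∀ s, (τ ≫ q).app (V x).1 s = τ.app (q ⁻¹ᵁ (V x).1) (q.app (V x).1 s) := by
    intro s; rw [Scheme.Hom.comp_app]; rfl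
  change t * (τ ≫ q).app (V x).1 (b x) = (τ ≫ q).app (V x).1 a
  rw [h5, h5]
  exact h4.symm

theorem comap_le_comap_normalization {U Z G : Scheme.{u}} (i : U ⟶ Z) (π : Z ⟶ G) (j : U ⟶ G)
    [QuasiCompact i] [QuasiSeparated i] [QuasiCompact j] [QuasiSeparated j] [UniversallyClosed π]
    (hj : i ≫ π = j) (I J : G.IdealSheafData) (hJ : IsLocallyPrincipal J) (hJU : J.comap j = ⊤)
    (H : I.comap (i.fromNormalization ≫ π) ≤ J.comap (i.fromNormalization ≫ π)) :
    I.comap j.fromNormalization ≤ J.comap j.fromNormalization := by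
  obtain rfl : i.toNormalization ≫ i.fromNormalization ≫ π = j := by simp [hj]
  have : IsSchemeTheoreticallyDominant i.toNormalization := ⟨by simp⟩
  exact comap_le_comap_normalization_aux i.toNormalization (i.fromNormalization ≫ π) I J hJ hJU H

theorem comap_le_comap_of_square {U U' Z Z' : Scheme.{u}} (i : U ⟶ Z) (i' : U' ⟶ Z')
    [QuasiCompact i] [QuasiSeparated i] [QuasiCompact i'] [QuasiSeparated i']
    (a : U' ⟶ U) (b : Z' ⟶ Z) (h : i' ≫ b = a ≫ i) (I J : Z.IdealSheafData)
    (H : I.comap i.fromNormalization ≤ J.comap i.fromNormalization) :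
    I.comap (i'.fromNormalization ≫ b) ≤ J.comap (i'.fromNormalization ≫ b) := by
  let c : i'.normalization ⟶ pullback i.fromNormalization b :=
    i'.normalizationDesc (pullback.lift (a ≫ i.toNormalization) i' (by rw [Category.assoc, Scheme.Hom.toNormalization_fromNormalization, h]))
      (pullback.snd _ _) (pullback.lift_snd _ _ _).symm
  have hc : i'.fromNormalization ≫ b = (c ≫ pullback.fst _ _) ≫ i.fromNormalization := by
    have : c ≫ pullback.snd _ _ = i'.fromNormalization := Scheme.Hom.normalizationDesc_comp ..
    rw [Category.assoc, pullback.condition, reassoc_of% this]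
  rw [hc, Scheme.IdealSheafData.comap_comp _ _ i.fromNormalization,
    Scheme.IdealSheafData.comap_comp _ _ i.fromNormalization]
  exact Scheme.IdealSheafData.comap_mono _ H

/-- `I` is the ideal sheaf of an effective Cartier divisor: locally it is generated by one
nonzerodivisor. -/
def IsEffectiveCartier {X : Scheme.{u}} (I : X.IdealSheafData) : Prop :=
  ∀ x : X, ∃ U : X.affineOpens, x ∈ U.1 ∧
    ∃ t : Γ(X, U.1), t ∈ nonZeroDivisors Γ(X, U.1) ∧ I.ideal U = Ideal.span {t}

theorem IsEffectiveCartier.isLocallyPrincipal {X : Scheme.{u}} {I : X.IdealSheafData}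
    (h : IsEffectiveCartier I) : IsLocallyPrincipal I := fun x =>
  let ⟨U, hx, t, _, ht⟩ := h x
  ⟨U, hx, t, ht⟩

/-- The complement of the support of the closed subscheme defined by `I`. -/
def offSupport {X : Scheme.{u}} (I : X.IdealSheafData) : X.Opens :=
  ⟨(I.support : Set X)ᶜ, I.support.isClosed.isOpen_compl⟩

/-- A modulus pair over the field `k`: a separated scheme of finite type over `k` with an effective
Cartier divisor (given by its ideal sheaf) whose complement is smooth over `k`. -/
structure ModulusPair (k : Type u) [Field k] where
  /-- the ambient space -/
  space : Scheme.{u}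
  /-- the structure morphism of the ambient space -/
  str : space ⟶ Spec (CommRingCat.of k)
  [isSeparated : IsSeparated str]
  [locallyOfFiniteType : LocallyOfFiniteType str]
  [quasiCompact : QuasiCompact str]
  /-- the modulus divisor -/
  divisor : space.IdealSheafData
  isEffectiveCartier : IsEffectiveCartier divisor
  smooth : Smooth ((offSupport divisor).ι ≫ str)

namespace ModulusPair

attribute [instance] ModulusPair.isSeparated ModulusPair.locallyOfFiniteType
  ModulusPair.quasiCompact

variable {k : Type u} [Field k]

/-- The interior of a modulus pair: the complement of the support of the modulus divisor. -/
def interior (M : ModulusPair k) : M.space.Opens := offSupport M.divisor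

instance (M : ModulusPair k) : IsLocallyNoetherian M.space :=
  LocallyOfFiniteType.isLocallyNoetherian M.str

theorem comap_divisor_interior (M : ModulusPair k) : M.divisor.comap M.interior.ι = ⊤ := by
  rw [← Scheme.IdealSheafData.support_eq_bot_iff, Scheme.IdealSheafData.support_comap]
  ext x
  simp only [TopologicalSpace.Closeds.coe_preimage, Set.mem_preimage, SetLike.mem_coe,
    TopologicalSpace.Closeds.coe_bot, Set.mem_empty_iff_false, iff_false]
  exact x.2

/-- The morphism from the interior of `M` to the product of the ambient spaces given by the
inclusion and `φ`. -/
noncomputable def graphMap {M N : ModulusPair k} (φ : M.interior.toScheme ⟶ N.interior.toScheme)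
    (hφ : φ ≫ N.interior.ι ≫ N.str = M.interior.ι ≫ M.str) :
    M.interior.toScheme ⟶ pullback M.str N.str :=
  pullback.lift M.interior.ι (φ ≫ N.interior.ι) (by simp [hφ])

instance {M N : ModulusPair k} (φ : M.interior.toScheme ⟶ N.interior.toScheme)
    (hφ : φ ≫ N.interior.ι ≫ N.str = M.interior.ι ≫ M.str) : QuasiCompact (graphMap φ hφ) := by
  have : QuasiCompact (graphMap φ hφ ≫ pullback.fst _ _) := by
    rw [graphMap, pullback.lift_fst]; infer_instance
  exact .of_comp _ (pullback.fst M.str N.str)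

instance {M N : ModulusPair k} (φ : M.interior.toScheme ⟶ N.interior.toScheme)
    (hφ : φ ≫ N.interior.ι ≫ N.str = M.interior.ι ≫ M.str) :
    QuasiSeparated (graphMap φ hφ).toImage := by
  have : QuasiSeparated ((graphMap φ hφ).toImage ≫ (graphMap φ hφ).imageι ≫ pullback.fst _ _) := by
    rw [Scheme.Hom.toImage_imageι_assoc, graphMap, pullback.lift_fst]; infer_instance
  exact .of_comp _ ((graphMap φ hφ).imageι ≫ pullback.fst M.str N.str)

/-- An admissible morphism of modulus pairs is a morphism of the interiors over `k` satisfying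
the properness and the modulus condition. Here `(graphMap φ w).image` is the closure `Γ` of the
graph, and `(graphMap φ w).toImage.fromNormalization : Γ^N ⟶ Γ` is its normalization: the integral
closure of `Γ` in its dense open subscheme `M.interior`, which is smooth over `k`, hence normal.
An inequality `D ≥ E` of effective Cartier divisors is the inclusion of the ideal sheaf of `D` in
that of `E`. -/
@[ext]
structure Hom (M N : ModulusPair k) where
  /-- the underlying morphism of the interiors -/
  base : M.interior.toScheme ⟶ N.interior.toScheme
  w : base ≫ N.interior.ι ≫ N.str = M.interior.ι ≫ M.str
  proper : IsProper ((graphMap base w).imageι ≫ pullback.fst M.str N.str)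
  modulus :
    M.divisor.comap ((graphMap base w).toImage.fromNormalization ≫ (graphMap base w).imageι ≫
        pullback.fst M.str N.str) ≤
      N.divisor.comap ((graphMap base w).toImage.fromNormalization ≫ (graphMap base w).imageι ≫
        pullback.snd M.str N.str)

theorem graph_fst {M N : ModulusPair k} (φ : M.interior.toScheme ⟶ N.interior.toScheme)
    (hφ : φ ≫ N.interior.ι ≫ N.str = M.interior.ι ≫ M.str) :
    (graphMap φ hφ).toImage ≫ (graphMap φ hφ).imageι ≫ pullback.fst M.str N.str
      = M.interior.ι := by
  rw [Scheme.Hom.toImage_imageι_assoc, graphMap, pullback.lift_fst]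

theorem graph_snd {M N : ModulusPair k} (φ : M.interior.toScheme ⟶ N.interior.toScheme)
    (hφ : φ ≫ N.interior.ι ≫ N.str = M.interior.ι ≫ M.str) :
    (graphMap φ hφ).toImage ≫ (graphMap φ hφ).imageι ≫ pullback.snd M.str N.str
      = φ ≫ N.interior.ι := by
  rw [Scheme.Hom.toImage_imageι_assoc, graphMap, pullback.lift_snd]

theorem id_w (M : ModulusPair k) :
    𝟙 M.interior.toScheme ≫ M.interior.ι ≫ M.str = M.interior.ι ≫ M.str := Category.id_comp _

theorem id_admissible (M : ModulusPair k) :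
    IsProper ((graphMap _ (id_w M)).imageι ≫ pullback.fst M.str M.str) ∧
    M.divisor.comap ((graphMap _ (id_w M)).toImage.fromNormalization ≫
        (graphMap _ (id_w M)).imageι ≫ pullback.fst M.str M.str) ≤
      M.divisor.comap ((graphMap _ (id_w M)).toImage.fromNormalization ≫
        (graphMap _ (id_w M)).imageι ≫ pullback.snd M.str M.str) := by
  have w := id_w M
  have h1 : graphMap (𝟙 M.interior.toScheme) w = M.interior.ι ≫ pullback.diagonal M.str := by
    apply pullback.hom_ext
    · rw [graphMap, pullback.lift_fst, Category.assoc, pullback.diagonal_fst, Category.comp_id]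
    · rw [graphMap, pullback.lift_snd, Category.assoc, pullback.diagonal_snd, Category.comp_id,
        Category.id_comp]
  have h2 : (pullback.diagonal M.str).ker ≤ (graphMap (𝟙 M.interior.toScheme) w).imageι.ker := by
    rw [Scheme.IdealSheafData.ker_subschemeι, h1]
    exact Scheme.Hom.le_ker_comp _ _
  let l := IsClosedImmersion.lift (pullback.diagonal M.str)
    (graphMap (𝟙 M.interior.toScheme) w).imageι h2
  have hl : l ≫ pullback.diagonal M.str = (graphMap (𝟙 M.interior.toScheme) w).imageι :=
    IsClosedImmersion.lift_fac _ _ _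
  have hf : (graphMap (𝟙 M.interior.toScheme) w).imageι ≫ pullback.fst M.str M.str = l := by
    rw [← hl]; simp
  have hs : (graphMap (𝟙 M.interior.toScheme) w).imageι ≫ pullback.snd M.str M.str = l := by
    rw [← hl]; simp
  constructor
  · rw [hf]
    have : IsClosedImmersion (l ≫ pullback.diagonal M.str) := by rw [hl]; infer_instance
    have : IsClosedImmersion l := .of_comp l (pullback.diagonal M.str)
    infer_instance
  · rw [hf, hs]

section comp

variable {M N L : ModulusPair k} (f : Hom M N) (g : Hom N L)

theorem comp_w : (f.base ≫ g.base) ≫ L.interior.ι ≫ L.str = M.interior.ι ≫ M.str := by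
  rw [Category.assoc, g.w, f.w]

theorem comp_admissible :
    IsProper ((graphMap _ (comp_w f g)).imageι ≫ pullback.fst M.str L.str) ∧
    M.divisor.comap ((graphMap _ (comp_w f g)).toImage.fromNormalization ≫
        (graphMap _ (comp_w f g)).imageι ≫ pullback.fst M.str L.str) ≤
      L.divisor.comap ((graphMap _ (comp_w f g)).toImage.fromNormalization ≫
        (graphMap _ (comp_w f g)).imageι ≫ pullback.snd M.str L.str) := by
  set F := graphMap f.base f.w with hF
  set G := graphMap g.base g.w with hG
  set H := graphMap (f.base ≫ g.base) (comp_w f g) with hH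
  have := f.proper
  have := g.proper
  -- the fibre product of the two graph closures over the ambient space of `N`
  let Z := pullback (F.imageι ≫ pullback.snd M.str N.str) (G.imageι ≫ pullback.fst N.str L.str)
  let s : Z ⟶ pullback M.str L.str := pullback.lift
    (pullback.fst _ _ ≫ F.imageι ≫ pullback.fst M.str N.str)
    (pullback.snd _ _ ≫ G.imageι ≫ pullback.snd N.str L.str) (by
      simp only [Category.assoc]
      rw [pullback.condition, ← pullback.condition (f := N.str) (g := L.str)]
      have := pullback.condition (f := F.imageι ≫ pullback.snd M.str N.str)
        (g := G.imageι ≫ pullback.fst N.str L.str)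
      simpa using congrArg (· ≫ N.str) this)
  have hs : UniversallyClosed s := by
    have : UniversallyClosed (s ≫ pullback.fst M.str L.str) := by
      rw [pullback.lift_fst]; infer_instance
    exact .of_comp_of_isSeparated s (pullback.fst M.str L.str)
  let m : M.interior.toScheme ⟶ Z := pullback.lift F.toImage (f.base ≫ G.toImage) (by
    rw [graph_snd, Category.assoc, graph_fst])
  have hmf : m ≫ pullback.fst _ _ = F.toImage := pullback.lift_fst _ _ _
  have hmg : m ≫ pullback.snd _ _ = f.base ≫ G.toImage := pullback.lift_snd _ _ _
  have hsf : s ≫ pullback.fst _ _ = pullback.fst _ _ ≫ F.imageι ≫ pullback.fst M.str N.str :=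
    pullback.lift_fst _ _ _
  have hsg : s ≫ pullback.snd _ _ = pullback.snd _ _ ≫ G.imageι ≫ pullback.snd N.str L.str :=
    pullback.lift_snd _ _ _
  have hms : m ≫ s = H := by
    apply pullback.hom_ext
    · rw [Category.assoc, hsf, reassoc_of% hmf, graph_fst]
      exact (pullback.lift_fst _ _ _).symm
    · rw [Category.assoc, hsg, reassoc_of% hmg, graph_snd, ← Category.assoc]
      exact (pullback.lift_snd _ _ _).symm
  -- its part over the graph closure of the composite
  let Z' := pullback s H.imageι
  let π : Z' ⟶ H.image := pullback.snd _ _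
  let i : M.interior.toScheme ⟶ Z' := pullback.lift m H.toImage (by rw [hms, Scheme.Hom.toImage_imageι])
  have hiπ : i ≫ π = H.toImage := pullback.lift_snd _ _ _
  have him : i ≫ pullback.fst _ _ = m := pullback.lift_fst _ _ _
  have hqc : QuasiCompact i := by
    have : QuasiCompact (i ≫ pullback.fst s H.imageι ≫ pullback.fst _ _ ≫ F.imageι ≫
        pullback.fst M.str N.str) := by
      rw [reassoc_of% him, reassoc_of% hmf, graph_fst]; infer_instance
    exact .of_comp i (pullback.fst s H.imageι ≫ pullback.fst _ _ ≫ F.imageι ≫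
        pullback.fst M.str N.str)
  have hqs : QuasiSeparated i := by
    have : QuasiSeparated (i ≫ π) := by rw [hiπ]; infer_instance
    exact .of_comp i π
  have hsurj : Surjective π := by
    have : IsDominant (i ≫ π) := by rw [hiπ]; infer_instance
    have : IsDominant π := .of_comp i π
    exact surjective_of_isDominant_of_isClosed_range π π.isClosedMap.isClosed_range
  constructor
  · have : UniversallyClosed (H.imageι ≫ pullback.fst M.str L.str) := by
      have : UniversallyClosed (π ≫ H.imageι ≫ pullback.fst M.str L.str) := by
        rw [← pullback.condition_assoc, hsf]; infer_instance
      exact .of_comp_surjective π _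
    exact { }
  · rw [Scheme.IdealSheafData.comap_comp, Scheme.IdealSheafData.comap_comp _ _ (_ ≫ pullback.snd _ _)]
    apply comap_le_comap_normalization i π H.toImage hiπ
    · exact L.isEffectiveCartier.isLocallyPrincipal.comap _
    · rw [← Scheme.IdealSheafData.comap_comp, graph_snd, Scheme.IdealSheafData.comap_comp,
        comap_divisor_interior, Scheme.IdealSheafData.comap_top]
    · have h1 := comap_le_comap_of_square F.toImage i (𝟙 _) (pullback.fst _ _ ≫ pullback.fst _ _)
        (by rw [reassoc_of% him, hmf, Category.id_comp]) (M.divisor.comap (F.imageι ≫ pullback.fst M.str N.str))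
          (N.divisor.comap (F.imageι ≫ pullback.snd M.str N.str)) (by
            rw [← Scheme.IdealSheafData.comap_comp, ← Scheme.IdealSheafData.comap_comp]
            exact f.modulus)
      have h2 := comap_le_comap_of_square G.toImage i f.base (pullback.fst _ _ ≫ pullback.snd _ _)
        (by rw [reassoc_of% him, hmg]) (N.divisor.comap (G.imageι ≫ pullback.fst N.str L.str))
          (L.divisor.comap (G.imageι ≫ pullback.snd N.str L.str)) (by
            rw [← Scheme.IdealSheafData.comap_comp, ← Scheme.IdealSheafData.comap_comp]
            exact g.modulus)
      have e1 : (i.fromNormalization ≫ π) ≫ H.imageι ≫ pullback.fst M.str L.str =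
          (i.fromNormalization ≫ pullback.fst _ _ ≫ pullback.fst _ _) ≫ F.imageι ≫
            pullback.fst M.str N.str := by
        simp only [Category.assoc]
        rw [← pullback.condition_assoc, hsf]
      have e2 : (i.fromNormalization ≫ π) ≫ H.imageι ≫ pullback.snd M.str L.str =
          (i.fromNormalization ≫ pullback.fst _ _ ≫ pullback.snd _ _) ≫ G.imageι ≫
            pullback.snd N.str L.str := by
        simp only [Category.assoc]
        rw [← pullback.condition_assoc, hsg]
      have e3 : (i.fromNormalization ≫ pullback.fst s H.imageι ≫ pullback.fst _ _) ≫ F.imageι ≫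
            pullback.snd M.str N.str =
          (i.fromNormalization ≫ pullback.fst _ _ ≫ pullback.snd _ _) ≫ G.imageι ≫
            pullback.fst N.str L.str := by
        simp only [Category.assoc]
        rw [pullback.condition]
      rw [← Scheme.IdealSheafData.comap_comp, ← Scheme.IdealSheafData.comap_comp] at h1 h2 ⊢
      rw [e1, e2]
      rw [e3] at h1
      exact h1.trans h2

end comp

/-- The category of modulus pairs and admissible morphisms. -/
instance : Category (ModulusPair k) where
  Hom M N := Hom M N
  id M := ⟨𝟙 _, id_w M, (id_admissible M).1, (id_admissible M).2⟩
  comp f g := ⟨f.base ≫ g.base, comp_w f g, (comp_admissible f g).1, (comp_admissible f g).2⟩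
  id_comp _ := Hom.ext (Category.id_comp _)
  comp_id _ := Hom.ext (Category.comp_id _)
  assoc _ _ _ := Hom.ext (Category.assoc _ _ _)

end ModulusPair

section Squares

/-! Notation for the corners of a square: `X₁, X₂, X₃, X₄` are the corners
`(00), (01), (10), (11)`, and `f₁₂, f₁₃, f₂₄, f₃₄` are `v, q, p, u`. -/

variable {C : Type*} [Category C]

/-- A decomposition `M ×_N M = M ⊔ OD(f)` of the self fibre product of `f : M ⟶ N`, where `M` is
embedded by the diagonal: a fibre product `prod` of `f` with itself and an object `obj = OD(f)`
with a morphism `ι` to `prod` such that the diagonal and `ι` exhibit `prod` as the coproduct of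
`M` and `OD(f)`. -/
structure OffDiagonal {M N : C} (f : M ⟶ N) where
  /-- the fibre product `M ×_N M` -/
  prod : C
  /-- the first projection -/
  fst : prod ⟶ M
  /-- the second projection -/
  snd : prod ⟶ M
  isPullback : IsPullback fst snd f f
  /-- the off-diagonal `OD(f)` -/
  obj : C
  /-- the inclusion of the off-diagonal -/
  ι : obj ⟶ prod
  isCoproduct : Nonempty (IsColimit (BinaryCofan.mk (isPullback.lift (𝟙 M) (𝟙 M) rfl) ι))

/-- The morphism on self fibre products induced by a morphism from `f` to `g`. -/
noncomputable def OffDiagonal.prodMap {M N M' N' : C} {f : M ⟶ N} {g : M' ⟶ N'}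
    (D : OffDiagonal f) (E : OffDiagonal g) (s : M ⟶ M') (t : N ⟶ N') (h : s ≫ g = f ≫ t) :
    D.prod ⟶ E.prod :=
  E.isPullback.lift (D.fst ≫ s) (D.snd ≫ s) (by
    rw [Category.assoc, Category.assoc, h, ← Category.assoc, ← Category.assoc, D.isPullback.w])

/-- The morphism `OD(q) ⟶ OD(p)` induced by a square is an isomorphism. The off-diagonals are
unique up to unique isomorphism, and the condition is stated for all choices of them. -/
def OffDiagonalIso (T : Square C) : Prop :=
  ∀ (D : OffDiagonal T.f₁₃) (E : OffDiagonal T.f₂₄),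
    ∃ e : D.obj ⟶ E.obj, e ≫ E.ι = D.ι ≫ D.prodMap E T.f₁₂ T.f₃₄ T.fac ∧ IsIso e

/-- The derived square built from the diagonals of `q` and `p`. -/
noncomputable def derivedSquare (T : Square C) [HasPullback T.f₂₄ T.f₂₄] [HasPullback T.f₁₃ T.f₁₃] :
    Square C where
  f₁₂ := T.f₁₂
  f₁₃ := pullback.diagonal T.f₁₃
  f₂₄ := pullback.diagonal T.f₂₄
  f₃₄ := pullback.map T.f₁₃ T.f₁₃ T.f₂₄ T.f₂₄ T.f₁₂ T.f₁₂ T.f₃₄ T.fac.symm T.fac.symm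
  fac := by
    apply pullback.hom_ext
    · simp only [Category.assoc, pullback.diagonal_fst, Category.comp_id, pullback.map,
        pullback.lift_fst, pullback.diagonal_fst_assoc]
    · simp only [Category.assoc, pullback.diagonal_snd, Category.comp_id, pullback.map,
        pullback.lift_snd, pullback.diagonal_snd_assoc]

end Squares

section CDStructure

universe v w

variable {C : Type w} [Category.{v} C]

/-- The Grothendieck topology associated with a class of squares: the smallest topology such that
the empty sieve covers the initial objects and the pair `u, p` covers the lower right corner of
each square of the class. -/
def cdTopology (P : ObjectProperty (Square C)) : GrothendieckTopology C :=
  sInf {J | (∀ X : C, Nonempty (IsInitial X) → ⊥ ∈ J X) ∧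
    ∀ T : Square C, P T → Sieve.ofTwoArrows T.f₃₄ T.f₂₄ ∈ J T.X₄}

/-- The sheaf of sets represented by an object, for the topology associated with `P`. -/
noncomputable def cdRepr (P : ObjectProperty (Square C)) :
    C ⥤ Sheaf (cdTopology P) (Type (max w v)) :=
  uliftYoneda.{w} ⋙ presheafToSheaf (cdTopology P) (Type (max w v))

instance (P : ObjectProperty (Square C)) :
    HasBinaryCoproducts (Sheaf (cdTopology P) (Type (max w v))) := by
  have : HasColimitsOfShape (Discrete WalkingPair) (Type (max w v)) := inferInstance
  have : HasSheafify (cdTopology P) (Type (max w v)) := inferInstance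
  exact CategoryTheory.Sheaf.instHasColimitsOfShape

instance (P : ObjectProperty (Square C)) :
    HasPullbacks (Sheaf (cdTopology P) (Type (max w v))) :=
  inferInstance

/-- A cd-structure is a class of commutative squares closed under isomorphism. It is regular if for
each of its squares `T`, the square is cartesian, `u` is a monomorphism, and the morphism of sheaves
`ρ(T₂) ⊔ ρ(T₁) ×_{ρ(T₃)} ρ(T₁) ⟶ ρ(T₂) ×_{ρ(T₄)} ρ(T₂)` given by the diagonal and `v` is
surjective. -/
structure IsRegularCDStructure (P : ObjectProperty (Square C)) : Prop where
  closedUnderIso : P.IsClosedUnderIsomorphisms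
  isPullback : ∀ T, P T → T.IsPullback
  mono : ∀ T, P T → Mono T.f₃₄
  surjective : ∀ T, P T → Sheaf.IsLocallySurjective
    (coprod.desc (pullback.diagonal ((cdRepr P).map T.f₂₄))
      (pullback.map ((cdRepr P).map T.f₁₃) ((cdRepr P).map T.f₁₃)
        ((cdRepr P).map T.f₂₄) ((cdRepr P).map T.f₂₄)
        ((cdRepr P).map T.f₁₂) ((cdRepr P).map T.f₁₂) ((cdRepr P).map T.f₃₄)
        (by rw [← Functor.map_comp, ← Functor.map_comp, T.fac])
        (by rw [← Functor.map_comp, ← Functor.map_comp, T.fac])))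

end CDStructure

/-- The reduced closed subscheme structure on the complement of an open subset. -/
noncomputable def reducedCompl {X : Scheme.{u}} (U : X.Opens) : X.IdealSheafData :=
  Scheme.IdealSheafData.vanishingIdeal ⟨(U : Set X)ᶜ, U.isOpen.isClosed_compl⟩

/-- Elementary Nisnevich squares of schemes: cartesian squares with horizontal open immersions and
vertical étale morphisms such that the right vertical morphism induces an isomorphism between the
reduced complements of the open immersions. -/
def IsElementaryNisnevich (S : Square Scheme.{u}) : Prop :=
  S.IsPullback ∧ Etale S.f₁₃ ∧ Etale S.f₂₄ ∧
  ∃ (_ : IsOpenImmersion S.f₁₂) (_ : IsOpenImmersion S.f₃₄)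
    (e : (reducedCompl S.f₁₂.opensRange).subscheme ⟶ (reducedCompl S.f₃₄.opensRange).subscheme),
      e ≫ (reducedCompl S.f₃₄.opensRange).subschemeι
        = (reducedCompl S.f₁₂.opensRange).subschemeι ≫ S.f₂₄ ∧ IsIso e

namespace ModulusPair

variable {k : Type u} [Field k]

/-- `φ` is an extension of `f` to the ambient spaces that makes `f` a minimal morphism: the modulus
divisor of `M` is the pullback of that of `N`. -/
structure IsMinimalExtension {M N : ModulusPair k} (f : M ⟶ N) (φ : M.space ⟶ N.space) : Prop where
  w : φ ≫ N.str = M.str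
  extends_base : M.interior.ι ≫ φ = Hom.base f ≫ N.interior.ι
  divisor_eq : M.divisor = N.divisor.comap φ

/-- The squares of ambient minimal morphisms of modulus pairs whose ambient spaces form an
elementary Nisnevich square. -/
def IsFinNisnevichSquare (S : Square (ModulusPair k)) : Prop :=
  ∃ (a₁₂ : S.X₁.space ⟶ S.X₂.space) (a₁₃ : S.X₁.space ⟶ S.X₃.space)
    (a₂₄ : S.X₂.space ⟶ S.X₄.space) (a₃₄ : S.X₃.space ⟶ S.X₄.space)
    (h : a₁₂ ≫ a₂₄ = a₁₃ ≫ a₃₄),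
    IsMinimalExtension S.f₁₂ a₁₂ ∧ IsMinimalExtension S.f₁₃ a₁₃ ∧
    IsMinimalExtension S.f₂₄ a₂₄ ∧ IsMinimalExtension S.f₃₄ a₃₄ ∧
    IsElementaryNisnevich ⟨a₁₂, a₁₃, a₂₄, a₃₄, h⟩

/-- The squares of modulus pairs isomorphic to a square of ambient minimal morphisms whose ambient
spaces form an elementary Nisnevich square. -/
def IsNisnevichSquare (S : Square (ModulusPair k)) : Prop :=
  ∃ S' : Square (ModulusPair k), IsFinNisnevichSquare S' ∧ Nonempty (S' ≅ S)

/-- A modulus pair is proper if its ambient space is proper over `k`. -/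
def proper (k : Type u) [Field k] : ObjectProperty (ModulusPair k) := fun M => IsProper M.str

end ModulusPair

/-- The category of proper modulus pairs. -/
abbrev MSm (k : Type u) [Field k] := (ModulusPair.proper k).FullSubcategory

/-- The cd-structure on the category of proper modulus pairs: cartesian squares `T` that receive a
morphism from a Nisnevich square `S` of modulus pairs with proper lower right corner, such that the
morphism is an isomorphism on all interiors and on the lower right corner, and such that the
induced morphism of off-diagonals is an isomorphism. -/
def MVSquare (k : Type u) [Field k] : ObjectProperty (Square (MSm k)) := fun T =>
  T.IsPullback ∧
  (∃ S : Square (ModulusPair k), ModulusPair.IsNisnevichSquare S ∧ ModulusPair.proper k S.X₄ ∧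
    ∃ φ : S ⟶ T.map (ModulusPair.proper k).ι,
      IsIso (ModulusPair.Hom.base φ.τ₁) ∧ IsIso (ModulusPair.Hom.base φ.τ₂) ∧
      IsIso (ModulusPair.Hom.base φ.τ₃) ∧ IsIso (ModulusPair.Hom.base φ.τ₄) ∧ IsIso φ.τ₄) ∧
  OffDiagonalIso T

end MotivicModulus

/-!
# The cd-structure on proper modulus pairs

**Admissibility.** Everything rests on a flexible form of the condition defining morphisms: a
morphism `φ : M° ⟶ N°` of interiors is admissible as soon as there is *some* `Z` with maps
`p : Z ⟶ M̄` and `q : Z ⟶ N̄`, with `p` universally closed and separated, to which `M°` maps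
compatibly with `φ`, and on which `M^∞|_Z ≥ N^∞|_Z` (`exists_hom_of_correspondence`). The
normalized closure of the graph is such a `Z` (`exists_correspondence`). Such correspondences can be
pulled back and glued without recomputing closures or normalizations. In this way a clopen
decomposition of the ambient space becomes a coproduct decomposition (`exists_desc`,
`hom_ext_of_isCompl`), and a morphism whose interior lands in a clopen part factors through it
(`exists_lift_restrict`).

**Fibre products.** Let `f : M ⟶ N` be a morphism of proper modulus pairs with `f°` étale, and let
`U = M° ×_{N°} M°`, which is smooth, and closed in `M° ×_k M°`. The ambient space of the fibre
product should carry as divisor the supremum of the two pullbacks of `M^∞`, and the supremum of two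
Cartier divisors is Cartier where one of them is locally contained in the other. This is arranged by
blowing up the sum of the two ideals on a proper scheme to which `U` maps. The blow-up is glued from
spectra of subrings of `Γ(U, -)` generated over the base by `b / a` or `a / b`, where `a` and `b`
generate the two ideals (`BlowupIndex.ring`). Hence `U` maps to it, and it is proper by the
valuative criterion, since one of `b / a` and `a / b` lies in the valuation ring
(`isProper_blowupπ`). On the closure of `U` the intersection of the two ideals is an effective
Cartier divisor with complement `U`, and its formation commutes with every pullback
(`LocallyComparable.le_comap_inf`); the latter gives the universal property (`exists_product`).

**Off-diagonals.** As `f°` is étale and separated, its diagonal is open and closed in `U`, so it is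
classified by a morphism from `U` to two points. Putting two points as a factor into the scheme
that is blown up extends this morphism to the ambient space of the fibre product, which
decomposes accordingly into two clopen parts. The diagonal identifies `M` with the first one, and
`OD(f)` is the second one (`exists_offDiagonal`).

**The derived square.** Let `T` be in the cd-structure. The interiors of `u` and `v` are open
immersions, so `u` and `v` are monomorphisms, and the derived square is cartesian. Its vertical
morphisms are diagonals, hence monomorphisms, and the off-diagonal of a monomorphism has empty
interior and is an initial object, so the condition on off-diagonals is automatic
(`offDiagonalIso_of_mono`). It remains to find a Nisnevich square over the derived square. Let
`P = T(01) ×_{T(11)} T(01)`, with ambient space decomposed into the diagonal part `O₁` and the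
off-diagonal part `O₂`, and let `W` be the image of `T(00)°` in the interior of `P`, an open
subscheme of `O₁`. The opens `O₁` and `W ⊔ O₂` cover `P` and meet in `W`, which gives a Zariski
square. It maps to the derived square: on `W` the divisor is trivial, so that `W ≅ T(00)°` is
admissible, and `O₂` maps to `T(00) ×_{T(10)} T(00)` through the isomorphism `OD(q) ≅ OD(p)` that is
part of the definition for `T` (`exists_nisnevichSquare_derived`).

**Regularity.** Since the derived square belongs to the cd-structure, the diagonal and `v × v` form
a covering of `T(01) ×_{T(11)} T(01)`. The functor `ρ` commutes with fibre products and sends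
coverings to epimorphic families of sheaves, which is the required surjectivity
(`isLocallySurjective_of_derived`).
-/

namespace MotivicModulus

/-! ### Admissibility by correspondences -/

namespace ModulusPair

variable {k : Type u} [Field k]

/-- A morphism of interiors is admissible as soon as it is realised by some correspondence `Z`
between the ambient spaces, universally closed over the source, on which the inequality of
modulus divisors holds. -/
theorem exists_hom_of_correspondence {M N : ModulusPair k} {Z : Scheme.{u}}
    (φ : M.interior.toScheme ⟶ N.interior.toScheme)
    (i : M.interior.toScheme ⟶ Z) (p : Z ⟶ M.space) (q : Z ⟶ N.space)
    [UniversallyClosed p] [IsSeparated p]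
    (hp : i ≫ p = M.interior.ι) (hq : i ≫ q = φ ≫ N.interior.ι)
    (hk : p ≫ M.str = q ≫ N.str) (H : M.divisor.comap p ≤ N.divisor.comap q) :
    ∃ f : M ⟶ N, Hom.base f = φ := by
  have w : φ ≫ N.interior.ι ≫ N.str = M.interior.ι ≫ M.str := by
    rw [← reassoc_of% hq, ← hk, reassoc_of% hp]
  set G := graphMap φ w with hG
  let s : Z ⟶ pullback M.str N.str := pullback.lift p q hk
  have hsf : s ≫ pullback.fst _ _ = p := pullback.lift_fst _ _ _
  have hsg : s ≫ pullback.snd _ _ = q := pullback.lift_snd _ _ _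
  have hs : UniversallyClosed s := by
    have : UniversallyClosed (s ≫ pullback.fst M.str N.str) := by rw [hsf]; infer_instance
    exact .of_comp_of_isSeparated s (pullback.fst M.str N.str)
  have his : i ≫ s = G := by
    apply pullback.hom_ext
    · rw [Category.assoc, hsf, hp]; exact (pullback.lift_fst _ _ _).symm
    · rw [Category.assoc, hsg, hq]; exact (pullback.lift_snd _ _ _).symm
  -- the part of the correspondence over the closure of the graph; it surjects onto this closure
  let Z' := pullback s G.imageι
  let π : Z' ⟶ G.image := pullback.snd _ _
  let i' : M.interior.toScheme ⟶ Z' := pullback.lift i G.toImage (by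
    rw [his, Scheme.Hom.toImage_imageι])
  have hiπ : i' ≫ π = G.toImage := pullback.lift_snd _ _ _
  have hii : i' ≫ pullback.fst _ _ = i := pullback.lift_fst _ _ _
  have hqc : QuasiCompact i' := by
    have : QuasiCompact (i' ≫ pullback.fst s G.imageι ≫ p) := by
      rw [reassoc_of% hii, hp]; infer_instance
    exact .of_comp i' (pullback.fst s G.imageι ≫ p)
  have hqs : QuasiSeparated i' := by
    have : QuasiSeparated (i' ≫ π) := by rw [hiπ]; infer_instance
    exact .of_comp i' π
  have hsurj : Surjective π := by
    have : IsDominant (i' ≫ π) := by rw [hiπ]; infer_instance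
    have : IsDominant π := .of_comp i' π
    exact surjective_of_isDominant_of_isClosed_range π π.isClosedMap.isClosed_range
  refine ⟨⟨φ, w, ?_, ?_⟩, rfl⟩
  · have : UniversallyClosed (G.imageι ≫ pullback.fst M.str N.str) := by
      have : UniversallyClosed (π ≫ G.imageι ≫ pullback.fst M.str N.str) := by
        rw [← pullback.condition_assoc, hsf]; infer_instance
      exact .of_comp_surjective π _
    exact { }
  · rw [Scheme.IdealSheafData.comap_comp,
      Scheme.IdealSheafData.comap_comp _ _ (_ ≫ pullback.snd _ _)]
    -- the inequality descends from `Z'` to the normalization of the closure of the graph, since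
    -- the quotient of local equations is integral
    apply comap_le_comap_normalization i' π G.toImage hiπ
    · exact N.isEffectiveCartier.isLocallyPrincipal.comap _
    · rw [← Scheme.IdealSheafData.comap_comp, graph_snd, Scheme.IdealSheafData.comap_comp,
        comap_divisor_interior, Scheme.IdealSheafData.comap_top]
    · rw [← Scheme.IdealSheafData.comap_comp, ← Scheme.IdealSheafData.comap_comp]
      have e1 : (i'.fromNormalization ≫ π) ≫ G.imageι ≫ pullback.fst M.str N.str =
          (i'.fromNormalization ≫ pullback.fst _ _) ≫ p := by
        simp only [Category.assoc]
        rw [← pullback.condition_assoc, hsf]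
      have e2 : (i'.fromNormalization ≫ π) ≫ G.imageι ≫ pullback.snd M.str N.str =
          (i'.fromNormalization ≫ pullback.fst _ _) ≫ q := by
        simp only [Category.assoc]
        rw [← pullback.condition_assoc, hsg]
      rw [e1, e2, Scheme.IdealSheafData.comap_comp,
        Scheme.IdealSheafData.comap_comp _ _ q]
      exact Scheme.IdealSheafData.comap_mono _ H

/-- An admissible morphism is realised by the normalized closure of its graph. -/
theorem exists_correspondence {M N : ModulusPair k} (f : M ⟶ N) :
    ∃ (Z : Scheme.{u}) (i : M.interior.toScheme ⟶ Z) (p : Z ⟶ M.space) (q : Z ⟶ N.space),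
      UniversallyClosed p ∧ IsSeparated p ∧ i ≫ p = M.interior.ι ∧
      i ≫ q = Hom.base f ≫ N.interior.ι ∧ p ≫ M.str = q ≫ N.str ∧
      M.divisor.comap p ≤ N.divisor.comap q := by
  have := Hom.proper f
  set G := graphMap (Hom.base f) (Hom.w f)
  refine ⟨G.toImage.normalization, G.toImage.toNormalization,
    G.toImage.fromNormalization ≫ G.imageι ≫ pullback.fst M.str N.str,
    G.toImage.fromNormalization ≫ G.imageι ≫ pullback.snd M.str N.str,
    inferInstance, inferInstance, ?_, ?_, ?_, Hom.modulus f⟩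
  · rw [Scheme.Hom.toNormalization_fromNormalization_assoc, graph_fst]
  · rw [Scheme.Hom.toNormalization_fromNormalization_assoc, graph_snd]
  · simp only [Category.assoc, pullback.condition]

theorem hom_ext {M N : ModulusPair k} {f g : M ⟶ N} (h : Hom.base f = Hom.base g) : f = g :=
  Hom.ext h

theorem base_w {M N : ModulusPair k} (f : M ⟶ N) :
    Hom.base f ≫ N.interior.ι ≫ N.str = M.interior.ι ≫ M.str := Hom.w f

@[simp]
theorem comp_base {M N L : ModulusPair k} (f : M ⟶ N) (g : N ⟶ L) :
    Hom.base (f ≫ g) = Hom.base f ≫ Hom.base g := rfl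

@[simp]
theorem id_base (M : ModulusPair k) : Hom.base (𝟙 M) = 𝟙 _ := rfl

theorem mono_of_mono_base {M N : ModulusPair k} (f : M ⟶ N) [Mono (Hom.base f)] : Mono f :=
  ⟨fun g h e => hom_ext <| by
    rw [← cancel_mono (Hom.base f), ← comp_base, ← comp_base, e]⟩

instance {M N : ModulusPair k} (f : M ⟶ N) [IsIso f] : IsIso (Hom.base f) :=
  ⟨Hom.base (inv f), by rw [← comp_base, IsIso.hom_inv_id, id_base],
    by rw [← comp_base, IsIso.inv_hom_id, id_base]⟩

/-- When the divisor of the source is trivial there is no modulus condition, and the graph is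
already closed. -/
theorem exists_hom_of_divisor_eq_top {M N : ModulusPair k} (hM : M.divisor = ⊤)
    (φ : M.interior.toScheme ⟶ N.interior.toScheme)
    (hφ : φ ≫ N.interior.ι ≫ N.str = M.interior.ι ≫ M.str) : ∃ f : M ⟶ N, Hom.base f = φ := by
  have hι : IsIso M.interior.ι := by
    have : M.interior = ⊤ := by
      ext x
      simp [interior, offSupport, hM]
    rw [this]
    exact (Scheme.topIso _).isIso_hom
  refine exists_hom_of_correspondence φ (𝟙 _) M.interior.ι (φ ≫ N.interior.ι)
    (Category.id_comp _) (Category.id_comp _) (by rw [Category.assoc, hφ]) ?_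
  rw [Scheme.IdealSheafData.comap_comp, comap_divisor_interior, comap_divisor_interior,
    Scheme.IdealSheafData.comap_top]

/-- A morphism of ambient spaces over `k` along which the modulus divisors compare induces an
admissible morphism. -/
theorem exists_hom_of_ambient {M N : ModulusPair k} (φ : M.space ⟶ N.space)
    (hk : φ ≫ N.str = M.str) (H : M.divisor ≤ N.divisor.comap φ) :
    ∃ f : M ⟶ N, Hom.base f ≫ N.interior.ι = M.interior.ι ≫ φ := by
  have hr : Set.range (M.interior.ι ≫ φ) ⊆ Set.range N.interior.ι := by
    rintro _ ⟨x, rfl⟩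
    rw [Scheme.Opens.range_ι]
    have h1 : (N.divisor.comap φ).support ≤ M.divisor.support :=
      Scheme.IdealSheafData.support_antitone H
    rw [Scheme.IdealSheafData.support_comap] at h1
    intro hx
    refine x.2 (h1 ?_)
    simp only [Scheme.Hom.comp_apply] at hx
    exact hx
  obtain ⟨f, hf⟩ := exists_hom_of_correspondence (IsOpenImmersion.lift N.interior.ι _ hr)
    M.interior.ι (𝟙 _) φ (Category.comp_id _) (IsOpenImmersion.lift_fac _ _ hr).symm
    (by rw [hk, Category.id_comp]) (by rwa [Scheme.IdealSheafData.comap_id])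
  exact ⟨f, by rw [hf, IsOpenImmersion.lift_fac]⟩

end ModulusPair

/-! ### Ideal sheaves and open immersions -/

theorem idealSheaf_le_of_locally {X : Scheme.{u}} {I J : X.IdealSheafData}
    (h : ∀ x : X, ∃ V : X.affineOpens, x ∈ V.1 ∧ I.ideal V ≤ J.ideal V) : I ≤ J := by
  choose V hxV hV using h
  exact Scheme.IdealSheafData.le_of_iSup_eq_top V
    (top_le_iff.mp fun x _ => TopologicalSpace.Opens.mem_iSup.mpr ⟨x, hxV x⟩) hV

theorem ideal_image_le_of_comap_le {U X : Scheme.{u}} (f : U ⟶ X) [IsOpenImmersion f]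
    {I J : X.IdealSheafData} (V : U.affineOpens)
    (h : (I.comap f).ideal V ≤ (J.comap f).ideal V) :
    I.ideal ⟨f ''ᵁ V, V.2.image_of_isOpenImmersion f⟩ ≤
      J.ideal ⟨f ''ᵁ V, V.2.image_of_isOpenImmersion f⟩ := by
  rw [Scheme.IdealSheafData.ideal_comap_of_isOpenImmersion,
    Scheme.IdealSheafData.ideal_comap_of_isOpenImmersion] at h
  refine (Ideal.comap_le_comap_iff_of_surjective _ ?_ _ _).mp h
  exact ((ConcreteCategory.isIso_iff_bijective (f.appIso V.1).inv).mp inferInstance).2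

theorem idealSheaf_le_of_comap_coprod {A B X : Scheme.{u}} (f : A ⟶ X) (g : B ⟶ X)
    [IsOpenImmersion f] [IsOpenImmersion g] (hfg : f.opensRange ⊔ g.opensRange = ⊤)
    {I J : X.IdealSheafData} (hf : I.comap f ≤ J.comap f) (hg : I.comap g ≤ J.comap g) :
    I ≤ J := by
  have key : ∀ {U : Scheme.{u}} (f : U ⟶ X) [IsOpenImmersion f], I.comap f ≤ J.comap f →
      ∀ x ∈ f.opensRange, ∃ V : X.affineOpens, x ∈ V.1 ∧ I.ideal V ≤ J.ideal V := by
    rintro U f _ hf _ ⟨y, rfl⟩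
    obtain ⟨_, ⟨W, hW, rfl⟩, hyW, -⟩ :=
      U.isBasis_affineOpens.exists_subset_of_mem_open (Set.mem_univ y) isOpen_univ
    exact ⟨⟨f ''ᵁ W, hW.image_of_isOpenImmersion f⟩, ⟨y, hyW, rfl⟩,
      ideal_image_le_of_comap_le f ⟨W, hW⟩ (hf _)⟩
  refine idealSheaf_le_of_locally fun x => ?_
  have hx : x ∈ f.opensRange ⊔ g.opensRange := hfg ▸ trivial
  rcases hx with hx | hx
  exacts [key f hf x hx, key g hg x hx]

/-- Flat pullback preserves nonzerodivisors, hence effective Cartier divisors. -/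
theorem IsEffectiveCartier.comap_of_flat {X Y : Scheme.{u}} {I : Y.IdealSheafData}
    (hI : IsEffectiveCartier I) (f : X ⟶ Y) [Flat f] : IsEffectiveCartier (I.comap f) := by
  intro x
  obtain ⟨V, hV, t, ht, hIt⟩ := hI (f x)
  obtain ⟨_, ⟨W, hW, rfl⟩, hxW, hWO⟩ :=
    X.isBasis_affineOpens.exists_subset_of_mem_open (show x ∈ f ⁻¹ᵁ V.1 from hV) (f ⁻¹ᵁ V.1).2
  refine ⟨⟨W, hW⟩, hxW, (f.appLE V.1 W hWO).hom t, ?_, ?_⟩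
  · have hflat := f.flat_appLE V.2 hW hWO
    let : Algebra Γ(Y, V.1) Γ(X, W) := (f.appLE V.1 W hWO).hom.toAlgebra
    have : Module.Flat Γ(Y, V.1) Γ(X, W) := hflat
    have h := Module.Flat.isSMulRegular_of_nonZeroDivisors (M := Γ(X, W)) ht
    refine mem_nonZeroDivisors_iff_right.mpr fun y hy => ?_
    refine h ?_
    change t • y = t • (0 : Γ(X, W))
    rw [smul_zero, Algebra.smul_def, mul_comm]
    exact hy
  · rw [comap_ideal I f ⟨W, hW⟩ V hWO, hIt, Ideal.map_span, Set.image_singleton]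

theorem isClosedImmersion_ι_of_isCompl {X : Scheme.{u}} {O O' : X.Opens} (h : IsCompl O O') :
    IsClosedImmersion O.ι := by
  refine .of_isPreimmersion _ ?_
  rw [Scheme.Opens.range_ι]
  have h1 : (O : Set X) = (O' : Set X)ᶜ := by
    have h2 := congrArg (fun U : X.Opens => (U : Set X)) h.inf_eq_bot
    have h3 := congrArg (fun U : X.Opens => (U : Set X)) h.sup_eq_top
    simp only [TopologicalSpace.Opens.coe_inf, TopologicalSpace.Opens.coe_bot,
      TopologicalSpace.Opens.coe_sup, TopologicalSpace.Opens.coe_top] at h2 h3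
    exact (IsCompl.of_eq h2 h3).eq_compl
  rw [h1]
  exact O'.isOpen.isClosed_compl

namespace ModulusPair

variable {k : Type u} [Field k]

/-! ### Restriction to open subschemes -/

theorem offSupport_comap {X Y : Scheme.{u}} (f : X ⟶ Y) (I : Y.IdealSheafData) :
    offSupport (I.comap f) = f ⁻¹ᵁ offSupport I := by
  ext x
  simp only [offSupport, Scheme.IdealSheafData.support_comap]
  rfl

/-- The restriction of a modulus pair to an open subscheme of its ambient space. -/
noncomputable def restrict (M : ModulusPair k) (O : M.space.Opens) : ModulusPair k where
  space := O
  str := O.ι ≫ M.str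
  divisor := M.divisor.comap O.ι
  isEffectiveCartier := M.isEffectiveCartier.comap_of_flat _
  smooth := by
    have := M.smooth
    have hr : Set.range ((offSupport (M.divisor.comap O.ι)).ι ≫ O.ι) ⊆
        Set.range (offSupport M.divisor).ι := by
      rintro _ ⟨x, rfl⟩
      rw [Scheme.Opens.range_ι]
      have h : (offSupport (M.divisor.comap O.ι)).ι x ∈ offSupport (M.divisor.comap O.ι) := x.2
      exact (offSupport_comap O.ι M.divisor).le h
    rw [← Category.assoc, ← IsOpenImmersion.lift_fac _ _ hr, Category.assoc]
    have : IsOpenImmersion (IsOpenImmersion.lift _ _ hr) := by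
      have : IsOpenImmersion (IsOpenImmersion.lift _ _ hr ≫ (offSupport M.divisor).ι) := by
        rw [IsOpenImmersion.lift_fac]; infer_instance
      exact .of_comp _ (offSupport M.divisor).ι
    infer_instance

variable (M : ModulusPair k)

/-- The inclusion of the ambient space of the restriction of a modulus pair to an open
subscheme. -/
noncomputable def spaceι (O : M.space.Opens) : (M.restrict O).space ⟶ M.space := O.ι

instance (O : M.space.Opens) : IsOpenImmersion (M.spaceι O) :=
  inferInstanceAs (IsOpenImmersion O.ι)

theorem spaceι_str (O : M.space.Opens) : M.spaceι O ≫ M.str = (M.restrict O).str := rfl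

theorem divisor_restrict (O : M.space.Opens) :
    (M.restrict O).divisor = M.divisor.comap (M.spaceι O) := rfl

theorem opensRange_spaceι (O : M.space.Opens) : (M.spaceι O).opensRange = O :=
  Scheme.Opens.opensRange_ι O

theorem exists_restrictι (O : M.space.Opens) : ∃ f : M.restrict O ⟶ M,
    Hom.base f ≫ M.interior.ι = (M.restrict O).interior.ι ≫ M.spaceι O :=
  exists_hom_of_ambient (M := M.restrict O) (N := M) (M.spaceι O) rfl le_rfl

/-- The inclusion of the restriction of a modulus pair to an open subscheme. -/
noncomputable def restrictι (O : M.space.Opens) : M.restrict O ⟶ M :=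
  (M.exists_restrictι O).choose

theorem restrictι_base_ι (O : M.space.Opens) :
    Hom.base (M.restrictι O) ≫ M.interior.ι = (M.restrict O).interior.ι ≫ M.spaceι O :=
  (M.exists_restrictι O).choose_spec

instance (O : M.space.Opens) : IsOpenImmersion (Hom.base (M.restrictι O)) := by
  have : IsOpenImmersion (Hom.base (M.restrictι O) ≫ M.interior.ι) := by
    rw [restrictι_base_ι]
    infer_instance
  exact .of_comp _ M.interior.ι

theorem opensRange_restrictι (O : M.space.Opens) :
    (Hom.base (M.restrictι O)).opensRange = M.interior.ι ⁻¹ᵁ O := by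
  ext x
  constructor
  · rintro ⟨y, rfl⟩
    change (Hom.base (M.restrictι O) ≫ M.interior.ι) y ∈ O
    rw [restrictι_base_ι]
    exact (M.opensRange_spaceι O).le ⟨_, rfl⟩
  · intro hx
    obtain ⟨y, hy⟩ : M.interior.ι x ∈ (M.spaceι O).opensRange := by
      rw [opensRange_spaceι]; exact hx
    have h1 : y ∈ (M.restrict O).interior := by
      have : (M.restrict O).interior = M.spaceι O ⁻¹ᵁ M.interior := offSupport_comap _ _
      rw [this]
      change M.spaceι O y ∈ M.interior
      rw [hy]
      exact x.2
    refine ⟨⟨y, h1⟩, ?_⟩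
    apply M.interior.ι.isOpenEmbedding.injective
    have h2 : (Hom.base (M.restrictι O) ≫ M.interior.ι) ⟨y, h1⟩ = M.spaceι O y := by
      rw [restrictι_base_ι]; rfl
    exact h2.trans hy

/-- The inclusion between the ambient spaces of the restrictions to two open subschemes. -/
noncomputable def spaceLE {O O' : M.space.Opens} (h : O ≤ O') :
    (M.restrict O).space ⟶ (M.restrict O').space := M.space.homOfLE h

@[simp]
theorem spaceLE_spaceι {O O' : M.space.Opens} (h : O ≤ O') :
    M.spaceLE h ≫ M.spaceι O' = M.spaceι O := Scheme.homOfLE_ι _ _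

theorem exists_restrictLE {O O' : M.space.Opens} (h : O ≤ O') :
    ∃ f : M.restrict O ⟶ M.restrict O', IsMinimalExtension f (M.spaceLE h) ∧
      f ≫ M.restrictι O' = M.restrictι O := by
  have hd : (M.restrict O).divisor = (M.restrict O').divisor.comap (M.spaceLE h) := by
    rw [divisor_restrict, divisor_restrict, ← Scheme.IdealSheafData.comap_comp, spaceLE_spaceι]
  have hs : M.spaceLE h ≫ (M.restrict O').str = (M.restrict O).str := by
    rw [← spaceι_str, ← spaceι_str, reassoc_of% M.spaceLE_spaceι h]
  obtain ⟨f, hf⟩ := exists_hom_of_ambient (M := M.restrict O) (N := M.restrict O')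
    (M.spaceLE h) hs hd.le
  refine ⟨f, ⟨hs, hf.symm, hd⟩, hom_ext ?_⟩
  rw [comp_base, ← cancel_mono M.interior.ι, Category.assoc, restrictι_base_ι, reassoc_of% hf,
    restrictι_base_ι, spaceLE_spaceι]

/-- The inclusion between the restrictions of a modulus pair to two open subschemes. -/
noncomputable def restrictLE {O O' : M.space.Opens} (h : O ≤ O') : M.restrict O ⟶ M.restrict O' :=
  (M.exists_restrictLE h).choose

theorem isMinimalExtension_restrictLE {O O' : M.space.Opens} (h : O ≤ O') :
    IsMinimalExtension (M.restrictLE h) (M.spaceLE h) :=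
  (M.exists_restrictLE h).choose_spec.1

@[simp]
theorem restrictLE_restrictι {O O' : M.space.Opens} (h : O ≤ O') :
    M.restrictLE h ≫ M.restrictι O' = M.restrictι O :=
  (M.exists_restrictLE h).choose_spec.2

instance (O : M.space.Opens) : Mono (M.restrictι O) := mono_of_mono_base _

/-! ### Clopen decompositions -/

variable {M}

theorem isCompl_interior {O₁ O₂ : M.space.Opens} (h : IsCompl O₁ O₂) :
    IsCompl (Hom.base (M.restrictι O₁)).opensRange (Hom.base (M.restrictι O₂)).opensRange := by
  rw [opensRange_restrictι, opensRange_restrictι, isCompl_iff, disjoint_iff, codisjoint_iff]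
  exact ⟨congrArg (M.interior.ι ⁻¹ᵁ ·) h.inf_eq_bot, congrArg (M.interior.ι ⁻¹ᵁ ·) h.sup_eq_top⟩

theorem isClosedImmersion_spaceι {O O' : M.space.Opens} (h : IsCompl O O') :
    IsClosedImmersion (M.spaceι O) := isClosedImmersion_ι_of_isCompl h

/-- A clopen decomposition of the ambient space decomposes the interior as a coproduct. -/
theorem isColimit_interior {O₁ O₂ : M.space.Opens} (h : IsCompl O₁ O₂) :
    Nonempty (IsColimit (BinaryCofan.mk (Hom.base (M.restrictι O₁))
      (Hom.base (M.restrictι O₂)))) :=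
  nonempty_isColimit_binaryCofanMk_of_isCompl _ _ (isCompl_interior h)

/-- The existence half of the statement that a clopen decomposition of the ambient space is a
coproduct decomposition: morphisms on the two parts glue, as their correspondences have a disjoint
union that is still universally closed over the ambient space. -/
theorem exists_desc {O₁ O₂ : M.space.Opens} (h : IsCompl O₁ O₂) {L : ModulusPair k}
    (g₁ : M.restrict O₁ ⟶ L) (g₂ : M.restrict O₂ ⟶ L) :
    ∃ g : M ⟶ L, M.restrictι O₁ ≫ g = g₁ ∧ M.restrictι O₂ ≫ g = g₂ := by
  obtain ⟨Z₁, i₁, p₁, q₁, _, _, hp₁, hq₁, hk₁, hd₁⟩ := exists_correspondence g₁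
  obtain ⟨Z₂, i₂, p₂, q₂, _, _, hp₂, hq₂, hk₂, hd₂⟩ := exists_correspondence g₂
  obtain ⟨c⟩ := isColimit_interior h
  have := isClosedImmersion_spaceι h
  have := isClosedImmersion_spaceι h.symm
  let D : (M.restrict O₁).space ⨿ (M.restrict O₂).space ⟶ M.space :=
    coprod.desc (M.spaceι O₁) (M.spaceι O₂)
  have : UniversallyClosed (coprod.map p₁ p₂) :=
    IsZariskiLocalAtTarget.coprodMap _ _ ‹_› ‹_›
  have : IsSeparated (coprod.map p₁ p₂) :=
    IsZariskiLocalAtTarget.coprodMap _ _ ‹_› ‹_›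
  have : IsIntegralHom D :=
    inferInstanceAs (IsIntegralHom (coprod.desc (M.spaceι O₁) (M.spaceι O₂)))
  have e₁ : coprod.inl ≫ coprod.map p₁ p₂ ≫ D = p₁ ≫ M.spaceι O₁ := by
    rw [coprod.inl_map_assoc, coprod.inl_desc]
  have e₂ : coprod.inr ≫ coprod.map p₁ p₂ ≫ D = p₂ ≫ M.spaceι O₂ := by
    rw [coprod.inr_map_assoc, coprod.inr_desc]
  let i : M.interior.toScheme ⟶ Z₁ ⨿ Z₂ :=
    c.desc (BinaryCofan.mk (i₁ ≫ coprod.inl) (i₂ ≫ coprod.inr))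
  let φ : M.interior.toScheme ⟶ L.interior.toScheme :=
    c.desc (BinaryCofan.mk (Hom.base g₁) (Hom.base g₂))
  have hi₁ : Hom.base (M.restrictι O₁) ≫ i = i₁ ≫ coprod.inl := c.fac _ ⟨.left⟩
  have hi₂ : Hom.base (M.restrictι O₂) ≫ i = i₂ ≫ coprod.inr := c.fac _ ⟨.right⟩
  have hφ₁ : Hom.base (M.restrictι O₁) ≫ φ = Hom.base g₁ := c.fac _ ⟨.left⟩
  have hφ₂ : Hom.base (M.restrictι O₂) ≫ φ = Hom.base g₂ := c.fac _ ⟨.right⟩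
  obtain ⟨g, hg⟩ := exists_hom_of_correspondence φ i (coprod.map p₁ p₂ ≫ D) (coprod.desc q₁ q₂)
    (by
      apply BinaryCofan.IsColimit.hom_ext c
      · change Hom.base (M.restrictι O₁) ≫ _ = Hom.base (M.restrictι O₁) ≫ _
        rw [reassoc_of% hi₁, e₁, reassoc_of% hp₁, restrictι_base_ι]
      · change Hom.base (M.restrictι O₂) ≫ _ = Hom.base (M.restrictι O₂) ≫ _
        rw [reassoc_of% hi₂, e₂, reassoc_of% hp₂, restrictι_base_ι])
    (by
      apply BinaryCofan.IsColimit.hom_ext c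
      · change Hom.base (M.restrictι O₁) ≫ _ = Hom.base (M.restrictι O₁) ≫ _
        rw [reassoc_of% hi₁, coprod.inl_desc, hq₁, reassoc_of% hφ₁]
      · change Hom.base (M.restrictι O₂) ≫ _ = Hom.base (M.restrictι O₂) ≫ _
        rw [reassoc_of% hi₂, coprod.inr_desc, hq₂, reassoc_of% hφ₂])
    (by
      apply coprod.hom_ext
      · rw [Category.assoc, reassoc_of% e₁, coprod.inl_desc_assoc, ← hk₁]; rfl
      · rw [Category.assoc, reassoc_of% e₂, coprod.inr_desc_assoc, ← hk₂]; rfl)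
    (by
      apply idealSheaf_le_of_comap_coprod (coprod.inl : Z₁ ⟶ Z₁ ⨿ Z₂) (coprod.inr : Z₂ ⟶ Z₁ ⨿ Z₂)
        (isCompl_opensRange_inl_inr _ _).sup_eq_top
      · rw [← Scheme.IdealSheafData.comap_comp, ← Scheme.IdealSheafData.comap_comp, e₁,
          coprod.inl_desc, Scheme.IdealSheafData.comap_comp]
        exact hd₁
      · rw [← Scheme.IdealSheafData.comap_comp, ← Scheme.IdealSheafData.comap_comp, e₂,
          coprod.inr_desc, Scheme.IdealSheafData.comap_comp]
        exact hd₂)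
  exact ⟨g, hom_ext (by rw [comp_base, hg, hφ₁]), hom_ext (by rw [comp_base, hg, hφ₂])⟩

/-- The uniqueness half of the statement that a clopen decomposition of the ambient space is a
coproduct decomposition. -/
theorem hom_ext_of_isCompl {O₁ O₂ : M.space.Opens} (h : IsCompl O₁ O₂) {L : ModulusPair k}
    {f g : M ⟶ L} (h₁ : M.restrictι O₁ ≫ f = M.restrictι O₁ ≫ g)
    (h₂ : M.restrictι O₂ ≫ f = M.restrictι O₂ ≫ g) : f = g := by
  obtain ⟨c⟩ := isColimit_interior h
  exact hom_ext (BinaryCofan.IsColimit.hom_ext c (congrArg Hom.base h₁) (congrArg Hom.base h₂))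

/-- A morphism whose base lands in a clopen part of the target factors through that part. That the
part is closed keeps the restricted correspondence universally closed over the source. -/
theorem exists_lift_restrict {N : ModulusPair k} {O O' : M.space.Opens} (h : IsCompl O O')
    (f : N ⟶ M) (φ : N.interior.toScheme ⟶ (M.restrict O).interior.toScheme)
    (hφ : φ ≫ Hom.base (M.restrictι O) = Hom.base f) :
    ∃ g : N ⟶ M.restrict O, g ≫ M.restrictι O = f := by
  obtain ⟨Z, i, p, q, _, _, hp, hq, hk, hd⟩ := exists_correspondence f
  have := isClosedImmersion_spaceι h
  have hi : i ≫ q = (φ ≫ (M.restrict O).interior.ι) ≫ (M.spaceι O) := by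
    rw [hq, ← hφ, Category.assoc, restrictι_base_ι, Category.assoc]
  obtain ⟨g, hg⟩ := exists_hom_of_correspondence (M := N) (N := M.restrict O) φ
    (pullback.lift i (φ ≫ (M.restrict O).interior.ι) hi : _ ⟶ pullback q (M.spaceι O))
    (pullback.fst q (M.spaceι O) ≫ p) (pullback.snd q (M.spaceι O))
    (by rw [pullback.lift_fst_assoc, hp])
    (pullback.lift_snd _ _ _)
    (by
      rw [Category.assoc, hk, pullback.condition_assoc, spaceι_str])
    (by
      rw [divisor_restrict, ← Scheme.IdealSheafData.comap_comp, ← pullback.condition,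
        Scheme.IdealSheafData.comap_comp, Scheme.IdealSheafData.comap_comp]
      exact Scheme.IdealSheafData.comap_mono _ hd)
  exact ⟨g, hom_ext (by rw [comp_base, hg, hφ])⟩

theorem isProper_restrict {O O' : M.space.Opens} (h : IsCompl O O') (hM : IsProper M.str) :
    IsProper (M.restrict O).str := by
  have := isClosedImmersion_spaceι h
  exact inferInstanceAs (IsProper ((M.spaceι O) ≫ M.str))

end ModulusPair

/-! ### The affine charts of the blow-up of the sum of two principal ideals -/

section Charts

variable {U Y : Scheme.{u}} (j : U ⟶ Y) (I₁ I₂ : Y.IdealSheafData)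

/-- An affine open subscheme of `Y` with generators `a` and `b` of two ideals, both invertible on
`U`. -/
structure BlowupChart where
  /-- the affine open subscheme -/
  carrier : Y.affineOpens
  /-- a generator of the first ideal -/
  a : Γ(Y, carrier.1)
  /-- a generator of the second ideal -/
  b : Γ(Y, carrier.1)
  ideal_a : I₁.ideal carrier = Ideal.span {a}
  ideal_b : I₂.ideal carrier = Ideal.span {b}
  isUnit_a : IsUnit (j.app carrier.1 a)
  isUnit_b : IsUnit (j.app carrier.1 b)

variable {j I₁ I₂}

namespace BlowupChart

/-- Charts are ordered by inclusion as basic open subschemes, so that restriction to a smaller chart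
is a localization. -/
instance : Preorder (BlowupChart j I₁ I₂) where
  le c d := ∃ r : Γ(Y, d.carrier.1), Y.basicOpen r = c.carrier.1
  le_refl c := ⟨1, Scheme.basicOpen_of_isUnit _ isUnit_one⟩
  le_trans c d e := by
    rintro ⟨r, hr⟩ ⟨s, hs⟩
    obtain ⟨⟨C, hC⟩, _⟩ := c
    obtain ⟨⟨D, hD⟩, _⟩ := d
    dsimp only at r hr hs
    subst hs hr
    exact e.carrier.2.basicOpen_basicOpen_is_basicOpen s r

variable (c d : BlowupChart j I₁ I₂)

theorem le_carrier {c d : BlowupChart j I₁ I₂} (h : c ≤ d) : c.carrier.1 ≤ d.carrier.1 := by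
  obtain ⟨r, hr⟩ := h
  exact hr ▸ Y.basicOpen_le r

/-- The sections over `U` on a chart. -/
abbrev Sections : Type u := Γ(U, j ⁻¹ᵁ c.carrier.1)

/-- The pullback of sections to `U`. -/
noncomputable def toSections : Γ(Y, c.carrier.1) →+* c.Sections := (j.app c.carrier.1).hom

/-- The restriction of sections over `U` to a smaller chart. -/
noncomputable def res {c d : BlowupChart j I₁ I₂} (h : c ≤ d) : d.Sections →+* c.Sections :=
  (U.presheaf.map (homOfLE (j.preimage_mono (le_carrier h))).op).hom

/-- The restriction of sections of `Y` to a smaller chart. -/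
noncomputable def resY {c d : BlowupChart j I₁ I₂} (h : c ≤ d) :
    Γ(Y, d.carrier.1) →+* Γ(Y, c.carrier.1) :=
  (Y.presheaf.map (homOfLE (le_carrier h)).op).hom

theorem res_toSections {c d : BlowupChart j I₁ I₂} (h : c ≤ d) (x : Γ(Y, d.carrier.1)) :
    res h (d.toSections x) = c.toSections (resY h x) :=
  (ConcreteCategory.congr_hom (j.naturality (homOfLE (le_carrier h)).op) x).symm

theorem res_refl (h : c ≤ c) (x : c.Sections) : res h x = x := by
  have : (homOfLE (j.preimage_mono (le_carrier h))).op = 𝟙 _ := rfl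
  change U.presheaf.map (homOfLE (j.preimage_mono (le_carrier h))).op x = x
  rw [this, U.presheaf.map_id]
  rfl

theorem res_res {c d e : BlowupChart j I₁ I₂} (h : c ≤ d) (h' : d ≤ e) (x : e.Sections) :
    res h (res h' x) = res (h.trans h') x := by
  change (U.presheaf.map _ ≫ U.presheaf.map _) x = U.presheaf.map _ x
  rw [← U.presheaf.map_comp]
  rfl

/-- The ratio `b / a` as a unit on `U` (for the side `true`) and its inverse (for `false`). -/
noncomputable def ratio : Bool → c.Sections
  | true => ↑(c.isUnit_b.unit * c.isUnit_a.unit⁻¹)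
  | false => ↑(c.isUnit_a.unit * c.isUnit_b.unit⁻¹)

theorem ratio_mul_ratio_not (s : Bool) : c.ratio s * c.ratio (!s) = 1 := by
  cases s
  · rw [Bool.not_false, ratio, ratio, ← Units.val_mul, ← Units.val_one]
    congr 1; group
  · rw [Bool.not_true, ratio, ratio, ← Units.val_mul, ← Units.val_one]
    congr 1; group

theorem ratio_true_mul : c.ratio true * c.toSections c.a = c.toSections c.b := by
  rw [ratio]
  have : c.toSections c.a = c.isUnit_a.unit := rfl
  rw [this, ← Units.val_mul, inv_mul_cancel_right]
  rfl

theorem ratio_false_mul : c.ratio false * c.toSections c.b = c.toSections c.a := by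
  rw [ratio]
  have : c.toSections c.b = c.isUnit_b.unit := rfl
  rw [this, ← Units.val_mul, inv_mul_cancel_right]
  rfl

/-- Changing the chart multiplies the ratio by a section of `Y` that is invertible on `U`, with
inverse a section of `Y`. -/
theorem exists_res_ratio {c d : BlowupChart j I₁ I₂} (h : c ≤ d) :
    ∃ u : Bool → Γ(Y, c.carrier.1), (∀ s, c.toSections (u s) * c.toSections (u (!s)) = 1) ∧
      ∀ s, res h (d.ratio s) = c.toSections (u s) * c.ratio s := by
  have hle : c.carrier ≤ d.carrier := le_carrier h
  have ha : Ideal.span {resY h d.a} = Ideal.span {c.a} := by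
    have := I₁.map_ideal hle
    rwa [d.ideal_a, c.ideal_a, Ideal.map_span, Set.image_singleton] at this
  have hb : Ideal.span {resY h d.b} = Ideal.span {c.b} := by
    have := I₂.map_ideal hle
    rwa [d.ideal_b, c.ideal_b, Ideal.map_span, Set.image_singleton] at this
  obtain ⟨v, hv⟩ := Ideal.mem_span_singleton'.mp (ha.le (Ideal.mem_span_singleton_self _))
  obtain ⟨v', hv'⟩ := Ideal.mem_span_singleton'.mp (ha.ge (Ideal.mem_span_singleton_self _))
  obtain ⟨w, hw⟩ := Ideal.mem_span_singleton'.mp (hb.le (Ideal.mem_span_singleton_self _))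
  obtain ⟨w', hw'⟩ := Ideal.mem_span_singleton'.mp (hb.ge (Ideal.mem_span_singleton_self _))
  have ea := congrArg c.toSections hv
  have ea' := congrArg c.toSections hv'
  have eb := congrArg c.toSections hw
  have eb' := congrArg c.toSections hw'
  rw [map_mul] at ea ea' eb eb'
  have ua : IsUnit (c.toSections c.a) := c.isUnit_a
  have ub : IsUnit (c.toSections c.b) := c.isUnit_b
  have rt := congrArg (res h) d.ratio_true_mul
  have rf := congrArg (res h) d.ratio_false_mul
  rw [map_mul, res_toSections, res_toSections] at rt rf
  have ct := c.ratio_true_mul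
  have cf := c.ratio_false_mul
  have hvv : c.toSections v * c.toSections v' = 1 := by
    apply ua.mul_right_cancel
    linear_combination c.toSections v' * ea + ea'
  have hww : c.toSections w * c.toSections w' = 1 := by
    apply ub.mul_right_cancel
    linear_combination c.toSections w' * eb + eb'
  refine ⟨fun s => if s then w * v' else v * w', ?_, ?_⟩
  · rintro (_ | _)
    · simp only [Bool.not_false, if_true, map_mul, Bool.false_eq_true, if_false]
      linear_combination hvv * (c.toSections w * c.toSections w') + hww
    · simp only [Bool.not_true, if_true, map_mul, Bool.false_eq_true, if_false]
      linear_combination hvv * (c.toSections w * c.toSections w') + hww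
  · rintro (_ | _)
    · simp only [Bool.false_eq_true, if_false, map_mul]
      apply ub.mul_right_cancel
      linear_combination -(res h (d.ratio false) * c.toSections c.b) * hww +
        res h (d.ratio false) * c.toSections w' * eb + c.toSections w' * rf -
        c.toSections w' * ea - c.toSections w' * c.toSections v * cf
    · simp only [if_true, map_mul]
      apply ua.mul_right_cancel
      linear_combination -(res h (d.ratio true) * c.toSections c.a) * hvv +
        res h (d.ratio true) * c.toSections v' * ea + c.toSections v' * rt -
        c.toSections v' * eb - c.toSections v' * c.toSections w * ct

/-- The restriction of a chart to a basic open subscheme. -/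
noncomputable def basicOpen (r : Γ(Y, c.carrier.1)) : BlowupChart j I₁ I₂ where
  carrier := ⟨Y.basicOpen r, c.carrier.2.basicOpen r⟩
  a := Y.presheaf.map (homOfLE (Y.basicOpen_le r)).op c.a
  b := Y.presheaf.map (homOfLE (Y.basicOpen_le r)).op c.b
  ideal_a := by
    rw [← I₁.map_ideal (U := ⟨Y.basicOpen r, c.carrier.2.basicOpen r⟩) (V := c.carrier)
      (Y.basicOpen_le r), c.ideal_a, Ideal.map_span, Set.image_singleton]
    rfl
  ideal_b := by
    rw [← I₂.map_ideal (U := ⟨Y.basicOpen r, c.carrier.2.basicOpen r⟩) (V := c.carrier)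
      (Y.basicOpen_le r), c.ideal_b, Ideal.map_span, Set.image_singleton]
    rfl
  isUnit_a := by
    have h := ConcreteCategory.congr_hom (j.naturality (homOfLE (Y.basicOpen_le r)).op) c.a
    have h2 : IsUnit (U.presheaf.map (homOfLE (j.preimage_mono (Y.basicOpen_le r))).op
      (j.app c.carrier.1 c.a)) := c.isUnit_a.map (U.presheaf.map _).hom
    exact h ▸ h2
  isUnit_b := by
    have h := ConcreteCategory.congr_hom (j.naturality (homOfLE (Y.basicOpen_le r)).op) c.b
    have h2 : IsUnit (U.presheaf.map (homOfLE (j.preimage_mono (Y.basicOpen_le r))).op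
      (j.app c.carrier.1 c.b)) := c.isUnit_b.map (U.presheaf.map _).hom
    exact h ▸ h2

theorem basicOpen_le (r : Γ(Y, c.carrier.1)) : c.basicOpen r ≤ c := ⟨r, rfl⟩

end BlowupChart

/-- The index of an affine piece of the blow-up: a chart of the base, and a side: the piece
`some true` is where `b / a` is regular, `some false` is where `a / b` is regular, and `none` is
the intersection of the two. -/
structure BlowupIndex (j : U ⟶ Y) (I₁ I₂ : Y.IdealSheafData) where
  /-- the chart of the base -/
  chart : BlowupChart j I₁ I₂
  /-- the side -/
  side : Option Bool

namespace BlowupIndex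

instance : Preorder (BlowupIndex j I₁ I₂) where
  le m n := m.chart ≤ n.chart ∧ (m.side = none ∨ m.side = n.side)
  le_refl m := ⟨le_rfl, .inr rfl⟩
  le_trans l m n h h' := ⟨h.1.trans h'.1, by
    rcases h.2 with h2 | h2
    · exact .inl h2
    · rw [h2]; exact h'.2⟩

variable (m n : BlowupIndex j I₁ I₂)

/-- The ratios that are adjoined on a piece. -/
def gens : Set m.chart.Sections :=
  {x | ∃ s, (m.side = none ∨ m.side = some s) ∧ x = m.chart.ratio s}

/-- The coordinate ring of a piece of the blow-up. It is taken inside the ring of sections over `U`,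
where both ratios exist; the pieces then make up the closure of `U` in the blow-up. -/
def ring : Subring m.chart.Sections :=
  Subring.closure (Set.range m.chart.toSections ∪ m.gens)

theorem toSections_mem (x : Γ(Y, m.chart.carrier.1)) : m.chart.toSections x ∈ m.ring :=
  Subring.subset_closure (.inl ⟨x, rfl⟩)

theorem ratio_mem {s : Bool} (hs : m.side = none ∨ m.side = some s) :
    m.chart.ratio s ∈ m.ring :=
  Subring.subset_closure (.inr ⟨s, hs, rfl⟩)

theorem res_mem {m n : BlowupIndex j I₁ I₂} (h : m ≤ n) {x : n.chart.Sections}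
    (hx : x ∈ n.ring) : BlowupChart.res h.1 x ∈ m.ring := by
  suffices n.ring ≤ m.ring.comap (BlowupChart.res h.1) from this hx
  refine Subring.closure_le.mpr ?_
  rintro _ (⟨y, rfl⟩ | ⟨s, hs, rfl⟩)
  · change BlowupChart.res h.1 (n.chart.toSections y) ∈ m.ring
    rw [BlowupChart.res_toSections]
    exact m.toSections_mem _
  · obtain ⟨u, -, hu⟩ := BlowupChart.exists_res_ratio h.1
    change BlowupChart.res h.1 (n.chart.ratio s) ∈ m.ring
    rw [hu]
    refine mul_mem (m.toSections_mem _) (m.ratio_mem ?_)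
    rcases h.2 with h2 | h2
    · exact .inl h2
    · rw [h2]; exact hs

/-- The restriction map between the coordinate rings of two pieces. -/
noncomputable def map {m n : BlowupIndex j I₁ I₂} (h : m ≤ n) : n.ring →+* m.ring :=
  (BlowupChart.res h.1).restrict _ _ fun _ hx => res_mem h hx

/-- The structure map of the coordinate ring of a piece. -/
noncomputable def structureMap : Γ(Y, m.chart.carrier.1) →+* m.ring :=
  m.chart.toSections.codRestrict _ m.toSections_mem

@[simp]
theorem coe_structureMap (x : Γ(Y, m.chart.carrier.1)) :
    (m.structureMap x : m.chart.Sections) = m.chart.toSections x := rfl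

theorem map_structureMap {m n : BlowupIndex j I₁ I₂} (h : m ≤ n) (x : Γ(Y, n.chart.carrier.1)) :
    map h (n.structureMap x) = m.structureMap (BlowupChart.resY h.1 x) :=
  Subtype.ext (BlowupChart.res_toSections h.1 x)

/-- The ratio whose inverse has to be adjoined to pass from `n` to the smaller piece `m`, or `1` if
the two pieces lie on the same side. -/
noncomputable def factor {m n : BlowupIndex j I₁ I₂} (_ : m ≤ n) : n.ring :=
  if hs : ∃ s, m.side = none ∧ n.side = some s then
    ⟨n.chart.ratio hs.choose, n.ratio_mem (.inr hs.choose_spec.2)⟩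
  else 1

theorem factor_of_eq {m n : BlowupIndex j I₁ I₂} (h : m ≤ n) (hs : m.side = n.side) :
    factor h = 1 := by
  rw [factor, dif_neg]
  rintro ⟨s, h1, h2⟩
  rw [h1, h2] at hs
  cases hs

theorem coe_factor_of_ne {m n : BlowupIndex j I₁ I₂} (h : m ≤ n) (hm : m.side = none)
    {s : Bool} (hn : n.side = some s) : (factor h : n.chart.Sections) = n.chart.ratio s := by
  have hs : ∃ s, m.side = none ∧ n.side = some s := ⟨s, hm, hn⟩
  rw [factor, dif_pos hs]
  exact congrArg n.chart.ratio (Option.some.inj (hs.choose_spec.2.symm.trans hn))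

theorem factor_cases {m n : BlowupIndex j I₁ I₂} (h : m ≤ n) :
    m.side = n.side ∨ ∃ s, m.side = none ∧ n.side = some s := by
  rcases h.2 with h2 | h2
  · rcases hn : n.side with _ | s
    · exact .inl h2
    · exact .inr ⟨s, h2, rfl⟩
  · exact .inl h2

/-- A smaller piece is the localization at the product of the function defining the basic open
subscheme of the base and the ratio that becomes invertible. -/
theorem isLocalization_map [QuasiCompact j] [QuasiSeparated j] {m n : BlowupIndex j I₁ I₂}
    (h : m ≤ n) (r : Γ(Y, n.chart.carrier.1))
    (hr : Y.basicOpen r = m.chart.carrier.1) :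
    letI := (map h).toAlgebra
    IsLocalization.Away (n.structureMap r * factor h) m.ring := by
  let _ := (map h).toAlgebra
  -- a section over `U` that vanishes on the smaller chart is annihilated by a power of `r`
  have hB : ∀ x : n.chart.Sections, BlowupChart.res h.1 x = 0 →
      ∃ N : ℕ, n.chart.toSections r ^ N * x = 0 := by
    intro x hx
    have hle : j ⁻¹ᵁ m.chart.carrier.1 = U.basicOpen (j.app n.chart.carrier.1 r) := by
      rw [← hr]; exact j.preimage_basicOpen r
    refine exists_of_res_zero_of_qcqs (X := U) (U := j ⁻¹ᵁ n.chart.carrier.1)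
      (j.isCompact_preimage n.chart.carrier.2.isCompact)
      (j.isQuasiSeparated_preimage n.chart.carrier.2.isQuasiSeparated)
      (f := x) (s := j.app n.chart.carrier.1 r) ?_
    have h1 : U.basicOpen (j.app n.chart.carrier.1 r) ≤ j ⁻¹ᵁ m.chart.carrier.1 := hle.ge
    have h2 := congrArg (U.presheaf.map (homOfLE h1).op) hx
    rw [map_zero] at h2
    rw [← h2]
    change _ = (U.presheaf.map _ ≫ U.presheaf.map _) x
    rw [← U.presheaf.map_comp]
    rfl
  have hloc : letI := (BlowupChart.resY h.1).toAlgebra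
      IsLocalization.Away r Γ(Y, m.chart.carrier.1) :=
    n.chart.carrier.2.isLocalization_of_eq_basicOpen r
      (homOfLE (BlowupChart.le_carrier h.1)) hr.symm
  let _ := (BlowupChart.resY h.1).toAlgebra
  have hY : ∀ y : Γ(Y, m.chart.carrier.1), ∃ (N : ℕ) (x : Γ(Y, n.chart.carrier.1)),
      y * BlowupChart.resY h.1 r ^ N = BlowupChart.resY h.1 x := by
    intro y
    obtain ⟨N, x, hx⟩ := IsLocalization.Away.surj r y
    exact ⟨N, x, hx⟩
  have hru : IsUnit (BlowupChart.resY h.1 r) := IsLocalization.Away.algebraMap_isUnit r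
  obtain ⟨u, hu1, hu⟩ := BlowupChart.exists_res_ratio h.1
  have hratio (s : Bool) : m.chart.ratio s =
      m.chart.toSections (u (!s)) * BlowupChart.res h.1 (n.chart.ratio s) := by
    rw [hu]
    linear_combination -(m.chart.ratio s) * hu1 s
  have hfac : IsUnit (map h (factor h)) := by
    rcases factor_cases h with hs | ⟨s, hm, hn⟩
    · rw [factor_of_eq h hs, map_one]
      exact isUnit_one
    · refine IsUnit.of_mul_eq_one
        ⟨m.chart.toSections (u (!s)) * m.chart.ratio (!s),
          mul_mem (m.toSections_mem _) (m.ratio_mem (.inl hm))⟩ (Subtype.ext ?_)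
      change BlowupChart.res h.1 (factor h).1 * (_ * _) = 1
      rw [coe_factor_of_ne h hm hn, hu]
      linear_combination (m.chart.ratio s * m.chart.ratio (!s)) * hu1 s +
        m.chart.ratio_mul_ratio_not s
  have hgunit : IsUnit (map h (n.structureMap r * factor h)) := by
    rw [map_mul, map_structureMap]
    exact (hru.map m.structureMap).mul hfac
  have hg (N : ℕ) :
      BlowupChart.res h.1 ((n.structureMap r * factor h : n.ring) : n.chart.Sections) ^ N =
      m.chart.toSections (BlowupChart.resY h.1 r) ^ N *
        BlowupChart.res h.1 ((factor h : n.ring) : n.chart.Sections) ^ N := by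
    rw [Subring.coe_mul, coe_structureMap, map_mul, BlowupChart.res_toSections, mul_pow]
  generalize hG : ((n.structureMap r * factor h : n.ring) : n.chart.Sections) = G at hg
  have hGmem : G ∈ n.ring := hG ▸ (n.structureMap r * factor h).2
  -- the elements of the form `y / G ^ N` with `y` in the ring of `n`; they contain the generators
  -- of the ring of `m`
  let S : Subring m.chart.Sections :=
    { carrier := {z | ∃ N : ℕ, ∃ y ∈ n.ring, z * BlowupChart.res h.1 G ^ N = BlowupChart.res h.1 y}
      mul_mem' := by
        rintro z w ⟨N, y, hym, hy⟩ ⟨N', y', hym', hy'⟩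
        refine ⟨N + N', y * y', mul_mem hym hym', ?_⟩
        rw [map_mul, ← hy, ← hy']
        ring
      one_mem' := ⟨0, 1, one_mem _, by rw [map_one, pow_zero, one_mul]⟩
      add_mem' := by
        rintro z w ⟨N, y, hym, hy⟩ ⟨N', y', hym', hy'⟩
        refine ⟨N + N', y * G ^ N' + y' * G ^ N,
          add_mem (mul_mem hym (pow_mem hGmem _)) (mul_mem hym' (pow_mem hGmem _)), ?_⟩
        rw [map_add, map_mul, map_mul, map_pow, map_pow, ← hy, ← hy']
        ring
      zero_mem' := ⟨0, 0, zero_mem _, by rw [map_zero, zero_mul]⟩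
      neg_mem' := by
        rintro z ⟨N, y, hym, hy⟩
        refine ⟨N, -y, neg_mem hym, ?_⟩
        rw [map_neg, ← hy]
        ring }
  have hSY (y : Γ(Y, m.chart.carrier.1)) : m.chart.toSections y ∈ S := by
    obtain ⟨N, x, hx⟩ := hY y
    refine ⟨N, n.chart.toSections x * (factor h).1 ^ N,
      mul_mem (n.toSections_mem _) (pow_mem (factor h).2 _), ?_⟩
    rw [hg, map_mul, BlowupChart.res_toSections, ← hx, map_mul, map_pow, map_pow]
    ring
  have hSres (x : n.chart.Sections) (hx : x ∈ n.ring) : BlowupChart.res h.1 x ∈ S :=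
    ⟨0, x, hx, by rw [pow_zero, mul_one]⟩
  have hS : m.ring ≤ S := by
    refine Subring.closure_le.mpr ?_
    rintro _ (⟨y, rfl⟩ | ⟨s, hs, rfl⟩)
    · exact hSY y
    · change m.chart.ratio s ∈ S
      rw [hratio]
      refine mul_mem (hSY _) ?_
      by_cases hn : n.side = none ∨ n.side = some s
      · exact hSres _ (n.ratio_mem hn)
      -- otherwise `m` is the intersection and the ratio is the inverse of the one that `factor`
      -- inverts
      · rcases factor_cases h with he | ⟨s', hm, hn'⟩
        · rw [he] at hs; exact absurd hs hn
        · have hs' : s' = !s := by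
            by_contra hne
            exact hn (.inr (hn'.trans (congrArg some (by
              cases s <;> cases s' <;> first | rfl | exact absurd rfl hne))))
          refine ⟨1, n.chart.toSections r, n.toSections_mem r, ?_⟩
          rw [hg, coe_factor_of_ne h hm hn', hs', pow_one, pow_one,
            BlowupChart.res_toSections]
          have := congrArg (BlowupChart.res h.1) (n.chart.ratio_mul_ratio_not s)
          rw [map_mul, map_one] at this
          linear_combination m.chart.toSections (BlowupChart.resY h.1 r) * this
  rw [IsLocalization.Away, isLocalization_iff]
  refine ⟨?_, ?_, ?_⟩
  · rintro ⟨_, N, rfl⟩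
    rw [map_pow]
    exact hgunit.pow N
  · intro z
    obtain ⟨N, y, hym, hy⟩ := hS z.2
    refine ⟨⟨⟨y, hym⟩, ⟨_, N, rfl⟩⟩, Subtype.ext ?_⟩
    change z.1 *
      BlowupChart.res h.1 (((n.structureMap r * factor h : n.ring) : n.chart.Sections) ^ N) =
        BlowupChart.res h.1 y
    rw [hG, ← hy, map_pow]
  · intro x y hxy
    have hxy' : BlowupChart.res h.1 (x.1 - y.1) = 0 := by
      rw [map_sub, sub_eq_zero]
      exact congrArg Subtype.val hxy
    obtain ⟨N, hN⟩ := hB _ hxy'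
    refine ⟨⟨_, N, rfl⟩, Subtype.ext ?_⟩
    change (n.chart.toSections r * (factor h).1) ^ N * x.1 =
      (n.chart.toSections r * (factor h).1) ^ N * y.1
    linear_combination (factor h).1 ^ N * hN

end BlowupIndex

end Charts

/-! ### The blow-up of the sum of two locally principal ideals -/

section Blowup

variable {U Y : Scheme.{u}} {j : U ⟶ Y} {I₁ I₂ : Y.IdealSheafData}

namespace BlowupIndex

theorem map_refl {m : BlowupIndex j I₁ I₂} (h : m ≤ m) : map h = RingHom.id m.ring :=
  RingHom.ext fun _ => Subtype.ext (BlowupChart.res_refl m.chart h.1 _)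

theorem map_comp {l m n : BlowupIndex j I₁ I₂} (h : l ≤ m) (h' : m ≤ n) :
    (map h).comp (map h') = map (h.trans h') :=
  RingHom.ext fun _ => Subtype.ext (BlowupChart.res_res h.1 h'.1 _)

/-- An affine piece of the blow-up. -/
noncomputable abbrev piece (m : BlowupIndex j I₁ I₂) : Scheme.{u} := Spec (.of m.ring)

/-- The inclusion of a smaller piece. -/
noncomputable def incl {m n : BlowupIndex j I₁ I₂} (h : m ≤ n) : m.piece ⟶ n.piece :=
  Spec.map (CommRingCat.ofHom (map h))

theorem incl_refl {m : BlowupIndex j I₁ I₂} (h : m ≤ m) : incl h = 𝟙 _ := by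
  rw [incl, map_refl]
  exact Spec.map_id _

theorem incl_comp {l m n : BlowupIndex j I₁ I₂} (h : l ≤ m) (h' : m ≤ n) :
    incl h ≫ incl h' = incl (h.trans h') := by
  rw [incl, incl, incl, ← map_comp h h', CommRingCat.ofHom_comp, Spec.map_comp]

/-- The projection from a piece to the base. -/
noncomputable def toBase (m : BlowupIndex j I₁ I₂) : m.piece ⟶ Y :=
  Spec.map (CommRingCat.ofHom m.structureMap) ≫ m.chart.carrier.2.fromSpec

theorem incl_toBase {m n : BlowupIndex j I₁ I₂} (h : m ≤ n) :
    incl h ≫ n.toBase = m.toBase := by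
  rw [incl, toBase, toBase, ← Spec.map_comp_assoc, ← CommRingCat.ofHom_comp,
    show (map h).comp n.structureMap = m.structureMap.comp (BlowupChart.resY h.1) from
      RingHom.ext fun x => map_structureMap h x, CommRingCat.ofHom_comp, Spec.map_comp_assoc]
  congr 1
  exact n.chart.carrier.2.map_fromSpec m.chart.carrier.2
    (homOfLE (BlowupChart.le_carrier h.1)).op

theorem range_toBase_subset (m : BlowupIndex j I₁ I₂) (x : m.piece) :
    m.toBase x ∈ m.chart.carrier.1 := by
  have h : m.chart.carrier.2.fromSpec (Spec.map (CommRingCat.ofHom m.structureMap) x) ∈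
    Set.range m.chart.carrier.2.fromSpec := ⟨_, rfl⟩
  rw [m.chart.carrier.2.range_fromSpec] at h
  rwa [toBase, Scheme.Hom.comp_apply]

theorem toBase_mem_basicOpen (m : BlowupIndex j I₁ I₂) (x : m.piece)
    (r : Γ(Y, m.chart.carrier.1)) :
    m.toBase x ∈ Y.basicOpen r ↔ m.structureMap r ∉ PrimeSpectrum.asIdeal x := by
  rw [toBase, Scheme.Hom.comp_apply]
  change Spec.map (CommRingCat.ofHom m.structureMap) x ∈
    m.chart.carrier.2.fromSpec ⁻¹ᵁ Y.basicOpen r ↔ _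
  rw [m.chart.carrier.2.fromSpec_preimage_basicOpen]
  rfl

theorem factor_eq_of_side_eq {l m n : BlowupIndex j I₁ I₂} (hl : l ≤ n) (hm : m ≤ n)
    (h : l.side = m.side) : factor hl = factor hm := by
  simp only [factor, h]

instance isOpenImmersion_incl [QuasiCompact j] [QuasiSeparated j] {m n : BlowupIndex j I₁ I₂}
    (h : m ≤ n) : IsOpenImmersion (incl h) := by
  obtain ⟨r, hr⟩ := h.1
  have := isLocalization_map h r hr
  let _ := (map h).toAlgebra
  exact IsOpenImmersion.of_isLocalization (n.structureMap r * factor h)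

theorem mem_range_incl [QuasiCompact j] [QuasiSeparated j] {m n : BlowupIndex j I₁ I₂}
    (h : m ≤ n) (r : Γ(Y, n.chart.carrier.1)) (hr : Y.basicOpen r = m.chart.carrier.1)
    (x : n.piece) :
    x ∈ Set.range (incl h) ↔
      n.structureMap r ∉ PrimeSpectrum.asIdeal x ∧ factor h ∉ PrimeSpectrum.asIdeal x := by
  have := isLocalization_map h r hr
  let _ := (map h).toAlgebra
  have h1 := PrimeSpectrum.localization_away_comap_range m.ring (n.structureMap r * factor h)
  refine (iff_of_eq (congrArg (fun s => x ∈ s) h1)).trans ?_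
  change n.structureMap r * factor h ∉ PrimeSpectrum.asIdeal x ↔ _
  rw [x.2.mul_mem_iff_mem_or_mem, not_or]

/-- Two pieces inside a third one meet in a union of smaller pieces: the diagram of pieces is
locally directed. -/
theorem exists_incl_eq [QuasiCompact j] [QuasiSeparated j] {i k n : BlowupIndex j I₁ I₂}
    (hi : i ≤ n) (hk : k ≤ n) (xi : i.piece) (xk : k.piece) (h : incl hi xi = incl hk xk) :
    ∃ (l : BlowupIndex j I₁ I₂) (hli : l ≤ i) (hlk : l ≤ k) (x : l.piece),
      incl hli x = xi ∧ incl hlk x = xk := by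
  classical
  obtain ⟨r, hr⟩ := hi.1
  obtain ⟨s, hs⟩ := hk.1
  let l : BlowupIndex j I₁ I₂ :=
    ⟨n.chart.basicOpen (r * s), if i.side = k.side then i.side else none⟩
  have hlside : l.side = i.side ∨ l.side = k.side := by
    by_cases he : i.side = k.side
    · exact .inl (if_pos he)
    · have hl : l.side = none := if_neg he
      rcases hi.2 with h1 | h1
      · exact .inl (hl.trans h1.symm)
      · rcases hk.2 with h2 | h2
        · exact .inr (hl.trans h2.symm)
        · exact absurd (h1.trans h2.symm) he
  have hli : l ≤ i := by
    refine ⟨⟨BlowupChart.resY hi.1 s, ?_⟩, ?_⟩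
    · refine (Y.basicOpen_res s (homOfLE (BlowupChart.le_carrier hi.1)).op).trans ?_
      rw [← hr]
      exact (Y.basicOpen_mul r s).symm
    · by_cases he : i.side = k.side
      · exact .inr (if_pos he)
      · exact .inl (if_neg he)
  have hlk : l ≤ k := by
    refine ⟨⟨BlowupChart.resY hk.1 r, ?_⟩, ?_⟩
    · refine (Y.basicOpen_res r (homOfLE (BlowupChart.le_carrier hk.1)).op).trans ?_
      rw [← hs, inf_comm]
      exact (Y.basicOpen_mul r s).symm
    · by_cases he : i.side = k.side
      · exact .inr ((if_pos he).trans he)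
      · exact .inl (if_neg he)
  have hln : l ≤ n := hli.trans hi
  have h1 : incl hi xi ∈ Set.range (incl hi) := ⟨_, rfl⟩
  have h2 : incl hi xi ∈ Set.range (incl hk) := ⟨xk, h.symm⟩
  rw [mem_range_incl hi r hr] at h1
  rw [mem_range_incl hk s hs] at h2
  have h3 : incl hi xi ∈ Set.range (incl hln) := by
    rw [mem_range_incl hln (r * s) rfl, map_mul]
    refine ⟨fun hmem =>
      (Ideal.IsPrime.mem_or_mem (PrimeSpectrum.isPrime _) hmem).elim h1.1 h2.1, ?_⟩
    rcases hlside with he | he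
    · rw [factor_eq_of_side_eq hln hi he]; exact h1.2
    · rw [factor_eq_of_side_eq hln hk he]; exact h2.2
  obtain ⟨x, hx⟩ := h3
  refine ⟨l, hli, hlk, x, ?_, ?_⟩
  · apply (incl hi).isOpenEmbedding.injective
    rw [← Scheme.Hom.comp_apply, incl_comp, hx]
  · apply (incl hk).isOpenEmbedding.injective
    rw [← Scheme.Hom.comp_apply, incl_comp, hx, h]

end BlowupIndex

variable (j I₁ I₂)

/-- The diagram of the affine pieces of the blow-up. -/
noncomputable def blowupDiagram : BlowupIndex j I₁ I₂ ⥤ Scheme.{u} where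
  obj m := m.piece
  map f := BlowupIndex.incl f.le
  map_id _ := BlowupIndex.incl_refl _
  map_comp f g := (BlowupIndex.incl_comp f.le g.le).symm

variable [QuasiCompact j] [QuasiSeparated j]

instance {m n : BlowupIndex j I₁ I₂} (f : m ⟶ n) :
    IsOpenImmersion ((blowupDiagram j I₁ I₂).map f) :=
  BlowupIndex.isOpenImmersion_incl f.le

instance : (blowupDiagram j I₁ I₂ ⋙ Scheme.forget).IsLocallyDirected where
  cond fi fj xi xj h := by
    obtain ⟨l, h1, h2, x, hx1, hx2⟩ := BlowupIndex.exists_incl_eq fi.le fj.le xi xj h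
    exact ⟨l, homOfLE h1, homOfLE h2, x, hx1, hx2⟩

/-- The closure of the image of `U` in the blow-up of `Y` in the sum of two locally principal ideals
that are invertible on `U`, glued from its affine pieces. -/
noncomputable def blowup : Scheme.{u} := colimit (blowupDiagram j I₁ I₂)

/-- The projection of the blow-up to the base. -/
noncomputable def blowupπ : blowup j I₁ I₂ ⟶ Y :=
  colimit.desc (blowupDiagram j I₁ I₂)
    { pt := Y
      ι := { app := fun m => m.toBase
             naturality := fun _ _ f =>
               (BlowupIndex.incl_toBase f.le).trans (Category.comp_id _).symm } }

variable {j I₁ I₂}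

namespace BlowupIndex

/-- The inclusion of an affine piece into the blow-up. -/
noncomputable def ι (m : BlowupIndex j I₁ I₂) : m.piece ⟶ blowup j I₁ I₂ :=
  colimit.ι (blowupDiagram j I₁ I₂) m

instance (m : BlowupIndex j I₁ I₂) : IsOpenImmersion m.ι :=
  inferInstanceAs (IsOpenImmersion (colimit.ι (blowupDiagram j I₁ I₂) m))

theorem ι_π (m : BlowupIndex j I₁ I₂) : m.ι ≫ blowupπ j I₁ I₂ = m.toBase :=
  colimit.ι_desc _ _

theorem incl_ι {m n : BlowupIndex j I₁ I₂} (h : m ≤ n) : incl h ≫ n.ι = m.ι :=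
  colimit.w (blowupDiagram j I₁ I₂) (homOfLE h)

theorem range_ι_mono {m n : BlowupIndex j I₁ I₂} (h : m ≤ n) :
    Set.range m.ι ⊆ Set.range n.ι := by
  rintro _ ⟨x, rfl⟩
  exact ⟨incl h x, by rw [← Scheme.Hom.comp_apply, incl_ι]⟩

theorem exists_ι_eq (x : blowup j I₁ I₂) :
    ∃ (m : BlowupIndex j I₁ I₂) (y : m.piece), m.ι y = x :=
  Scheme.IsLocallyDirected.ι_jointly_surjective (blowupDiagram j I₁ I₂) x

/-- Over a chart, the blow-up is the union of the two pieces of this chart. -/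
theorem exists_mem_range_ι (c : BlowupChart j I₁ I₂) (x : blowup j I₁ I₂)
    (hx : blowupπ j I₁ I₂ x ∈ c.carrier.1) :
    ∃ s : Bool, x ∈ Set.range (BlowupIndex.mk c (some s)).ι := by
  obtain ⟨⟨d, t⟩, y, rfl⟩ := exists_ι_eq x
  let m : BlowupIndex j I₁ I₂ := ⟨d, t⟩
  rw [← Scheme.Hom.comp_apply, ι_π] at hx
  obtain ⟨f, g, e, hyf⟩ := exists_basicOpen_le_affine_inter c.carrier.2 d.carrier.2 _
    ⟨hx, m.range_toBase_subset y⟩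
  let m' : BlowupIndex j I₁ I₂ := ⟨c.basicOpen f, t⟩
  have hm : m' ≤ m := ⟨⟨g, e.symm⟩, .inr rfl⟩
  have hyr : (y : m.piece) ∈ Set.range (incl hm) := by
    rw [mem_range_incl hm g e.symm, factor_of_eq hm rfl]
    rw [e] at hyf
    exact ⟨(m.toBase_mem_basicOpen y g).mp hyf,
      (Ideal.ne_top_iff_one _).mp (PrimeSpectrum.isPrime y).ne_top⟩
  have h1 : m.ι y ∈ Set.range m'.ι := by
    obtain ⟨z, rfl⟩ := hyr
    exact ⟨z, by rw [← Scheme.Hom.comp_apply, incl_ι]⟩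
  refine ⟨t.getD true, range_ι_mono (m := m') ⟨c.basicOpen_le f, ?_⟩ h1⟩
  rcases t with _ | t
  · exact .inl rfl
  · exact .inr rfl

theorem exists_mem_ι_of_ι_eq {m n : BlowupIndex j I₁ I₂} {x : m.piece} {y : n.piece}
    (h : m.ι x = n.ι y) :
    ∃ (l : BlowupIndex j I₁ I₂) (hm : l ≤ m) (hn : l ≤ n) (z : l.piece),
      incl hm z = x ∧ incl hn z = y := by
  obtain ⟨l, f, g, z, h1, h2⟩ :=
    (Scheme.IsLocallyDirected.ι_eq_ι_iff (F := blowupDiagram j I₁ I₂)).mp h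
  exact ⟨l, f.le, g.le, z, h1, h2⟩

end BlowupIndex

end Blowup

/-! ### Finiteness of the blow-up -/

section Blowup

variable {U Y : Scheme.{u}} {j : U ⟶ Y} {I₁ I₂ : Y.IdealSheafData}

namespace BlowupIndex

theorem finite_gens (m : BlowupIndex j I₁ I₂) : m.gens.Finite :=
  (Set.finite_range m.chart.ratio).subset (by rintro _ ⟨s, -, rfl⟩; exact ⟨s, rfl⟩)

theorem finiteType_structureMap (m : BlowupIndex j I₁ I₂) : m.structureMap.FiniteType := by
  let _ := m.structureMap.toAlgebra
  have hfin : (((↑) : m.ring → m.chart.Sections) ⁻¹' m.gens).Finite :=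
    m.finite_gens.preimage Subtype.val_injective.injOn
  refine ⟨⟨hfin.toFinset, ?_⟩⟩
  rw [Set.Finite.coe_toFinset]
  set S := Algebra.adjoin Γ(Y, m.chart.carrier.1) (((↑) : m.ring → m.chart.Sections) ⁻¹' m.gens)
    with hS
  have h : m.ring ≤ S.toSubring.map m.ring.subtype := by
    refine Subring.closure_le.mpr ?_
    rintro _ (⟨y, rfl⟩ | ⟨s, hs, rfl⟩)
    · exact ⟨m.structureMap y, S.algebraMap_mem y, rfl⟩
    · exact ⟨⟨m.chart.ratio s, m.ratio_mem hs⟩, Algebra.subset_adjoin ⟨s, hs, rfl⟩, rfl⟩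
  refine top_le_iff.mp fun x _ => ?_
  obtain ⟨y, hy, hyx⟩ := h x.2
  exact (Subtype.ext hyx : y = x) ▸ hy

instance (m : BlowupIndex j I₁ I₂) : LocallyOfFiniteType m.toBase := by
  have h1 : LocallyOfFiniteType (Spec.map (CommRingCat.ofHom m.structureMap)) :=
    HasRingHomProperty.Spec_iff.mpr m.finiteType_structureMap
  have h2 := m.chart.carrier.2.isOpenImmersion_fromSpec
  rw [toBase]
  infer_instance

/-- A divisibility between local generators in the coordinate ring of a piece is an inclusion
between the ideals pulled back to this piece. -/
theorem comap_toBase_le (m : BlowupIndex j I₁ I₂) {J J' : Y.IdealSheafData}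
    {x x' : Γ(Y, m.chart.carrier.1)} (hJ : J.ideal m.chart.carrier = Ideal.span {x})
    (hJ' : J'.ideal m.chart.carrier = Ideal.span {x'}) (t : m.ring)
    (h : t * m.structureMap x' = m.structureMap x) :
    J.comap m.toBase ≤ J'.comap m.toBase := by
  have hle : (⊤ : m.piece.Opens) ≤ m.toBase ⁻¹ᵁ m.chart.carrier.1 := fun y _ =>
    m.range_toBase_subset y
  have key : (m.toBase.appLE m.chart.carrier.1 ⊤ hle) =
      CommRingCat.ofHom m.structureMap ≫ (Scheme.ΓSpecIso (.of m.ring)).inv := by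
    have := m.chart.carrier.2.isOpenImmersion_fromSpec
    apply Spec.map_injective
    rw [← cancel_mono m.chart.carrier.2.fromSpec,
      m.chart.carrier.2.SpecMap_appLE_fromSpec m.toBase (isAffineOpen_top m.piece) hle,
      IsAffineOpen.fromSpec_top, Scheme.isoSpec_Spec_inv, Spec.map_comp, Category.assoc]
    rfl
  apply Scheme.IdealSheafData.le_of_isAffine
  rw [comap_ideal J m.toBase ⟨⊤, isAffineOpen_top m.piece⟩ m.chart.carrier hle,
    comap_ideal J' m.toBase ⟨⊤, isAffineOpen_top m.piece⟩ m.chart.carrier hle, hJ, hJ',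
    Ideal.map_span, Ideal.map_span, Set.image_singleton, Set.image_singleton,
    Ideal.span_singleton_le_span_singleton, key]
  refine ⟨(Scheme.ΓSpecIso (.of m.ring)).inv t, ?_⟩
  change (Scheme.ΓSpecIso (.of m.ring)).inv (m.structureMap x) =
    (Scheme.ΓSpecIso (.of m.ring)).inv (m.structureMap x') * _
  rw [← h, ← map_mul, mul_comm]

end BlowupIndex

variable [QuasiCompact j] [QuasiSeparated j]

instance locallyOfFiniteType_blowupπ : LocallyOfFiniteType (blowupπ j I₁ I₂) := by
  have hL : IsZariskiLocalAtSource (@LocallyOfFiniteType.{u}) :=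
    HasRingHomProperty.instIsZariskiLocalAtSource
  refine (hL.iff_of_openCover
    (Scheme.IsLocallyDirected.openCover (blowupDiagram j I₁ I₂))).mpr ?_
  intro (m : BlowupIndex j I₁ I₂)
  have h : m.ι ≫ blowupπ j I₁ I₂ = m.toBase := m.ι_π
  exact h ▸ (inferInstance : LocallyOfFiniteType m.toBase)

theorem quasiCompact_blowupπ (hc : ∀ y : Y, ∃ c : BlowupChart j I₁ I₂, y ∈ c.carrier.1) :
    QuasiCompact (blowupπ j I₁ I₂) := by
  have hsup : ⨆ c : BlowupChart j I₁ I₂, c.carrier.1 = ⊤ :=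
    top_le_iff.mp fun y _ => TopologicalSpace.Opens.mem_iSup.mpr (hc y)
  have hL : IsZariskiLocalAtTarget (@QuasiCompact.{u}) :=
    @HasAffineProperty.instIsZariskiLocalAtTarget _ _
      instHasAffinePropertyQuasiCompactCompactSpaceCarrierCarrierCommRingCat
  refine (hL.iff_of_iSup_eq_top _ hsup).mpr fun c => ?_
  have : IsAffine c.carrier.1 := c.carrier.2
  have h : IsCompact (blowupπ j I₁ I₂ ⁻¹ᵁ c.carrier.1 : Set (blowup j I₁ I₂)) := by
    have : (blowupπ j I₁ I₂ ⁻¹ᵁ c.carrier.1 : Set (blowup j I₁ I₂)) =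
        ⋃ s : Bool, Set.range (BlowupIndex.mk c (some s)).ι := by
      ext x
      rw [Set.mem_iUnion]
      refine ⟨fun hx => BlowupIndex.exists_mem_range_ι c x hx, ?_⟩
      rintro ⟨s, y, rfl⟩
      change blowupπ j I₁ I₂ _ ∈ c.carrier.1
      rw [← Scheme.Hom.comp_apply, BlowupIndex.ι_π]
      exact (BlowupIndex.mk c (some s)).range_toBase_subset y
    rw [this]
    exact isCompact_iUnion fun s => isCompact_range (Scheme.Hom.continuous _)
  have : CompactSpace (blowupπ j I₁ I₂ ⁻¹ᵁ c.carrier.1) := isCompact_iff_compactSpace.mp h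
  infer_instance

/-! ### The map from `U` to the blow-up -/

/-- The open cover of `U` by the preimages of the charts. -/
abbrev chartCover (hc : ∀ y : Y, ∃ c : BlowupChart j I₁ I₂, y ∈ c.carrier.1) : U.OpenCover where
  I₀ := BlowupChart j I₁ I₂
  X c := (j ⁻¹ᵁ c.carrier.1).toScheme
  f c := (j ⁻¹ᵁ c.carrier.1).ι
  mem₀ := by
    rw [Scheme.presieve₀_mem_precoverage_iff]
    refine ⟨fun x => ?_, inferInstance⟩
    obtain ⟨c, hxc⟩ := hc (j x)
    exact ⟨c, ⟨x, hxc⟩, rfl⟩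

/-- The inclusions between the members of the cover by charts. -/
noncomputable abbrev chartCoverMap {c d : BlowupChart j I₁ I₂} (h : c ≤ d) :
    (j ⁻¹ᵁ c.carrier.1).toScheme ⟶ (j ⁻¹ᵁ d.carrier.1).toScheme :=
  U.homOfLE (j.preimage_mono (BlowupChart.le_carrier h))

noncomputable instance (hc : ∀ y : Y, ∃ c : BlowupChart j I₁ I₂, y ∈ c.carrier.1) :
    (chartCover hc).LocallyDirected where
  trans f := chartCoverMap f.le
  trans_id c := by
    rw [← cancel_mono (j ⁻¹ᵁ c.carrier.1).ι]
    exact (Scheme.homOfLE_ι _ _).trans (Category.id_comp _).symm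
  trans_comp f g := (Scheme.homOfLE_homOfLE _ _ _).symm
  w f := Scheme.homOfLE_ι _ _
  directed {c d} x := by
    let p₁ := pullback.fst (j ⁻¹ᵁ c.carrier.1).ι (j ⁻¹ᵁ d.carrier.1).ι
    let p₂ := pullback.snd (j ⁻¹ᵁ c.carrier.1).ι (j ⁻¹ᵁ d.carrier.1).ι
    have hp : p₁ ≫ (j ⁻¹ᵁ c.carrier.1).ι = p₂ ≫ (j ⁻¹ᵁ d.carrier.1).ι := pullback.condition
    let a := (p₁ ≫ (j ⁻¹ᵁ c.carrier.1).ι) x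
    have ha1 : j a ∈ c.carrier.1 := (p₁ x).2
    have ha2 : j a ∈ d.carrier.1 := by
      unfold a
      rw [hp]
      exact (p₂ x).2
    obtain ⟨f, g, e, hxf⟩ :=
      exists_basicOpen_le_affine_inter c.carrier.2 d.carrier.2 _ ⟨ha1, ha2⟩
    have hd : c.basicOpen f ≤ d := ⟨g, e.symm⟩
    refine ⟨c.basicOpen f, homOfLE (c.basicOpen_le f), homOfLE hd, ⟨a, hxf⟩, ?_⟩
    apply (p₁ ≫ (j ⁻¹ᵁ c.carrier.1).ι).isOpenEmbedding.injective
    have hw : chartCoverMap (c.basicOpen_le f) ≫ (j ⁻¹ᵁ c.carrier.1).ι =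
        chartCoverMap hd ≫ (j ⁻¹ᵁ d.carrier.1).ι := by
      rw [Scheme.homOfLE_ι, Scheme.homOfLE_ι]
    have key : pullback.lift _ _ hw ≫ p₁ ≫ (j ⁻¹ᵁ c.carrier.1).ι =
        (j ⁻¹ᵁ (c.basicOpen f).carrier.1).ι := by
      rw [pullback.lift_fst_assoc, Scheme.homOfLE_ι]
    exact congrArg (fun φ : (j ⁻¹ᵁ (c.basicOpen f).carrier.1).toScheme ⟶ U => φ ⟨a, hxf⟩) key

/-- The map to the blow-up on a chart. -/
noncomputable def chartToBlowup (c : BlowupChart j I₁ I₂) :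
    (j ⁻¹ᵁ c.carrier.1).toScheme ⟶ blowup j I₁ I₂ :=
  (j ⁻¹ᵁ c.carrier.1).toSpecΓ ≫
    Spec.map (CommRingCat.ofHom (BlowupIndex.mk c none).ring.subtype) ≫ (BlowupIndex.mk c none).ι

theorem chartCoverMap_chartToBlowup {c d : BlowupChart j I₁ I₂} (h : c ≤ d) :
    chartCoverMap h ≫ chartToBlowup d = chartToBlowup c := by
  have hcd : BlowupIndex.mk c none ≤ BlowupIndex.mk d none := ⟨h, .inl rfl⟩
  rw [chartToBlowup, chartToBlowup, ← Scheme.Opens.toSpecΓ_SpecMap_presheaf_map_assoc,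
    ← BlowupIndex.incl_ι hcd, BlowupIndex.incl]
  congr 1
  rw [← Spec.map_comp_assoc, ← Spec.map_comp_assoc]
  rfl

theorem chartToBlowup_π (c : BlowupChart j I₁ I₂) :
    chartToBlowup c ≫ blowupπ j I₁ I₂ = (j ⁻¹ᵁ c.carrier.1).ι ≫ j := by
  rw [chartToBlowup, Category.assoc, Category.assoc, BlowupIndex.ι_π, BlowupIndex.toBase,
    ← Spec.map_comp_assoc]
  change (j ⁻¹ᵁ c.carrier.1).toSpecΓ ≫ Spec.map (j.app _) ≫ c.carrier.2.fromSpec = _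
  rw [Scheme.Opens.toSpecΓ_naturality_assoc, c.carrier.2.toSpecΓ_fromSpec, morphismRestrict_ι]

/-- `U` maps to the blow-up: its sections receive the coordinate rings of all pieces. -/
theorem exists_comp_blowupπ (hc : ∀ y : Y, ∃ c : BlowupChart j I₁ I₂, y ∈ c.carrier.1) :
    ∃ i : U ⟶ blowup j I₁ I₂, i ≫ blowupπ j I₁ I₂ = j := by
  refine ⟨(chartCover hc).glueMorphismsOfLocallyDirected chartToBlowup
    fun f => chartCoverMap_chartToBlowup f.le, ?_⟩
  refine (chartCover hc).hom_ext _ _ fun c => ?_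
  have h : (chartCover hc).f c ≫ (chartCover hc).glueMorphismsOfLocallyDirected chartToBlowup
      (fun f => chartCoverMap_chartToBlowup f.le) = chartToBlowup c :=
    Scheme.OpenCover.map_glueMorphismsOfLocallyDirected ..
  exact (Category.assoc _ _ _).symm.trans
    ((congrArg (fun φ => φ ≫ blowupπ j I₁ I₂) h).trans (chartToBlowup_π c))

/-! ### Comparability of the two ideals -/

/-- Two ideal sheaves are locally comparable if locally one of them contains the other. -/
def LocallyComparable {X : Scheme.{u}} (I J : X.IdealSheafData) : Prop :=
  ∀ x : X, ∃ O : X.Opens, x ∈ O ∧ (I.comap O.ι ≤ J.comap O.ι ∨ J.comap O.ι ≤ I.comap O.ι)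

theorem LocallyComparable.comap {X X' : Scheme.{u}} {I J : X.IdealSheafData}
    (h : LocallyComparable I J) (f : X' ⟶ X) : LocallyComparable (I.comap f) (J.comap f) := by
  intro x
  obtain ⟨O, hO, h⟩ := h (f x)
  refine ⟨f ⁻¹ᵁ O, hO, ?_⟩
  have key (K : X.IdealSheafData) :
      (K.comap f).comap (f ⁻¹ᵁ O).ι = (K.comap O.ι).comap (f ∣_ O) := by
    rw [← Scheme.IdealSheafData.comap_comp, ← Scheme.IdealSheafData.comap_comp,
      morphismRestrict_ι]
  rw [key, key]
  exact h.imp (fun h => Scheme.IdealSheafData.comap_mono _ h)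
    (fun h => Scheme.IdealSheafData.comap_mono _ h)

/-- On the pieces of the side `true` one has `b = (b / a) * a`, and on those of the side `false` one
has `a = (a / b) * b`. -/
theorem locallyComparable_blowup (hc : ∀ y : Y, ∃ c : BlowupChart j I₁ I₂, y ∈ c.carrier.1) :
    LocallyComparable (I₁.comap (blowupπ j I₁ I₂)) (I₂.comap (blowupπ j I₁ I₂)) := by
  intro x
  obtain ⟨c, hxc⟩ := hc (blowupπ j I₁ I₂ x)
  obtain ⟨s, hs⟩ := BlowupIndex.exists_mem_range_ι c x hxc
  let m : BlowupIndex j I₁ I₂ := ⟨c, some s⟩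
  refine ⟨m.ι.opensRange, hs, ?_⟩
  have key (K : Y.IdealSheafData) : (K.comap (blowupπ j I₁ I₂)).comap m.ι.opensRange.ι =
      (K.comap m.toBase).comap m.ι.isoOpensRange.inv := by
    rw [← m.ι_π, ← Scheme.IdealSheafData.comap_comp, ← Scheme.IdealSheafData.comap_comp,
      Scheme.Hom.isoOpensRange_inv_comp_assoc]
  rw [key, key]
  cases s
  · exact .inl (Scheme.IdealSheafData.comap_mono _ (m.comap_toBase_le c.ideal_a c.ideal_b
      ⟨_, m.ratio_mem (.inr rfl)⟩ (Subtype.ext c.ratio_false_mul)))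
  · exact .inr (Scheme.IdealSheafData.comap_mono _ (m.comap_toBase_le c.ideal_b c.ideal_a
      ⟨_, m.ratio_mem (.inr rfl)⟩ (Subtype.ext c.ratio_true_mul)))

end Blowup

/-! ### Properness of the blow-up -/

section Blowup

variable {U Y : Scheme.{u}} {j : U ⟶ Y} {I₁ I₂ : Y.IdealSheafData}

/-- A morphism from the spectrum of a local ring whose closed point lands in an open subscheme
lands in this open subscheme. -/
theorem range_subset_of_closedPoint {R : Type u} [CommRing R] [IsLocalRing R] {X V : Scheme.{u}}
    (f : Spec (.of R) ⟶ X) (g : V ⟶ X) [IsOpenImmersion g]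
    (h : f (IsLocalRing.closedPoint R) ∈ Set.range g) : Set.range f ⊆ Set.range g := by
  rintro _ ⟨x, rfl⟩
  exact ((IsLocalRing.specializes_closedPoint (R := R) x).map f.continuous).mem_open
    g.isOpenEmbedding.isOpen_range h

namespace BlowupIndex

/-- A ring homomorphism from the coordinate ring of a piece to the fraction field of `R` has
values in `R` if it does so on the base and on the adjoined ratios. -/
theorem exists_lift_ringHom (m : BlowupIndex j I₁ I₂) {R K : Type u} [CommRing R] [Field K]
    [Algebra R K] (hinj : Function.Injective (algebraMap R K)) (f : m.ring →+* K)
    (hY : ∀ y, ∃ r, algebraMap R K r = f (m.structureMap y))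
    (hr : ∀ s (hs : m.side = none ∨ m.side = some s),
      ∃ r, algebraMap R K r = f ⟨m.chart.ratio s, m.ratio_mem hs⟩) :
    ∃ g : m.ring →+* R, (algebraMap R K).comp g = f := by
  have h : m.ring ≤ ((algebraMap R K).range.comap f).map m.ring.subtype := by
    refine Subring.closure_le.mpr ?_
    rintro _ (⟨y, rfl⟩ | ⟨s, hs, rfl⟩)
    · exact ⟨m.structureMap y, hY y, rfl⟩
    · exact ⟨⟨m.chart.ratio s, m.ratio_mem hs⟩, hr s hs, rfl⟩
  have h' (x : m.ring) : f x ∈ (algebraMap R K).range := by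
    obtain ⟨y, hy, hyx⟩ := h x.2
    exact (Subtype.ext hyx : y = x) ▸ hy
  choose g hg using h'
  refine ⟨{ toFun := g, map_one' := hinj ?_, map_zero' := hinj ?_, map_mul' := fun x y => hinj ?_,
            map_add' := fun x y => hinj ?_ }, RingHom.ext hg⟩
  · rw [hg, map_one, map_one]
  · rw [map_mul, hg, hg, hg, map_mul]
  · rw [hg, map_zero, map_zero]
  · rw [map_add, hg, hg, hg, map_add]

end BlowupIndex

variable [QuasiCompact j] [QuasiSeparated j]

namespace BlowupIndex

/-- A ring homomorphism from the coordinate ring of `n` extends to that of a smaller piece on the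
same chart as soon as it sends the ratio to be inverted to a unit. -/
theorem exists_comp_incl {m n : BlowupIndex j I₁ I₂} (h : m ≤ n)
    (hc : m.chart.carrier.1 = n.chart.carrier.1) {R : Type u} [CommRing R] (f : n.ring →+* R)
    (hf : IsUnit (f (factor h))) : ∃ g : m.ring →+* R, g.comp (map h) = f := by
  have := isLocalization_map h 1 ((Scheme.basicOpen_of_isUnit _ isUnit_one).trans hc.symm)
  let _ := (map h).toAlgebra
  have hu : IsUnit (f (n.structureMap 1 * factor h)) := by
    rwa [map_one, one_mul]
  exact ⟨IsLocalization.Away.lift _ hu, IsLocalization.Away.lift_comp _ hu⟩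

end BlowupIndex

/-- The existence part of the valuative criterion: of the two ratios, one is integral. -/
theorem existence_blowupπ (hc : ∀ y : Y, ∃ c : BlowupChart j I₁ I₂, y ∈ c.carrier.1) :
    ValuativeCriterion.Existence (blowupπ j I₁ I₂) := by
  intro S
  obtain ⟨c, hyc⟩ := hc (S.i₂ (IsLocalRing.closedPoint S.R))
  have hWo := c.carrier.2.isOpenImmersion_fromSpec
  -- the base point is a point of the chart
  have hW := range_subset_of_closedPoint S.i₂ c.carrier.2.fromSpec
    (by rw [c.carrier.2.range_fromSpec]; exact hyc)
  obtain ⟨β, hβ⟩ : ∃ β : Γ(Y, c.carrier.1) →+* S.R,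
      Spec.map (CommRingCat.ofHom β) ≫ c.carrier.2.fromSpec = S.i₂ :=
    ⟨(Spec.preimage (IsOpenImmersion.lift c.carrier.2.fromSpec S.i₂ hW)).hom, by
      rw [CommRingCat.ofHom_hom, Spec.map_preimage, IsOpenImmersion.lift_fac]⟩
  have hinj : Function.Injective (algebraMap S.R S.K) := IsFractionRing.injective S.R S.K
  -- the generic point lies on one of the two pieces
  let pt : Spec (.of S.K) := IsLocalRing.closedPoint S.K
  have hpt : blowupπ j I₁ I₂ (S.i₁ pt) ∈ c.carrier.1 := by
    rw [← Scheme.Hom.comp_apply, S.commSq.w, Scheme.Hom.comp_apply]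
    have := hW ⟨Spec.map (CommRingCat.ofHom (algebraMap S.R S.K)) pt, rfl⟩
    rwa [c.carrier.2.range_fromSpec] at this
  obtain ⟨s, hs⟩ := BlowupIndex.exists_mem_range_ι c _ hpt
  let n (s : Bool) : BlowupIndex j I₁ I₂ := ⟨c, some s⟩
  let m : BlowupIndex j I₁ I₂ := ⟨c, none⟩
  have hmn (s : Bool) : m ≤ n s := ⟨le_rfl, .inl rfl⟩
  have hK := range_subset_of_closedPoint S.i₁ (n s).ι hs
  obtain ⟨α, hα⟩ : ∃ α : (n s).ring →+* S.K, Spec.map (CommRingCat.ofHom α) ≫ (n s).ι = S.i₁ :=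
    ⟨(Spec.preimage (IsOpenImmersion.lift (n s).ι S.i₁ hK)).hom, by
      rw [CommRingCat.ofHom_hom, Spec.map_preimage, IsOpenImmersion.lift_fac]⟩
  -- a lift exists as soon as a piece containing the generic point has an integral ratio
  have main (s : Bool) (α : (n s).ring →+* S.K)
      (hα : Spec.map (CommRingCat.ofHom α) ≫ (n s).ι = S.i₁)
      (hint : ∃ r, algebraMap S.R S.K r = α ⟨c.ratio s, (n s).ratio_mem (.inr rfl)⟩) :
      S.commSq.HasLift := by
    have hbase : α.comp (n s).structureMap = (algebraMap S.R S.K).comp β := by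
      have h1 := S.commSq.w
      rw [← hα, Category.assoc, BlowupIndex.ι_π, ← hβ, BlowupIndex.toBase, ← Category.assoc,
        ← Category.assoc, cancel_mono, ← Spec.map_comp, ← Spec.map_comp] at h1
      exact congrArg CommRingCat.Hom.hom (Spec.map_injective h1)
    obtain ⟨g, hg⟩ := (n s).exists_lift_ringHom hinj α
      (fun y => ⟨β y, (RingHom.congr_fun hbase y).symm⟩) (by
        rintro s' (h | h)
        · cases h
        · obtain rfl := Option.some.inj h
          exact hint)
    refine ⟨⟨⟨Spec.map (CommRingCat.ofHom g) ≫ (n s).ι, ?_, ?_⟩⟩⟩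
    · rw [← Spec.map_comp_assoc, ← CommRingCat.ofHom_comp, hg, hα]
    · rw [Category.assoc, BlowupIndex.ι_π, BlowupIndex.toBase, ← Spec.map_comp_assoc,
        ← CommRingCat.ofHom_comp, ← hβ]
      congr 3
      refine RingHom.ext fun y => hinj ?_
      exact (RingHom.congr_fun hg _).trans (RingHom.congr_fun hbase y)
  let x := α ⟨c.ratio s, (n s).ratio_mem (.inr rfl)⟩
  -- either the ratio `x` or its inverse is integral; in the second case the generic point also lies
  -- on the piece of the other side, unless `x = 0`
  rcases ValuationRing.isInteger_or_isInteger S.R x with hx | hx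
  · exact main s α hα hx
  · by_cases hx0 : x = 0
    · exact main s α hα ⟨0, by rw [map_zero]; exact hx0.symm⟩
    · have hfac : BlowupIndex.factor (hmn s) = ⟨c.ratio s, (n s).ratio_mem (.inr rfl)⟩ :=
        Subtype.ext (BlowupIndex.coe_factor_of_ne (hmn s) rfl rfl)
      obtain ⟨γ, hγ⟩ := BlowupIndex.exists_comp_incl (hmn s) rfl α
        (by rw [hfac]; exact isUnit_iff_ne_zero.mpr hx0)
      refine main (!s) (γ.comp (BlowupIndex.map (hmn (!s)))) ?_ ?_
      · rw [CommRingCat.ofHom_comp, Spec.map_comp, Category.assoc]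
        change _ ≫ BlowupIndex.incl (hmn (!s)) ≫ (n (!s)).ι = _
        rw [BlowupIndex.incl_ι, ← BlowupIndex.incl_ι (hmn s), ← hα, ← hγ, CommRingCat.ofHom_comp,
          Spec.map_comp, Category.assoc]
        rfl
      · obtain ⟨r, hr⟩ := hx
        refine ⟨r, hr.trans ?_⟩
        refine inv_eq_of_mul_eq_one_right ?_
        change α _ * γ _ = 1
        rw [← hγ, RingHom.comp_apply, ← map_mul, ← map_one γ]
        congr 1
        refine Subtype.ext ?_
        change BlowupChart.res _ (c.ratio s) * BlowupChart.res _ (c.ratio (!s)) = 1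
        rw [← map_mul, c.ratio_mul_ratio_not, map_one]

/-- The uniqueness part of the valuative criterion. Two lifts on the two pieces of a chart have
inverse values at the two ratios, so both ratios are units and one lift moves to the other piece. -/
theorem uniqueness_blowupπ (hc : ∀ y : Y, ∃ c : BlowupChart j I₁ I₂, y ∈ c.carrier.1) :
    ValuativeCriterion.Uniqueness (blowupπ j I₁ I₂) := by
  intro S
  refine ⟨fun L₁ L₂ => ?_⟩
  have hinj : Function.Injective (algebraMap S.R S.K) := IsFractionRing.injective S.R S.K
  obtain ⟨c, hyc⟩ := hc (S.i₂ (IsLocalRing.closedPoint S.R))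
  let n (s : Bool) : BlowupIndex j I₁ I₂ := ⟨c, some s⟩
  let m : BlowupIndex j I₁ I₂ := ⟨c, none⟩
  have hmn (s : Bool) : m ≤ n s := ⟨le_rfl, .inl rfl⟩
  have hlift (L : S.commSq.LiftStruct) : ∃ (s : Bool) (g : (n s).ring →+* S.R),
      Spec.map (CommRingCat.ofHom g) ≫ (n s).ι = L.l := by
    let pt : Spec (.of S.R) := IsLocalRing.closedPoint S.R
    have hpt : blowupπ j I₁ I₂ (L.l pt) ∈ c.carrier.1 := by
      rw [← Scheme.Hom.comp_apply, L.fac_right]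
      exact hyc
    obtain ⟨s, hs⟩ := BlowupIndex.exists_mem_range_ι c _ hpt
    have hR := range_subset_of_closedPoint L.l (n s).ι hs
    exact ⟨s, (Spec.preimage (IsOpenImmersion.lift (n s).ι L.l hR)).hom, by
      rw [CommRingCat.ofHom_hom, Spec.map_preimage, IsOpenImmersion.lift_fac]⟩
  have hgen (L : S.commSq.LiftStruct) (s : Bool) (g : (n s).ring →+* S.R)
      (hg : Spec.map (CommRingCat.ofHom g) ≫ (n s).ι = L.l) :
      Spec.map (CommRingCat.ofHom ((algebraMap S.R S.K).comp g)) ≫ (n s).ι = S.i₁ := by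
    rw [CommRingCat.ofHom_comp, Spec.map_comp, Category.assoc, hg, L.fac_left]
  -- two lifts on the same piece agree
  have same (s : Bool) (g₁ g₂ : (n s).ring →+* S.R)
      (h₁ : Spec.map (CommRingCat.ofHom g₁) ≫ (n s).ι = L₁.l)
      (h₂ : Spec.map (CommRingCat.ofHom g₂) ≫ (n s).ι = L₂.l) : L₁ = L₂ := by
    have h := (hgen L₁ s g₁ h₁).trans (hgen L₂ s g₂ h₂).symm
    rw [cancel_mono] at h
    have h' := congrArg CommRingCat.Hom.hom (Spec.map_injective h)
    have : g₁ = g₂ := RingHom.ext fun x => hinj (RingHom.congr_fun h' x)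
    ext1
    rw [← h₁, ← h₂, this]
  obtain ⟨s₁, g₁, h₁⟩ := hlift L₁
  obtain ⟨s₂, g₂, h₂⟩ := hlift L₂
  by_cases hs : s₁ = s₂
  · subst hs
    exact same s₁ g₁ g₂ h₁ h₂
  · -- on different pieces, the generic point lies on the intersection, where the ratios are inverse
    have hs₂ : s₂ = !s₁ := by
      revert hs
      cases s₁ <;> cases s₂ <;> simp
    subst hs₂
    have k₁ := hgen L₁ _ g₁ h₁
    have k₂ := hgen L₂ _ g₂ h₂
    let pt : Spec (.of S.K) := IsLocalRing.closedPoint S.K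
    obtain ⟨l, hl₁, hl₂, z, hz₁, hz₂⟩ := BlowupIndex.exists_mem_ι_of_ι_eq
      (m := n s₁) (n := n (!s₁))
      (x := Spec.map (CommRingCat.ofHom ((algebraMap S.R S.K).comp g₁)) pt)
      (y := Spec.map (CommRingCat.ofHom ((algebraMap S.R S.K).comp g₂)) pt) (by
        rw [← Scheme.Hom.comp_apply, ← Scheme.Hom.comp_apply, k₁, k₂])
    have hpt : S.i₁ pt ∈ Set.range l.ι := by
      refine ⟨z, ?_⟩
      rw [← k₁, Scheme.Hom.comp_apply, ← BlowupIndex.incl_ι hl₁, Scheme.Hom.comp_apply]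
      exact congrArg (n s₁).ι hz₁
    have hR := range_subset_of_closedPoint S.i₁ l.ι hpt
    obtain ⟨γ, hγ⟩ : ∃ γ : l.ring →+* S.K, Spec.map (CommRingCat.ofHom γ) ≫ l.ι = S.i₁ :=
      ⟨(Spec.preimage (IsOpenImmersion.lift l.ι S.i₁ hR)).hom, by
        rw [CommRingCat.ofHom_hom, Spec.map_preimage, IsOpenImmersion.lift_fac]⟩
    have e (s : Bool) (hl : l ≤ n s) (g : (n s).ring →+* S.R)
        (k : Spec.map (CommRingCat.ofHom ((algebraMap S.R S.K).comp g)) ≫ (n s).ι = S.i₁)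
        (x : (n s).ring) : algebraMap S.R S.K (g x) = γ (BlowupIndex.map hl x) := by
      rw [← hγ, ← BlowupIndex.incl_ι hl, ← Category.assoc, cancel_mono, BlowupIndex.incl,
        ← Spec.map_comp] at k
      exact RingHom.congr_fun (congrArg CommRingCat.Hom.hom (Spec.map_injective k)) x
    have hunit : g₁ ⟨c.ratio s₁, (n s₁).ratio_mem (.inr rfl)⟩ *
        g₂ ⟨c.ratio (!s₁), (n (!s₁)).ratio_mem (.inr rfl)⟩ = 1 := by
      apply hinj
      rw [map_mul, e s₁ hl₁ g₁ k₁, e (!s₁) hl₂ g₂ k₂, ← map_mul, map_one, ← map_one γ]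
      congr 1
      refine Subtype.ext ?_
      change BlowupChart.res _ (c.ratio s₁) * BlowupChart.res _ (c.ratio (!s₁)) = 1
      rw [← map_mul, c.ratio_mul_ratio_not, map_one]
    have hfac : BlowupIndex.factor (hmn s₁) = ⟨c.ratio s₁, (n s₁).ratio_mem (.inr rfl)⟩ :=
      Subtype.ext (BlowupIndex.coe_factor_of_ne (hmn s₁) rfl rfl)
    obtain ⟨δ, hδ⟩ := BlowupIndex.exists_comp_incl (hmn s₁) rfl g₁
      (by rw [hfac]; exact IsUnit.of_mul_eq_one _ hunit)
    refine same (!s₁) (δ.comp (BlowupIndex.map (hmn (!s₁)))) g₂ ?_ h₂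
    rw [CommRingCat.ofHom_comp, Spec.map_comp, Category.assoc]
    change _ ≫ BlowupIndex.incl (hmn (!s₁)) ≫ (n (!s₁)).ι = _
    rw [BlowupIndex.incl_ι, ← BlowupIndex.incl_ι (hmn s₁), ← h₁, ← hδ, CommRingCat.ofHom_comp,
      Spec.map_comp, Category.assoc]
    rfl

theorem isProper_blowupπ [IsLocallyNoetherian Y]
    (hc : ∀ y : Y, ∃ c : BlowupChart j I₁ I₂, y ∈ c.carrier.1) : IsProper (blowupπ j I₁ I₂) := by
  have := quasiCompact_blowupπ hc
  have := LocallyOfFiniteType.isLocallyNoetherian (blowupπ j I₁ I₂)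
  exact IsProper.of_valuativeCriterion _
    (ValuativeCriterion.iff.mpr ⟨existence_blowupπ hc, uniqueness_blowupπ hc⟩)

/-- Two locally principal ideals that are trivial on `U` become comparable on a scheme that is
proper over the base and to which `U` still maps. -/
theorem exists_proper_locallyComparable [IsLocallyNoetherian Y] (h₁ : IsLocallyPrincipal I₁)
    (h₂ : IsLocallyPrincipal I₂) (hj₁ : I₁.comap j = ⊤) (hj₂ : I₂.comap j = ⊤) :
    ∃ (X : Scheme.{u}) (p : X ⟶ Y) (i : U ⟶ X), IsProper p ∧ i ≫ p = j ∧
      LocallyComparable (I₁.comap p) (I₂.comap p) := by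
  -- the charts cover `Y`
  have hc (y : Y) : ∃ c : BlowupChart j I₁ I₂, y ∈ c.carrier.1 := by
    obtain ⟨V, hV, a, ha⟩ := h₁ y
    obtain ⟨W, hW, b, hb⟩ := h₂ y
    obtain ⟨f, g, e, hf⟩ := exists_basicOpen_le_affine_inter V.2 W.2 y ⟨hV, hW⟩
    let D : Y.affineOpens := ⟨Y.basicOpen f, V.2.basicOpen f⟩
    have hDV : D ≤ V := Y.basicOpen_le f
    have hDW : D ≤ W := by
      change Y.basicOpen f ≤ W.1
      rw [e]; exact Y.basicOpen_le g
    have ha' := I₁.map_ideal hDV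
    have hb' := I₂.map_ideal hDW
    rw [ha, Ideal.map_span, Set.image_singleton] at ha'
    rw [hb, Ideal.map_span, Set.image_singleton] at hb'
    exact ⟨⟨D, _, _, ha'.symm, hb'.symm, isUnit_app_of_comap_eq_top j I₁ hj₁ D _ ha'.symm,
      isUnit_app_of_comap_eq_top j I₂ hj₂ D _ hb'.symm⟩, hf⟩
  obtain ⟨i, hi⟩ := exists_comp_blowupπ hc
  exact ⟨_, _, i, isProper_blowupπ hc, hi, locallyComparable_blowup hc⟩

end Blowup

/-! ### Locally comparable ideals -/

theorem ideal_le_of_comap_ι_le {X : Scheme.{u}} {I J : X.IdealSheafData} {O : X.Opens}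
    (h : I.comap O.ι ≤ J.comap O.ι) (V : X.affineOpens) (hV : V.1 ≤ O) :
    I.ideal V ≤ J.ideal V := by
  have : IsAffine V.1 := V.2
  have h1 : I.comap V.1.ι ≤ J.comap V.1.ι := by
    rw [← X.homOfLE_ι hV, Scheme.IdealSheafData.comap_comp, Scheme.IdealSheafData.comap_comp]
    exact Scheme.IdealSheafData.comap_mono _ h
  have h2 := ideal_image_le_of_comap_le V.1.ι ⟨⊤, isAffineOpen_top V.1.toScheme⟩ (h1 _)
  have e : (⟨V.1.ι ''ᵁ ⊤, (isAffineOpen_top V.1.toScheme).image_of_isOpenImmersion V.1.ι⟩ :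
      X.affineOpens) = V := Subtype.ext (by simp)
  exact e ▸ h2

theorem IsLocallyPrincipal.exists_le {X : Scheme.{u}} {I : X.IdealSheafData}
    (hI : IsLocallyPrincipal I) (O : X.Opens) (x : X) (hx : x ∈ O) :
    ∃ V : X.affineOpens, x ∈ V.1 ∧ V.1 ≤ O ∧ ∃ a, I.ideal V = Ideal.span {a} := by
  obtain ⟨V, hV, a, ha⟩ := hI x
  obtain ⟨f, hf, hxf⟩ := V.2.exists_basicOpen_le ⟨x, hx⟩ hV
  have hDV : (⟨X.basicOpen f, V.2.basicOpen f⟩ : X.affineOpens) ≤ V := X.basicOpen_le f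
  have h := I.map_ideal hDV
  rw [ha, Ideal.map_span, Set.image_singleton] at h
  exact ⟨⟨X.basicOpen f, V.2.basicOpen f⟩, hxf, hf, _, h.symm⟩

theorem LocallyComparable.exists_affine {X : Scheme.{u}} {I J : X.IdealSheafData}
    (h : LocallyComparable I J) (hI : IsLocallyPrincipal I) (hJ : IsLocallyPrincipal J) (x : X) :
    ∃ V : X.affineOpens, x ∈ V.1 ∧
      (((I ⊓ J).ideal V = I.ideal V ∧ ∃ a, I.ideal V = Ideal.span {a}) ∨
        ((I ⊓ J).ideal V = J.ideal V ∧ ∃ b, J.ideal V = Ideal.span {b})) := by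
  obtain ⟨O, hx, h | h⟩ := h x
  · obtain ⟨V, hxV, hVO, ha⟩ := hI.exists_le O x hx
    exact ⟨V, hxV, .inl ⟨inf_eq_left.mpr (ideal_le_of_comap_ι_le h V hVO), ha⟩⟩
  · obtain ⟨V, hxV, hVO, hb⟩ := hJ.exists_le O x hx
    exact ⟨V, hxV, .inr ⟨inf_eq_right.mpr (ideal_le_of_comap_ι_le h V hVO), hb⟩⟩

/-- Forming the intersection of locally comparable ideals commutes with pullback; this is the
nontrivial inclusion. It holds because the intersection is locally one of the two ideals. -/
theorem LocallyComparable.le_comap_inf {X Z : Scheme.{u}} {I J : X.IdealSheafData}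
    (h : LocallyComparable I J) (hI : IsLocallyPrincipal I) (hJ : IsLocallyPrincipal J)
    (q : Z ⟶ X) : I.comap q ⊓ J.comap q ≤ (I ⊓ J).comap q := by
  refine idealSheaf_le_of_locally fun z => ?_
  obtain ⟨V, hzV, hV⟩ := h.exists_affine hI hJ (q z)
  obtain ⟨_, ⟨W, hW, rfl⟩, hzW, hWV⟩ :=
    Z.isBasis_affineOpens.exists_subset_of_mem_open (show z ∈ q ⁻¹ᵁ V.1 from hzV) (q ⁻¹ᵁ V.1).2
  refine ⟨⟨W, hW⟩, hzW, ?_⟩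
  rw [comap_ideal (I ⊓ J) q ⟨W, hW⟩ V hWV]
  rcases hV with ⟨hV, -⟩ | ⟨hV, -⟩
  · rw [hV, ← comap_ideal I q ⟨W, hW⟩ V hWV]
    exact inf_le_left
  · rw [hV, ← comap_ideal J q ⟨W, hW⟩ V hWV]
    exact inf_le_right

/-- The intersection of two comparable locally principal ideals is an effective Cartier divisor as
soon as both become trivial on a dense open subscheme. -/
theorem LocallyComparable.isEffectiveCartier_inf {U X : Scheme.{u}} {I J : X.IdealSheafData}
    (h : LocallyComparable I J) (hI : IsLocallyPrincipal I) (hJ : IsLocallyPrincipal J)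
    (i : U ⟶ X) [IsSchemeTheoreticallyDominant i] [QuasiCompact i] (hiI : I.comap i = ⊤)
    (hiJ : J.comap i = ⊤) : IsEffectiveCartier (I ⊓ J) := by
  intro x
  obtain ⟨V, hxV, hV⟩ := h.exists_affine hI hJ x
  have key (K : X.IdealSheafData) (hK : K.comap i = ⊤) (a : Γ(X, V.1))
      (ha : K.ideal V = Ideal.span {a}) : a ∈ nonZeroDivisors Γ(X, V.1) := by
    refine mem_nonZeroDivisors_iff_right.mpr fun y hy => i.app_injective V.1 ?_
    have h1 := congrArg (i.app V.1) hy
    rw [map_mul, map_zero] at h1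
    rw [map_zero]
    exact ((isUnit_app_of_comap_eq_top i K hK V a ha).mul_left_eq_zero).mp h1
  rcases hV with ⟨hV, a, ha⟩ | ⟨hV, a, ha⟩
  · exact ⟨V, hxV, a, key I hiI a ha, hV.trans ha⟩
  · exact ⟨V, hxV, a, key J hiJ a ha, hV.trans ha⟩

theorem offSupport_inf_le_left {X : Scheme.{u}} (I J : X.IdealSheafData) :
    offSupport (I ⊓ J) ≤ offSupport I := fun _ hx hx' =>
  hx (Scheme.IdealSheafData.support_antitone inf_le_left hx')

theorem offSupport_inf_le_right {X : Scheme.{u}} (I J : X.IdealSheafData) :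
    offSupport (I ⊓ J) ≤ offSupport J := fun _ hx hx' =>
  hx (Scheme.IdealSheafData.support_antitone inf_le_right hx')

theorem inf_offSupport_le {X : Scheme.{u}} (I J : X.IdealSheafData) :
    offSupport I ⊓ offSupport J ≤ offSupport (I ⊓ J) := by
  rintro x ⟨h1, h2⟩ hx
  have hle : I * J ≤ I ⊓ J := fun V => Ideal.mul_le_inf
  have h3 := Scheme.IdealSheafData.support_antitone hle hx
  rw [Scheme.IdealSheafData.support_mul] at h3
  exact h3.elim h1 h2

theorem mem_offSupport_of_comap_eq_top {U X : Scheme.{u}} {I : X.IdealSheafData} {i : U ⟶ X}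
    (h : I.comap i = ⊤) (x : U) : i x ∈ offSupport I := by
  have h1 : x ∈ offSupport (I.comap i) := by
    rw [h]
    simp [offSupport]
  exact (ModulusPair.offSupport_comap i I).le h1

instance isSchemeTheoreticallyDominant_toImage {X Y : Scheme.{u}} (f : X ⟶ Y) [QuasiCompact f] :
    IsSchemeTheoreticallyDominant f.toImage := by
  refine ⟨?_⟩
  refine Scheme.IdealSheafData.ext_of_iSup_eq_top
    (fun V : Y.affineOpens => ⟨f.imageι ⁻¹ᵁ V.1, V.2.preimage f.imageι⟩) ?_ fun V => ?_
  · refine top_le_iff.mp fun x _ => ?_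
    obtain ⟨V, hV⟩ := TopologicalSpace.Opens.mem_iSup.mp
      ((iSup_affineOpens_eq_top Y).ge (Set.mem_univ (f.imageι x)))
    exact TopologicalSpace.Opens.mem_iSup.mpr ⟨V, hV⟩
  · rw [Scheme.Hom.ker_apply]
    exact (RingHom.injective_iff_ker_eq_bot _).mp (f.toImage_app_injective V)

/-- The proper scheme making two ideals comparable can be replaced by the closure of `U` in it. -/
theorem exists_proper_dominant_locallyComparable {U Y : Scheme.{u}} {j : U ⟶ Y}
    {I₁ I₂ : Y.IdealSheafData} [QuasiCompact j] [QuasiSeparated j] [IsLocallyNoetherian Y]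
    (h₁ : IsLocallyPrincipal I₁)
    (h₂ : IsLocallyPrincipal I₂) (hj₁ : I₁.comap j = ⊤) (hj₂ : I₂.comap j = ⊤) :
    ∃ (X : Scheme.{u}) (p : X ⟶ Y) (i : U ⟶ X), IsProper p ∧ IsSchemeTheoreticallyDominant i ∧
      QuasiCompact i ∧ i ≫ p = j ∧ LocallyComparable (I₁.comap p) (I₂.comap p) := by
  obtain ⟨X, p, i, hp, hi, h⟩ := exists_proper_locallyComparable h₁ h₂ hj₁ hj₂
  have : QuasiCompact (i ≫ p) := by rwa [hi]
  have : QuasiCompact i := .of_comp i p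
  refine ⟨i.image, i.imageι ≫ p, i.toImage, inferInstance, inferInstance, inferInstance, ?_, ?_⟩
  · rw [← Category.assoc, Scheme.Hom.toImage_imageι, hi]
  · rw [Scheme.IdealSheafData.comap_comp, Scheme.IdealSheafData.comap_comp]
    exact h.comap _

/-- If a scheme-theoretically dominant morphism `U ⟶ X` factors through a closed immersion into an
open subscheme of `X`, then this open subscheme is `U`. -/
theorem isIso_of_isClosedImmersion_of_comp_ι {U X : Scheme.{u}} {O : X.Opens} (i : U ⟶ O.toScheme)
    [IsClosedImmersion i] [IsSchemeTheoreticallyDominant (i ≫ O.ι)] [QuasiCompact (i ≫ O.ι)] :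
    IsIso i := by
  have H : IsPullback (𝟙 U) i (i ≫ O.ι) O.ι := by
    refine ⟨⟨Category.id_comp _⟩, ⟨PullbackCone.IsLimit.mk _ (fun s => s.fst)
      (fun s => Category.comp_id _) (fun s => ?_) fun s m hm _ => ?_⟩⟩
    · rw [← cancel_mono O.ι, Category.assoc]
      exact s.condition
    · simpa using hm
  have := IsSchemeTheoreticallyDominant.of_isPullback H
  exact IsClosedImmersion.isIso_iff_ker_eq_bot.mpr i.ker_eq_bot

namespace ModulusPair

variable {k : Type u} [Field k]

/-! ### Fibre products of proper modulus pairs -/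

theorem range_subset_range_interior {N : ModulusPair k} {X : Scheme.{u}} (f : X ⟶ N.space)
    (h : N.divisor.comap f = ⊤) : Set.range f ⊆ Set.range N.interior.ι := by
  rintro _ ⟨x, rfl⟩
  rw [Scheme.Opens.range_ι]
  exact mem_offSupport_of_comap_eq_top h x

theorem comap_eq_top_of_le_offSupport {X Y : Scheme.{u}} {I : Y.IdealSheafData} (f : X ⟶ Y)
    (h : ∀ x, f x ∈ offSupport I) : I.comap f = ⊤ := by
  rw [← Scheme.IdealSheafData.support_eq_bot_iff, Scheme.IdealSheafData.support_comap]
  ext x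
  simp only [TopologicalSpace.Closeds.coe_preimage, Set.mem_preimage, SetLike.mem_coe,
    TopologicalSpace.Closeds.coe_bot, Set.mem_empty_iff_false, iff_false]
  exact h x

/-- A smooth closed subscheme `U` of the product of the interiors of two proper modulus pairs is
the interior of a modulus pair with the universal property expected of a fibre product. Moreover
a given morphism from `U` to a proper scheme `E` can be extended to the ambient space. -/
theorem exists_product {M₁ M₂ : ModulusPair k} (h₁ : IsProper M₁.str) (h₂ : IsProper M₂.str)
    {U E : Scheme.{u}} (j₁ : U ⟶ M₁.interior.toScheme) (j₂ : U ⟶ M₂.interior.toScheme)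
    (hj : j₁ ≫ M₁.interior.ι ≫ M₁.str = j₂ ≫ M₂.interior.ι ≫ M₂.str)
    (hU : Smooth (j₁ ≫ M₁.interior.ι ≫ M₁.str))
    (hj' : IsClosedImmersion (pullback.lift j₁ j₂ hj))
    (sE : E ⟶ Spec (.of k)) [IsProper sE] (e : U ⟶ E)
    (he : e ≫ sE = j₁ ≫ M₁.interior.ι ≫ M₁.str) :
    ∃ (P : ModulusPair k) (φ : P.interior.toScheme ⟶ U) (p₁ : P ⟶ M₁) (p₂ : P ⟶ M₂)
      (ε : P.space ⟶ E), IsProper P.str ∧ IsIso φ ∧ Hom.base p₁ = φ ≫ j₁ ∧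
      Hom.base p₂ = φ ≫ j₂ ∧ P.interior.ι ≫ ε = φ ≫ e ∧
      ∀ (X : ModulusPair k) (f₁ : X ⟶ M₁) (f₂ : X ⟶ M₂) (t : X.interior.toScheme ⟶ U),
        Hom.base f₁ = t ≫ j₁ → Hom.base f₂ = t ≫ j₂ → ∃ g : X ⟶ P, Hom.base g ≫ φ = t := by
  let A := pullback M₁.str M₂.str
  let sA : A ⟶ Spec (.of k) := pullback.fst M₁.str M₂.str ≫ M₁.str
  have : IsProper sA := inferInstanceAs (IsProper (_ ≫ _))
  -- the base of the blow-up; the factor `E` makes `e` extend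
  let Y := pullback sA sE
  let a : Y ⟶ A := pullback.fst sA sE
  let y₁ : Y ⟶ M₁.space := a ≫ pullback.fst M₁.str M₂.str
  let y₂ : Y ⟶ M₂.space := a ≫ pullback.snd M₁.str M₂.str
  have : IsProper (a ≫ sA) := inferInstance
  have : IsLocallyNoetherian Y := LocallyOfFiniteType.isLocallyNoetherian (a ≫ sA)
  let jA : U ⟶ A := pullback.lift (j₁ ≫ M₁.interior.ι) (j₂ ≫ M₂.interior.ι)
    (by rw [Category.assoc, hj, Category.assoc])
  have hjA₁ : jA ≫ pullback.fst M₁.str M₂.str = j₁ ≫ M₁.interior.ι := pullback.lift_fst _ _ _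
  have hjA₂ : jA ≫ pullback.snd M₁.str M₂.str = j₂ ≫ M₂.interior.ι := pullback.lift_snd _ _ _
  let j : U ⟶ Y := pullback.lift jA e (by
    rw [he]
    exact ((Category.assoc _ _ _).symm.trans ((congrArg (· ≫ M₁.str) hjA₁).trans
      (Category.assoc _ _ _))))
  have hja : j ≫ a = jA := pullback.lift_fst _ _ _
  have hje : j ≫ pullback.snd sA sE = e := pullback.lift_snd _ _ _
  -- `U` is quasi-compact and separated over the product `A`
  let c := pullback.lift j₁ j₂ hj
  have hcA : c ≫ pullback.map (M₁.interior.ι ≫ M₁.str) (M₂.interior.ι ≫ M₂.str) M₁.str M₂.str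
      M₁.interior.ι M₂.interior.ι (𝟙 _) (by simp) (by simp) = jA := by
    apply pullback.hom_ext
    · exact (Category.assoc _ _ _).trans ((congrArg (c ≫ ·) (pullback.lift_fst _ _ _)).trans
        ((pullback.lift_fst_assoc _ _ _ _).trans hjA₁.symm))
    · exact (Category.assoc _ _ _).trans ((congrArg (c ≫ ·) (pullback.lift_snd _ _ _)).trans
        ((pullback.lift_snd_assoc _ _ _ _).trans hjA₂.symm))
  have hqcA : QuasiCompact jA := by
    rw [← hcA]
    infer_instance
  have hsepA : IsSeparated jA := by
    rw [← hcA]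
    infer_instance
  have : QuasiCompact (j ≫ a) := by rwa [hja]
  have : IsSeparated (j ≫ a) := by rwa [hja]
  have : QuasiCompact j := .of_comp j a
  have : IsSeparated j := .of_comp j a
  have hjy₁ : j ≫ y₁ = j₁ ≫ M₁.interior.ι := by rw [← hjA₁, ← hja, Category.assoc]
  have hjy₂ : j ≫ y₂ = j₂ ≫ M₂.interior.ι := by rw [← hjA₂, ← hja, Category.assoc]
  have htop₁ : (M₁.divisor.comap y₁).comap j = ⊤ := by
    rw [← Scheme.IdealSheafData.comap_comp, hjy₁, Scheme.IdealSheafData.comap_comp,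
      comap_divisor_interior, Scheme.IdealSheafData.comap_top]
  have htop₂ : (M₂.divisor.comap y₂).comap j = ⊤ := by
    rw [← Scheme.IdealSheafData.comap_comp, hjy₂, Scheme.IdealSheafData.comap_comp,
      comap_divisor_interior, Scheme.IdealSheafData.comap_top]
  have hlp₁ := M₁.isEffectiveCartier.isLocallyPrincipal.comap y₁
  have hlp₂ := M₂.isEffectiveCartier.isLocallyPrincipal.comap y₂
  obtain ⟨X, p, i, hp, hi, hiq, hip, hcomp⟩ :=
    exists_proper_dominant_locallyComparable (j := j) hlp₁ hlp₂ htop₁ htop₂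
  let J₁ := (M₁.divisor.comap y₁).comap p
  let J₂ := (M₂.divisor.comap y₂).comap p
  have hiJ₁ : J₁.comap i = ⊤ := by rw [← Scheme.IdealSheafData.comap_comp, hip, htop₁]
  have hiJ₂ : J₂.comap i = ⊤ := by rw [← Scheme.IdealSheafData.comap_comp, hip, htop₂]
  -- the divisor of the product is the supremum of the two divisors; its complement `O` contains `U`
  let D := J₁ ⊓ J₂
  let O := offSupport D
  have hiO : Set.range i ⊆ Set.range O.ι := by
    rintro _ ⟨x, rfl⟩
    rw [Scheme.Opens.range_ι]
    exact inf_offSupport_le _ _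
      ⟨mem_offSupport_of_comap_eq_top hiJ₁ x, mem_offSupport_of_comap_eq_top hiJ₂ x⟩
  let i₀ := IsOpenImmersion.lift O.ι i hiO
  have hi₀ : i₀ ≫ O.ι = i := IsOpenImmersion.lift_fac _ _ _
  -- `O` maps to the product of the interiors, where `U` is closed; hence `U` is closed in `O`
  have hO₁ : M₁.divisor.comap (O.ι ≫ p ≫ y₁) = ⊤ := comap_eq_top_of_le_offSupport _ fun x => by
    have h : O.ι x ∈ offSupport J₁ := offSupport_inf_le_left _ _ x.2
    exact (offSupport_comap y₁ M₁.divisor).le ((offSupport_comap p _).le h)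
  have hO₂ : M₂.divisor.comap (O.ι ≫ p ≫ y₂) = ⊤ := comap_eq_top_of_le_offSupport _ fun x => by
    have h : O.ι x ∈ offSupport J₂ := offSupport_inf_le_right _ _ x.2
    exact (offSupport_comap y₂ M₂.divisor).le ((offSupport_comap p _).le h)
  let l₁ := IsOpenImmersion.lift M₁.interior.ι (O.ι ≫ p ≫ y₁) (range_subset_range_interior _ hO₁)
  let l₂ := IsOpenImmersion.lift M₂.interior.ι (O.ι ≫ p ≫ y₂) (range_subset_range_interior _ hO₂)
  have hl₁ : l₁ ≫ M₁.interior.ι = O.ι ≫ p ≫ y₁ := IsOpenImmersion.lift_fac _ _ _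
  have hl₂ : l₂ ≫ M₂.interior.ι = O.ι ≫ p ≫ y₂ := IsOpenImmersion.lift_fac _ _ _
  have hy : y₁ ≫ M₁.str = y₂ ≫ M₂.str := by
    simp only [y₁, y₂, Category.assoc, pullback.condition]
  let l := pullback.lift (f := M₁.interior.ι ≫ M₁.str) (g := M₂.interior.ι ≫ M₂.str) l₁ l₂
    (by rw [reassoc_of% hl₁, reassoc_of% hl₂, hy])
  have hil₁ : i₀ ≫ l₁ = j₁ := by
    rw [← cancel_mono M₁.interior.ι, Category.assoc, hl₁, reassoc_of% hi₀, reassoc_of% hip, hjy₁]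
  have hil₂ : i₀ ≫ l₂ = j₂ := by
    rw [← cancel_mono M₂.interior.ι, Category.assoc, hl₂, reassoc_of% hi₀, reassoc_of% hip, hjy₂]
  have hil : i₀ ≫ l = c := by
    apply pullback.hom_ext
    · rw [Category.assoc, pullback.lift_fst, pullback.lift_fst, hil₁]
    · rw [Category.assoc, pullback.lift_snd, pullback.lift_snd, hil₂]
  have : IsSeparated (l ≫ pullback.fst _ _ ≫ M₁.interior.ι ≫ M₁.str) := by
    rw [pullback.lift_fst_assoc, reassoc_of% hl₁]
    infer_instance
  have : IsSeparated l := .of_comp l (pullback.fst _ _ ≫ M₁.interior.ι ≫ M₁.str)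
  have : IsClosedImmersion (i₀ ≫ l) := by rwa [hil]
  have : IsClosedImmersion i₀ := .of_comp i₀ l
  have : IsSchemeTheoreticallyDominant (i₀ ≫ O.ι) := by rwa [hi₀]
  have : QuasiCompact (i₀ ≫ O.ι) := by rwa [hi₀]
  have : IsIso i₀ := isIso_of_isClosedImmersion_of_comp_ι i₀
  let ψ : O.toScheme ⟶ U := inv i₀
  have hφ₁ : ψ ≫ j₁ = l₁ := by rw [← hil₁]; exact IsIso.inv_hom_id_assoc _ _
  have hφ₂ : ψ ≫ j₂ = l₂ := by rw [← hil₂]; exact IsIso.inv_hom_id_assoc _ _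
  let P : ModulusPair k :=
    { space := X
      str := p ≫ a ≫ sA
      divisor := D
      isEffectiveCartier := hcomp.isEffectiveCartier_inf (hlp₁.comap p) (hlp₂.comap p) i hiJ₁ hiJ₂
      smooth := by
        have h : O.ι ≫ p ≫ a ≫ sA = ψ ≫ j₁ ≫ M₁.interior.ι ≫ M₁.str := by
          rw [reassoc_of% hφ₁, reassoc_of% hl₁]
          simp only [y₁, sA, Category.assoc]
        change Smooth (O.ι ≫ p ≫ a ≫ sA)
        have : IsIso ψ := inferInstanceAs (IsIso (inv i₀))
        rw [h]
        infer_instance }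
  have hP : P.str = p ≫ y₁ ≫ M₁.str := by simp [P, y₁, sA]
  obtain ⟨p₁, hp₁⟩ := exists_hom_of_ambient (M := P) (N := M₁) (p ≫ y₁)
    (by rw [hP, Category.assoc])
    (by rw [Scheme.IdealSheafData.comap_comp]; exact inf_le_left)
  obtain ⟨p₂, hp₂⟩ := exists_hom_of_ambient (M := P) (N := M₂) (p ≫ y₂)
    (by rw [hP, Category.assoc, hy])
    (by rw [Scheme.IdealSheafData.comap_comp]; exact inf_le_right)
  refine ⟨P, ψ, p₁, p₂, p ≫ pullback.snd sA sE, inferInstanceAs (IsProper (p ≫ a ≫ sA)),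
    inferInstanceAs (IsIso (inv i₀)), ?_, ?_, ?_, ?_⟩
  · rw [← cancel_mono M₁.interior.ι, hp₁]
    exact hl₁.symm.trans (congrArg (· ≫ M₁.interior.ι) hφ₁.symm)
  · rw [← cancel_mono M₂.interior.ι, hp₂]
    exact hl₂.symm.trans (congrArg (· ≫ M₂.interior.ι) hφ₂.symm)
  · have h : i₀ ≫ O.ι ≫ p ≫ pullback.snd sA sE = e := by
      rw [reassoc_of% hi₀, reassoc_of% hip, hje]
    exact (IsIso.eq_inv_comp i₀).mpr h
  -- universal property: the two correspondences are combined over `T` and pulled back to `P`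
  · intro T f₁ f₂ t ht₁ ht₂
    obtain ⟨Z₁, i₁, r₁, q₁, _, _, hr₁, hq₁, hk₁, hd₁⟩ := exists_correspondence f₁
    obtain ⟨Z₂, i₂, r₂, q₂, _, _, hr₂, hq₂, hk₂, hd₂⟩ := exists_correspondence f₂
    let W := pullback r₁ r₂
    let w : W ⟶ A := pullback.lift (pullback.fst r₁ r₂ ≫ q₁) (pullback.snd r₁ r₂ ≫ q₂) (by
      rw [Category.assoc, Category.assoc, ← hk₁, ← hk₂, pullback.condition_assoc])
    have hw₁ : w ≫ pullback.fst _ _ = pullback.fst r₁ r₂ ≫ q₁ := pullback.lift_fst _ _ _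
    have hw₂ : w ≫ pullback.snd _ _ = pullback.snd r₁ r₂ ≫ q₂ := pullback.lift_snd _ _ _
    let iW : T.interior.toScheme ⟶ W := pullback.lift i₁ i₂ (by rw [hr₁, hr₂])
    have hiW₁ : iW ≫ pullback.fst _ _ = i₁ := pullback.lift_fst _ _ _
    have hiW₂ : iW ≫ pullback.snd _ _ = i₂ := pullback.lift_snd _ _ _
    let iZ : T.interior.toScheme ⟶ pullback w (p ≫ a) := pullback.lift iW (t ≫ i) (by
      rw [Category.assoc, reassoc_of% hip, hja]
      apply pullback.hom_ext
      · rw [Category.assoc, hw₁, reassoc_of% hiW₁, hq₁, Category.assoc, hjA₁, ht₁, Category.assoc]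
      · rw [Category.assoc, hw₂, reassoc_of% hiW₂, hq₂, Category.assoc, hjA₂, ht₂, Category.assoc])
    have hiZ₁ : iZ ≫ pullback.fst _ _ = iW := pullback.lift_fst _ _ _
    have hiZ₂ : iZ ≫ pullback.snd _ _ = t ≫ i := pullback.lift_snd _ _ _
    have e₁ : pullback.snd w (p ≫ a) ≫ p ≫ y₁ =
        (pullback.fst w (p ≫ a) ≫ pullback.fst r₁ r₂) ≫ q₁ := by
      rw [Category.assoc, ← hw₁, pullback.condition_assoc, Category.assoc]
    have e₂ : pullback.snd w (p ≫ a) ≫ p ≫ y₂ =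
        (pullback.fst w (p ≫ a) ≫ pullback.snd r₁ r₂) ≫ q₂ := by
      rw [Category.assoc, ← hw₂, pullback.condition_assoc, Category.assoc]
    obtain ⟨g, hg⟩ := exists_hom_of_correspondence (M := T) (N := P) (t ≫ i₀) iZ
      ((pullback.fst w (p ≫ a) ≫ pullback.fst r₁ r₂) ≫ r₁) (pullback.snd w (p ≫ a))
      (by rw [Category.assoc, reassoc_of% hiZ₁, reassoc_of% hiW₁, hr₁])
      (by
        rw [hiZ₂]
        exact (congrArg (t ≫ ·) hi₀.symm).trans (Category.assoc _ _ _).symm)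
      (by
        rw [hP, Category.assoc, hk₁]
        simpa only [Category.assoc] using (congrArg (· ≫ M₁.str) e₁).symm)
      (by
        refine le_trans (le_inf ?_ ?_) (hcomp.le_comap_inf (hlp₁.comap p) (hlp₂.comap p) _)
        · rw [← Scheme.IdealSheafData.comap_comp, ← Scheme.IdealSheafData.comap_comp,
            Category.assoc (pullback.snd w (p ≫ a)), e₁,
            Scheme.IdealSheafData.comap_comp _ _ r₁, Scheme.IdealSheafData.comap_comp _ _ q₁]
          exact Scheme.IdealSheafData.comap_mono _ hd₁
        · rw [← Scheme.IdealSheafData.comap_comp, ← Scheme.IdealSheafData.comap_comp,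
            Category.assoc (pullback.snd w (p ≫ a)), e₂, Category.assoc _ _ r₁,
            pullback.condition, ← Category.assoc,
            Scheme.IdealSheafData.comap_comp _ _ r₂, Scheme.IdealSheafData.comap_comp _ _ q₂]
          exact Scheme.IdealSheafData.comap_mono _ hd₂)
    refine ⟨g, ?_⟩
    rw [hg]
    exact (Category.assoc _ _ _).trans
      ((congrArg (t ≫ ·) (IsIso.hom_inv_id i₀)).trans (Category.comp_id t))

end ModulusPair

/-! ### Clopen decompositions and maps to two points -/

instance isProper_coprod_desc_id (S : Scheme.{u}) : IsProper (coprod.desc (𝟙 S) (𝟙 S)) := by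
  have : IsFinite (coprod.desc (𝟙 S) (𝟙 S)) := inferInstance
  infer_instance

/-- A clopen decomposition `U = O ⊔ O'` of a scheme over `S` is classified by a morphism to `S ⨿ S`
over `S`. -/
theorem exists_classifying {U S : Scheme.{u}} {O O' : U.Opens} (h : IsCompl O O') (s : U ⟶ S) :
    ∃ e : U ⟶ S ⨿ S, e ≫ coprod.desc (𝟙 S) (𝟙 S) = s ∧
      e ⁻¹ᵁ (coprod.inl : S ⟶ S ⨿ S).opensRange = O := by
  have h' : IsCompl O.ι.opensRange O'.ι.opensRange := by
    rwa [Scheme.Opens.opensRange_ι, Scheme.Opens.opensRange_ι]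
  obtain ⟨c⟩ := nonempty_isColimit_binaryCofanMk_of_isCompl O.ι O'.ι h'
  let e : U ⟶ S ⨿ S := c.desc (BinaryCofan.mk (O.ι ≫ s ≫ coprod.inl) (O'.ι ≫ s ≫ coprod.inr))
  have h₁ : O.ι ≫ e = O.ι ≫ s ≫ coprod.inl := c.fac _ ⟨.left⟩
  have h₂ : O'.ι ≫ e = O'.ι ≫ s ≫ coprod.inr := c.fac _ ⟨.right⟩
  have hS := isCompl_opensRange_inl_inr S S
  have k₁ : O ≤ e ⁻¹ᵁ (coprod.inl : S ⟶ S ⨿ S).opensRange := by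
    intro x hx
    have := congrArg (fun f : O.toScheme ⟶ S ⨿ S => f ⟨x, hx⟩) h₁
    exact ⟨s x, this.symm⟩
  have k₂ : O' ≤ e ⁻¹ᵁ (coprod.inr : S ⟶ S ⨿ S).opensRange := by
    intro x hx
    have := congrArg (fun f : O'.toScheme ⟶ S ⨿ S => f ⟨x, hx⟩) h₂
    exact ⟨s x, this.symm⟩
  have k : Disjoint (e ⁻¹ᵁ (coprod.inl : S ⟶ S ⨿ S).opensRange)
      (e ⁻¹ᵁ (coprod.inr : S ⟶ S ⨿ S).opensRange) := by
    rw [disjoint_iff]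
    exact congrArg (e ⁻¹ᵁ ·) hS.inf_eq_bot
  refine ⟨e, ?_, ?_⟩
  · apply BinaryCofan.IsColimit.hom_ext c
    · change O.ι ≫ _ = O.ι ≫ _
      rw [reassoc_of% h₁, coprod.inl_desc, Category.comp_id]
    · change O'.ι ≫ _ = O'.ι ≫ _
      rw [reassoc_of% h₂, coprod.inr_desc, Category.comp_id]
  · refine le_antisymm ?_ k₁
    intro x hx
    rcases (h.sup_eq_top.ge trivial : x ∈ O ⊔ O') with hx' | hx'
    · exact hx'
    · exact (k.le_bot ⟨hx, k₂ hx'⟩).elim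

theorem isCompl_preimage {X Y : Scheme.{u}} (f : X ⟶ Y) {O O' : Y.Opens} (h : IsCompl O O') :
    IsCompl (f ⁻¹ᵁ O) (f ⁻¹ᵁ O') := by
  rw [isCompl_iff, disjoint_iff, codisjoint_iff]
  exact ⟨congrArg (f ⁻¹ᵁ ·) h.inf_eq_bot, congrArg (f ⁻¹ᵁ ·) h.sup_eq_top⟩

theorem isCompl_opensRange_compl {X Y : Scheme.{u}} (f : X ⟶ Y) [IsOpenImmersion f]
    [IsClosedImmersion f] : ∃ O : Y.Opens, IsCompl f.opensRange O := by
  refine ⟨⟨(Set.range f)ᶜ, f.isClosedEmbedding.isClosed_range.isOpen_compl⟩, ?_⟩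
  rw [isCompl_iff, disjoint_iff, codisjoint_iff]
  constructor
  · ext x
    simp
  · ext x
    simp

theorem isClosedImmersion_pullback_lift {X Y B S : Scheme.{u}} (f : X ⟶ B) (g : Y ⟶ B) (b : B ⟶ S)
    [IsSeparated b] {s : X ⟶ S} {t : Y ⟶ S} (hs : f ≫ b = s) (ht : g ≫ b = t)
    (h : pullback.fst f g ≫ s = pullback.snd f g ≫ t) :
    IsClosedImmersion (pullback.lift (pullback.fst f g) (pullback.snd f g) h) := by
  subst hs ht
  have : IsClosedImmersion (pullback.mapDesc f g b) := inferInstance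
  have e : pullback.lift (pullback.fst f g) (pullback.snd f g) h = pullback.mapDesc f g b := by
    apply pullback.hom_ext
    · exact (pullback.lift_fst _ _ _).trans
        ((pullback.lift_fst _ _ _).trans (Category.comp_id _)).symm
    · exact (pullback.lift_snd _ _ _).trans
        ((pullback.lift_snd _ _ _).trans (Category.comp_id _)).symm
  rwa [e]

namespace ModulusPair

variable {k : Type u} [Field k]

theorem isSeparated_base {M N : ModulusPair k} (f : M ⟶ N) : IsSeparated (Hom.base f) := by
  have : IsSeparated (Hom.base f ≫ N.interior.ι ≫ N.str) := by
    rw [base_w]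
    infer_instance
  exact .of_comp (Hom.base f) (N.interior.ι ≫ N.str)

end ModulusPair

open ModulusPair

variable {k : Type u} [Field k]

/-- A clopen decomposition of the ambient space of a proper modulus pair is a coproduct
decomposition in the category of proper modulus pairs. -/
theorem nonempty_isColimit_of_isCompl {P A B : MSm k} {O₁ O₂ : P.obj.space.Opens}
    (h : IsCompl O₁ O₂) (a : A ⟶ P) (b : B ⟶ P) (a' : A.obj ≅ P.obj.restrict O₁)
    (b' : B.obj ≅ P.obj.restrict O₂) (ha : a'.hom ≫ P.obj.restrictι O₁ = a.hom)
    (hb : b'.hom ≫ P.obj.restrictι O₂ = b.hom) : Nonempty (IsColimit (BinaryCofan.mk a b)) := by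
  have key (L : MSm k) (f : A ⟶ L) (g : B ⟶ L) : ∃ l : P ⟶ L, a ≫ l = f ∧ b ≫ l = g := by
    obtain ⟨l, h₁, h₂⟩ := exists_desc h (a'.inv ≫ f.hom) (b'.inv ≫ g.hom)
    refine ⟨ObjectProperty.homMk l, ?_, ?_⟩
    · ext1
      change a.hom ≫ l = f.hom
      rw [← ha, Category.assoc, h₁, Iso.hom_inv_id_assoc]
    · ext1
      change b.hom ≫ l = g.hom
      rw [← hb, Category.assoc, h₂, Iso.hom_inv_id_assoc]
  choose l hl₁ hl₂ using key
  refine ⟨BinaryCofan.isColimitMk (fun s => l s.pt s.inl s.inr) (fun s => hl₁ _ _ _)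
    (fun s => hl₂ _ _ _) fun s m h₁ h₂ => ?_⟩
  ext1
  refine hom_ext_of_isCompl h ?_ ?_
  · rw [← cancel_epi a'.hom, reassoc_of% ha, reassoc_of% ha]
    exact congrArg InducedCategory.Hom.hom (h₁.trans (hl₁ _ _ _).symm)
  · rw [← cancel_epi b'.hom, reassoc_of% hb, reassoc_of% hb]
    exact congrArg InducedCategory.Hom.hom (h₂.trans (hl₂ _ _ _).symm)

/-- The self fibre product of a morphism of proper modulus pairs that is étale on the interiors,
decomposed along the diagonal by two complementary open subschemes of the ambient space. -/
theorem exists_offDiagonal {M N : MSm k} (f : M ⟶ N) (hf : Etale (Hom.base f.hom)) :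
    ∃ (D : OffDiagonal f) (O₁ O₂ : D.prod.obj.space.Opens) (_ : IsCompl O₁ O₂)
      (a : M.obj ≅ D.prod.obj.restrict O₁) (b : D.obj.obj ≅ D.prod.obj.restrict O₂),
      a.hom ≫ D.prod.obj.restrictι O₁ = (D.isPullback.lift (𝟙 M) (𝟙 M) rfl).hom ∧
      b.hom ≫ D.prod.obj.restrictι O₂ = D.ι.hom ∧
      IsPullback (Hom.base D.fst.hom) (Hom.base D.snd.hom) (Hom.base f.hom) (Hom.base f.hom) := by
  have := isSeparated_base f.hom
  let φ := Hom.base f.hom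
  let sM := M.obj.interior.ι ≫ M.obj.str
  let S := Spec (CommRingCat.of k)
  let U := pullback φ φ
  let Δ := pullback.diagonal φ
  have hw : φ ≫ N.obj.interior.ι ≫ N.obj.str = sM := base_w f.hom
  have hU : pullback.fst φ φ ≫ sM = pullback.snd φ φ ≫ sM := by
    rw [← hw, pullback.condition_assoc]
  have : Smooth sM := M.obj.smooth
  -- the diagonal is open because `φ` is étale and closed because `φ` is separated
  obtain ⟨O', hO'⟩ := isCompl_opensRange_compl Δ
  obtain ⟨e, he, he₁⟩ := exists_classifying hO' (pullback.fst φ φ ≫ sM)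
  obtain ⟨P, ψ, p₁, p₂, ε, hP, hψ, hp₁, hp₂, hε, huniv⟩ := exists_product
    (M₁ := M.obj) (M₂ := M.obj) M.property M.property (pullback.fst φ φ) (pullback.snd φ φ) hU
    (inferInstanceAs (Smooth (pullback.fst φ φ ≫ sM)))
    (isClosedImmersion_pullback_lift φ φ (N.obj.interior.ι ≫ N.obj.str) hw hw hU)
    (coprod.desc (𝟙 S) (𝟙 S)) e he
  have hpb : IsPullback (Hom.base p₁) (Hom.base p₂) φ φ :=
    .of_iso (.of_hasPullback φ φ) (asIso ψ).symm (Iso.refl _) (Iso.refl _) (Iso.refl _)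
      (by simp [hp₁]) (by simp [hp₂]) (by simp) (by simp)
  let P' : MSm k := ⟨P, hP⟩
  let q₁ : P' ⟶ M := ObjectProperty.homMk p₁
  let q₂ : P' ⟶ M := ObjectProperty.homMk p₂
  have hq : IsPullback q₁ q₂ f f := by
    have w : q₁ ≫ f = q₂ ≫ f := by
      ext1
      exact ModulusPair.hom_ext hpb.w
    have key (s : PullbackCone f f) : ∃ l : s.pt ⟶ P', l ≫ q₁ = s.fst ∧ l ≫ q₂ = s.snd := by
      have hs : Hom.base s.fst.hom ≫ φ = Hom.base s.snd.hom ≫ φ :=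
        congrArg (fun g => Hom.base (InducedCategory.Hom.hom g)) s.condition
      obtain ⟨l, hl⟩ := huniv s.pt.obj s.fst.hom s.snd.hom (pullback.lift _ _ hs)
        (pullback.lift_fst _ _ _).symm (pullback.lift_snd _ _ _).symm
      refine ⟨ObjectProperty.homMk l, ?_, ?_⟩
      · ext1
        refine ModulusPair.hom_ext ?_
        change Hom.base l ≫ Hom.base p₁ = _
        rw [hp₁, reassoc_of% hl, pullback.lift_fst]
      · ext1
        refine ModulusPair.hom_ext ?_
        change Hom.base l ≫ Hom.base p₂ = _
        rw [hp₂, reassoc_of% hl, pullback.lift_snd]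
    choose l hl₁ hl₂ using key
    refine ⟨⟨w⟩, ⟨PullbackCone.IsLimit.mk w l hl₁ hl₂ fun s m h₁ h₂ => ?_⟩⟩
    ext1
    refine ModulusPair.hom_ext (hpb.hom_ext ?_ ?_)
    · exact congrArg (fun g => Hom.base (InducedCategory.Hom.hom g)) (h₁.trans (hl₁ s).symm)
    · exact congrArg (fun g => Hom.base (InducedCategory.Hom.hom g)) (h₂.trans (hl₂ s).symm)
  let δ : M ⟶ P' := hq.lift (𝟙 M) (𝟙 M) rfl
  have hδ₁ : δ.hom ≫ p₁ = 𝟙 M.obj := congrArg InducedCategory.Hom.hom (hq.lift_fst (𝟙 M) (𝟙 M) rfl)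
  have hδ₂ : δ.hom ≫ p₂ = 𝟙 M.obj := congrArg InducedCategory.Hom.hom (hq.lift_snd (𝟙 M) (𝟙 M) rfl)
  have hδ : Hom.base δ.hom ≫ ψ = Δ := by
    apply pullback.hom_ext
    · rw [Category.assoc, ← hp₁, ← comp_base, hδ₁, pullback.diagonal_fst, id_base]
    · rw [Category.assoc, ← hp₂, ← comp_base, hδ₂, pullback.diagonal_snd, id_base]
  let O₁ : P.space.Opens := ε ⁻¹ᵁ (coprod.inl : S ⟶ S ⨿ S).opensRange
  let O₂ : P.space.Opens := ε ⁻¹ᵁ (coprod.inr : S ⟶ S ⨿ S).opensRange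
  have hO : IsCompl O₁ O₂ := isCompl_preimage ε (isCompl_opensRange_inl_inr S S)
  have hO₁ : P.interior.ι ⁻¹ᵁ O₁ = ψ ⁻¹ᵁ Δ.opensRange := by
    rw [← he₁, ← Scheme.Hom.comp_preimage, ← Scheme.Hom.comp_preimage, hε]
  -- the diagonal factors through the first part of the decomposition
  have hr : Set.range (Hom.base δ.hom) ⊆ Set.range (Hom.base (P.restrictι O₁)) := by
    rintro _ ⟨x, rfl⟩
    have h : Hom.base δ.hom x ∈ (Hom.base (P.restrictι O₁)).opensRange := by
      rw [opensRange_restrictι, hO₁]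
      exact ⟨x, congrArg (fun g : M.obj.interior.toScheme ⟶ U => g x) hδ.symm⟩
    exact h
  obtain ⟨a, ha⟩ := exists_lift_restrict hO δ.hom
    (IsOpenImmersion.lift (Hom.base (P.restrictι O₁)) (Hom.base δ.hom) hr)
    (IsOpenImmersion.lift_fac _ _ hr)
  -- the projection inverts the diagonal on the first part
  have ha' : (P.restrictι O₁ ≫ p₁) ≫ δ.hom = P.restrictι O₁ := by
    refine ModulusPair.hom_ext ?_
    have hr' : Set.range (Hom.base (P.restrictι O₁) ≫ ψ) ⊆ Set.range Δ := by
      rintro _ ⟨x, rfl⟩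
      have h : Hom.base (P.restrictι O₁) x ∈ P.interior.ι ⁻¹ᵁ O₁ := by
        rw [← opensRange_restrictι]
        exact ⟨x, rfl⟩
      rw [hO₁] at h
      exact h
    have hfac := IsOpenImmersion.lift_fac Δ _ hr'
    have h : (Hom.base (P.restrictι O₁) ≫ ψ) ≫ pullback.fst φ φ ≫ Δ =
        Hom.base (P.restrictι O₁) ≫ ψ := by
      rw [← hfac]
      simp only [Δ, Category.assoc, pullback.diagonal_fst_assoc]
    rw [← cancel_mono ψ, comp_base, Category.assoc, hδ, comp_base, hp₁]
    simpa only [Category.assoc] using h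
  let a' : M.obj ≅ P.restrict O₁ :=
    { hom := a
      inv := P.restrictι O₁ ≫ p₁
      hom_inv_id := by rw [reassoc_of% ha, hδ₁]
      inv_hom_id := by
        rw [← cancel_mono (P.restrictι O₁), Category.assoc, ha, ha', Category.id_comp] }
  let B : MSm k := ⟨P.restrict O₂, isProper_restrict hO.symm hP⟩
  let b : B ⟶ P' := ObjectProperty.homMk (P.restrictι O₂)
  exact ⟨⟨P', q₁, q₂, hq, B, b, nonempty_isColimit_of_isCompl (P := P') hO δ b a' (Iso.refl _) ha
    (Category.id_comp _)⟩, O₁, O₂, hO, a', Iso.refl _, ha, Category.id_comp _, hpb⟩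

/-! ### Transport of squares along isomorphisms -/

section

variable {C : Type*} [Category C]

theorem isIso_τ {T T' : Square C} (i : T ≅ T') :
    IsIso i.hom.τ₁ ∧ IsIso i.hom.τ₂ ∧ IsIso i.hom.τ₃ ∧ IsIso i.hom.τ₄ :=
  ⟨⟨i.inv.τ₁, congrArg Square.Hom.τ₁ i.hom_inv_id, congrArg Square.Hom.τ₁ i.inv_hom_id⟩,
    ⟨i.inv.τ₂, congrArg Square.Hom.τ₂ i.hom_inv_id, congrArg Square.Hom.τ₂ i.inv_hom_id⟩,
    ⟨i.inv.τ₃, congrArg Square.Hom.τ₃ i.hom_inv_id, congrArg Square.Hom.τ₃ i.inv_hom_id⟩,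
    ⟨i.inv.τ₄, congrArg Square.Hom.τ₄ i.hom_inv_id, congrArg Square.Hom.τ₄ i.inv_hom_id⟩⟩

/-- Transport of the off-diagonal along an isomorphism of arrows; the fibre product and the
off-diagonal are kept. -/
theorem OffDiagonal.exists_transport {M N M' N' : C} {f : M ⟶ N} {f' : M' ⟶ N'}
    (D : OffDiagonal f') (s : M ⟶ M') (t : N ⟶ N') [IsIso s] [IsIso t] (h : s ≫ f' = f ≫ t) :
    ∃ D' : OffDiagonal f, ∃ (a : D'.prod ≅ D.prod) (b : D'.obj ≅ D.obj),
      a.hom ≫ D.fst = D'.fst ≫ s ∧ a.hom ≫ D.snd = D'.snd ≫ s ∧ D'.ι ≫ a.hom = b.hom ≫ D.ι := by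
  have hf : f = s ≫ f' ≫ inv t := by rw [reassoc_of% h, IsIso.hom_inv_id, Category.comp_id]
  have H : IsPullback (D.fst ≫ inv s) (D.snd ≫ inv s) f f :=
    IsPullback.of_iso D.isPullback (Iso.refl _) (asIso s).symm (asIso s).symm (asIso t).symm
      (by simp) (by simp) (by simp [hf]) (by simp [hf])
  obtain ⟨c⟩ := D.isCoproduct
  have hl : H.lift (𝟙 M) (𝟙 M) rfl = s ≫ D.isPullback.lift (𝟙 M') (𝟙 M') rfl := by
    apply H.hom_ext
    · rw [H.lift_fst, Category.assoc, D.isPullback.lift_fst_assoc, Category.id_comp,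
        IsIso.hom_inv_id]
    · rw [H.lift_snd, Category.assoc, D.isPullback.lift_snd_assoc, Category.id_comp,
        IsIso.hom_inv_id]
  refine ⟨⟨D.prod, D.fst ≫ inv s, D.snd ≫ inv s, H, D.obj, D.ι, ?_⟩, Iso.refl _, Iso.refl _,
    by simp, by simp, by simp⟩
  rw [hl]
  let δ := D.isPullback.lift (𝟙 M') (𝟙 M') rfl
  have key (L : C) (u : M' ⟶ L) (v : D.obj ⟶ L) : ∃ l : D.prod ⟶ L, δ ≫ l = u ∧ D.ι ≫ l = v :=
    ⟨c.desc (BinaryCofan.mk u v), c.fac _ ⟨.left⟩, c.fac _ ⟨.right⟩⟩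
  have ext (L : C) (l l' : D.prod ⟶ L) (h₁ : δ ≫ l = δ ≫ l') (h₂ : D.ι ≫ l = D.ι ≫ l') : l = l' :=
    BinaryCofan.IsColimit.hom_ext c h₁ h₂
  choose l hl₁ hl₂ using key
  refine ⟨BinaryCofan.isColimitMk (fun F => l F.pt (inv s ≫ (F.inl : M ⟶ F.pt)) F.inr)
    (fun F => ?_) (fun F => hl₂ _ _ _) fun F m h₁ h₂ => ?_⟩
  · exact (Category.assoc _ _ _).trans ((congrArg (s ≫ ·) (hl₁ _ _ _)).trans
      (IsIso.hom_inv_id_assoc s _))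
  · refine ext _ _ _ ?_ (h₂.trans (hl₂ _ _ _).symm)
    refine Eq.trans ?_ (hl₁ _ _ _).symm
    exact (IsIso.eq_inv_comp s).mpr ((Category.assoc _ _ _).symm.trans h₁)

theorem OffDiagonalIso.of_iso {T T' : Square C} (i : T ≅ T') (h : OffDiagonalIso T) :
    OffDiagonalIso T' := by
  intro D E
  obtain ⟨h₁, h₂, h₃, h₄⟩ := isIso_τ i
  obtain ⟨D', a, b, ha₁, ha₂, hab⟩ := D.exists_transport i.hom.τ₁ i.hom.τ₃ i.hom.comm₁₃.symm
  obtain ⟨E', c, d, hc₁, hc₂, hcd⟩ := E.exists_transport i.hom.τ₂ i.hom.τ₄ i.hom.comm₂₄.symm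
  obtain ⟨e, he, _⟩ := h D' E'
  have key : a.hom ≫ D.prodMap E T'.f₁₂ T'.f₃₄ T'.fac =
      D'.prodMap E' T.f₁₂ T.f₃₄ T.fac ≫ c.hom := by
    apply E.isPullback.hom_ext
    · simp only [OffDiagonal.prodMap, Category.assoc, IsPullback.lift_fst, hc₁]
      rw [IsPullback.lift_fst_assoc, reassoc_of% ha₁, Category.assoc, i.hom.comm₁₂]
    · simp only [OffDiagonal.prodMap, Category.assoc, IsPullback.lift_snd, hc₂]
      rw [IsPullback.lift_snd_assoc, reassoc_of% ha₂, Category.assoc, i.hom.comm₁₂]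
  refine ⟨b.inv ≫ e ≫ d.hom, ?_, inferInstance⟩
  rw [Category.assoc, Category.assoc, ← hcd, reassoc_of% he, ← key, reassoc_of% hab,
    Iso.inv_hom_id_assoc]

end

instance isClosedUnderIsomorphisms_MVSquare :
    (MVSquare k).IsClosedUnderIsomorphisms where
  of_iso {T T'} i hT := by
    obtain ⟨h, ⟨S, hS, hS₄, φ, _, _, _, _, _⟩, hOD⟩ := hT
    refine ⟨h.of_iso i, ⟨S, hS, hS₄, φ ≫ (ModulusPair.proper k).ι.mapSquare.map i.hom, ?_⟩,
      hOD.of_iso i⟩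
    obtain ⟨h₁, h₂, h₃, h₄⟩ := isIso_τ i
    have e₁ : IsIso i.hom.τ₁.hom := inferInstance
    have e₂ : IsIso i.hom.τ₂.hom := inferInstance
    have e₃ : IsIso i.hom.τ₃.hom := inferInstance
    have e₄ : IsIso i.hom.τ₄.hom := inferInstance
    exact ⟨
      IsIso.comp_isIso' ‹IsIso (Hom.base φ.τ₁)› (inferInstanceAs (IsIso (Hom.base i.hom.τ₁.hom))),
      IsIso.comp_isIso' ‹IsIso (Hom.base φ.τ₂)› (inferInstanceAs (IsIso (Hom.base i.hom.τ₂.hom))),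
      IsIso.comp_isIso' ‹IsIso (Hom.base φ.τ₃)› (inferInstanceAs (IsIso (Hom.base i.hom.τ₃.hom))),
      IsIso.comp_isIso' ‹IsIso (Hom.base φ.τ₄)› (inferInstanceAs (IsIso (Hom.base i.hom.τ₄.hom))),
      IsIso.comp_isIso' ‹IsIso φ.τ₄› e₄⟩

/-! ### The morphisms of interiors in the squares of the cd-structure -/

namespace ModulusPair

theorem IsMinimalExtension.etale_base {M N : ModulusPair k} {f : M ⟶ N} {φ : M.space ⟶ N.space}
    (h : IsMinimalExtension f φ) [Etale φ] : Etale (Hom.base f) := by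
  have : Etale (Hom.base f ≫ N.interior.ι) := by
    rw [← h.extends_base]
    infer_instance
  exact .of_comp (Hom.base f) N.interior.ι

theorem IsMinimalExtension.isOpenImmersion_base {M N : ModulusPair k} {f : M ⟶ N}
    {φ : M.space ⟶ N.space} (h : IsMinimalExtension f φ) [IsOpenImmersion φ] :
    IsOpenImmersion (Hom.base f) := by
  have : IsOpenImmersion (Hom.base f ≫ N.interior.ι) := by
    rw [← h.extends_base]
    infer_instance
  exact .of_comp (Hom.base f) N.interior.ι

theorem base_eq_of_comm {M N M' N' : ModulusPair k} {f : M ⟶ N} {f' : M' ⟶ N'} {s : M ⟶ M'}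
    {t : N ⟶ N'} (hs : IsIso (Hom.base s)) (h : f ≫ t = s ≫ f') :
    Hom.base f' = inv (Hom.base s) ≫ Hom.base f ≫ Hom.base t := by
  rw [IsIso.eq_inv_comp, ← comp_base, ← comp_base, h]

theorem etale_base_of_comm {M N M' N' : ModulusPair k} {f : M ⟶ N} {f' : M' ⟶ N'} {s : M ⟶ M'}
    {t : N ⟶ N'} (hs : IsIso (Hom.base s)) (ht : IsIso (Hom.base t)) (h : f ≫ t = s ≫ f')
    (hf : Etale (Hom.base f)) : Etale (Hom.base f') := by
  rw [base_eq_of_comm hs h]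
  infer_instance

theorem isOpenImmersion_base_of_comm {M N M' N' : ModulusPair k} {f : M ⟶ N} {f' : M' ⟶ N'}
    {s : M ⟶ M'} {t : N ⟶ N'} (hs : IsIso (Hom.base s)) (ht : IsIso (Hom.base t))
    (h : f ≫ t = s ≫ f') (hf : IsOpenImmersion (Hom.base f)) : IsOpenImmersion (Hom.base f') := by
  rw [base_eq_of_comm hs h]
  infer_instance

end ModulusPair

/-- The interiors of the squares of the cd-structure are those of Nisnevich squares. -/
theorem MVSquare.base {T : Square (MSm k)} (hT : MVSquare k T) :
    Etale (Hom.base T.f₁₃.hom) ∧ Etale (Hom.base T.f₂₄.hom) ∧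
      IsOpenImmersion (Hom.base T.f₁₂.hom) ∧ IsOpenImmersion (Hom.base T.f₃₄.hom) := by
  obtain ⟨-, ⟨S, ⟨S', ⟨a₁₂, a₁₃, a₂₄, a₃₄, hc, h₁₂, h₁₃, h₂₄, h₃₄, -, e₁₃, e₂₄, o₁₂, o₃₄, -⟩, ⟨i⟩⟩,
    -, φ, _, _, _, _, _⟩, -⟩ := hT
  have : Etale a₁₃ := e₁₃
  have : Etale a₂₄ := e₂₄
  have : IsOpenImmersion a₁₂ := o₁₂
  have : IsOpenImmersion a₃₄ := o₃₄
  obtain ⟨_, _, _, _⟩ := isIso_τ i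
  have i₁ : IsIso (Hom.base (i.hom.τ₁ ≫ φ.τ₁)) := by rw [comp_base]; infer_instance
  have i₂ : IsIso (Hom.base (i.hom.τ₂ ≫ φ.τ₂)) := by rw [comp_base]; infer_instance
  have i₃ : IsIso (Hom.base (i.hom.τ₃ ≫ φ.τ₃)) := by rw [comp_base]; infer_instance
  have i₄ : IsIso (Hom.base (i.hom.τ₄ ≫ φ.τ₄)) := by rw [comp_base]; infer_instance
  have c₁₂ : S'.f₁₂ ≫ i.hom.τ₂ ≫ φ.τ₂ = (i.hom.τ₁ ≫ φ.τ₁) ≫ T.f₁₂.hom := (i.hom ≫ φ).comm₁₂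
  have c₁₃ : S'.f₁₃ ≫ i.hom.τ₃ ≫ φ.τ₃ = (i.hom.τ₁ ≫ φ.τ₁) ≫ T.f₁₃.hom := (i.hom ≫ φ).comm₁₃
  have c₂₄ : S'.f₂₄ ≫ i.hom.τ₄ ≫ φ.τ₄ = (i.hom.τ₂ ≫ φ.τ₂) ≫ T.f₂₄.hom := (i.hom ≫ φ).comm₂₄
  have c₃₄ : S'.f₃₄ ≫ i.hom.τ₄ ≫ φ.τ₄ = (i.hom.τ₃ ≫ φ.τ₃) ≫ T.f₃₄.hom := (i.hom ≫ φ).comm₃₄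
  exact ⟨etale_base_of_comm i₁ i₃ c₁₃ h₁₃.etale_base, etale_base_of_comm i₂ i₄ c₂₄ h₂₄.etale_base,
    isOpenImmersion_base_of_comm i₁ i₂ c₁₂ h₁₂.isOpenImmersion_base,
    isOpenImmersion_base_of_comm i₃ i₄ c₃₄ h₃₄.isOpenImmersion_base⟩

theorem MVSquare.mono_f₁₂ {T : Square (MSm k)} (hT : MVSquare k T) : Mono T.f₁₂ := by
  have := hT.base.2.2.1
  have : Mono T.f₁₂.hom := mono_of_mono_base _
  exact (ModulusPair.proper k).ι.mono_of_mono_map this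

theorem MVSquare.mono_f₃₄ {T : Square (MSm k)} (hT : MVSquare k T) : Mono T.f₃₄ := by
  have := hT.base.2.2.2
  have : Mono T.f₃₄.hom := mono_of_mono_base _
  exact (ModulusPair.proper k).ι.mono_of_mono_map this

/-! ### Modulus pairs with empty interior -/

namespace ModulusPair

theorem exists_hom_of_isEmpty {M : ModulusPair k} (hM : IsEmpty M.interior.toScheme)
    (N : ModulusPair k) : Nonempty (M ⟶ N) := by
  have hi : IsInitial M.interior.toScheme := isInitialOfIsEmpty
  obtain ⟨f, -⟩ := exists_hom_of_correspondence (M := M) (N := N) (hi.to _) (𝟙 _) M.interior.ι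
    (hi.to _) (Category.id_comp _) (hi.hom_ext _ _) (hi.hom_ext _ _) (by
      refine idealSheaf_le_of_locally fun x => ?_
      exact (hM.false x).elim)
  exact ⟨f⟩

theorem nonempty_isInitial_of_isEmpty {M : MSm k} (hM : IsEmpty M.obj.interior.toScheme) :
    Nonempty (IsInitial M) := by
  have hi : IsInitial M.obj.interior.toScheme := isInitialOfIsEmpty
  refine ⟨IsInitial.ofUniqueHom
    (fun N => ObjectProperty.homMk (exists_hom_of_isEmpty hM N.obj).some) fun N g => ?_⟩
  ext1
  exact ModulusPair.hom_ext (hi.hom_ext _ _)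

/-- Two disjoint copies of the point, with empty divisor: the ideal sheaf is the unit ideal. -/
noncomputable def twoPoints (k : Type u) [Field k] : ModulusPair k where
  space := Spec (.of k) ⨿ Spec (.of k)
  str := coprod.desc (𝟙 _) (𝟙 _)
  divisor := ⊤
  isEffectiveCartier x := by
    obtain ⟨_, ⟨W, hW, rfl⟩, hxW, -⟩ :=
      (Spec (.of k) ⨿ Spec (.of k) : Scheme.{u}).isBasis_affineOpens.exists_subset_of_mem_open
        (Set.mem_univ x) isOpen_univ
    exact ⟨⟨W, hW⟩, hxW, 1, one_mem _, by simp⟩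
  smooth := by
    have : Smooth (coprod.desc (𝟙 (Spec (.of k))) (𝟙 (Spec (.of k)))) := by
      have hL : IsZariskiLocalAtSource (@Smooth.{u}) :=
        HasRingHomProperty.instIsZariskiLocalAtSource
      rw [hL.iff_of_openCover (coprodOpenCover.{u, 0} _ _)]
      rintro (_ | _)
      · exact (coprod.inl_desc (𝟙 (Spec (.of k))) (𝟙 (Spec (.of k)))).symm ▸
          (inferInstance : Smooth (𝟙 (Spec (CommRingCat.of k))))
      · exact (coprod.inr_desc (𝟙 (Spec (.of k))) (𝟙 (Spec (.of k)))).symm ▸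
          (inferInstance : Smooth (𝟙 (Spec (CommRingCat.of k))))
    infer_instance

theorem exists_hom_twoPoints (M : ModulusPair k) (c : Spec (.of k) ⟶ (twoPoints k).space)
    (hc : c ≫ (twoPoints k).str = 𝟙 _) : ∃ f : M ⟶ twoPoints k,
      Hom.base f ≫ (twoPoints k).interior.ι = M.interior.ι ≫ M.str ≫ c :=
  exists_hom_of_ambient (M := M) (N := twoPoints k) (M.str ≫ c)
    (by rw [Category.assoc, hc, Category.comp_id]) (by
      rw [show (twoPoints k).divisor = ⊤ from rfl, Scheme.IdealSheafData.comap_top]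
      exact le_top)

end ModulusPair

/-- The off-diagonal of a monomorphism is empty: as the diagonal is an isomorphism, the off-diagonal
has at most one morphism to each object that receives a morphism from the source, such as a pair of
points. -/
theorem OffDiagonal.isEmpty_interior {M N : MSm k} {f : M ⟶ N} [Mono f] (D : OffDiagonal f) :
    IsEmpty D.obj.obj.interior.toScheme := by
  have hd : D.fst = D.snd := (cancel_mono f).mp D.isPullback.w
  let δ := D.isPullback.lift (𝟙 M) (𝟙 M) rfl
  have hδ : D.fst ≫ δ = 𝟙 _ := by
    apply D.isPullback.hom_ext
    · simp [δ]
    · simp [δ, hd]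
  obtain ⟨c⟩ := D.isCoproduct
  let L : MSm k := ⟨twoPoints k, isProper_coprod_desc_id _⟩
  obtain ⟨l, hl⟩ := exists_hom_twoPoints D.obj.obj coprod.inl (coprod.inl_desc _ _)
  obtain ⟨r, hr⟩ := exists_hom_twoPoints D.obj.obj coprod.inr (coprod.inr_desc _ _)
  obtain ⟨m⟩ : Nonempty (M ⟶ L) := by
    obtain ⟨m, -⟩ := exists_hom_twoPoints M.obj coprod.inl (coprod.inl_desc _ _)
    exact ⟨ObjectProperty.homMk m⟩
  have key (g : D.obj ⟶ L) : D.ι ≫ D.fst ≫ m = g := by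
    let s : BinaryCofan M D.obj := BinaryCofan.mk m g
    let l : D.prod ⟶ L := c.desc s
    have h₁ : δ ≫ l = m := c.fac s ⟨.left⟩
    have h₂ : D.ι ≫ l = g := c.fac s ⟨.right⟩
    rw [← h₁, reassoc_of% hδ, h₂]
  have hlr : l = r := congrArg InducedCategory.Hom.hom
    ((key (ObjectProperty.homMk l)).symm.trans (key (ObjectProperty.homMk r)))
  refine ⟨fun x => ?_⟩
  rw [hlr, hr] at hl
  have h := congrArg (fun g : D.obj.obj.interior.toScheme ⟶ (twoPoints k).space => g x) hl
  have hS := isCompl_opensRange_inl_inr (Spec (CommRingCat.of k)) (Spec (CommRingCat.of k))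
  let y := (D.obj.obj.interior.ι ≫ D.obj.obj.str) x
  have h₁ : (coprod.inr : _ ⟶ (twoPoints k).space) y ∈
      (coprod.inl : Spec (.of k) ⟶ (twoPoints k).space).opensRange := ⟨y, h.symm⟩
  exact hS.disjoint.le_bot ⟨h₁, ⟨y, rfl⟩⟩

/-- The condition on off-diagonals holds for squares with vertical monomorphisms. -/
theorem offDiagonalIso_of_mono (T : Square (MSm k)) [Mono T.f₁₃] [Mono T.f₂₄] :
    OffDiagonalIso T := by
  intro D E
  obtain ⟨hD⟩ := nonempty_isInitial_of_isEmpty D.isEmpty_interior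
  obtain ⟨hE⟩ := nonempty_isInitial_of_isEmpty E.isEmpty_interior
  exact ⟨hD.to _, hD.hom_ext _ _, (hD.uniqueUpToIso hE).isIso_hom⟩

/-! ### The derived square -/

namespace OffDiagonal

variable {C : Type*} [Category C]

/-- The diagonal `M ⟶ M ×_N M`. -/
noncomputable abbrev diag {M N : C} {f : M ⟶ N} (D : OffDiagonal f) : M ⟶ D.prod :=
  D.isPullback.lift (𝟙 M) (𝟙 M) rfl

variable {T : Square C} (D : OffDiagonal T.f₁₃) (E : OffDiagonal T.f₂₄)

/-- The derived square, formed with chosen fibre products. -/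
noncomputable abbrev derived : Square C where
  f₁₂ := T.f₁₂
  f₁₃ := D.diag
  f₂₄ := E.diag
  f₃₄ := D.prodMap E T.f₁₂ T.f₃₄ T.fac
  fac := by
    apply E.isPullback.hom_ext
    · simp [prodMap]
    · simp [prodMap]

theorem prodMap_fst : D.prodMap E T.f₁₂ T.f₃₄ T.fac ≫ E.fst = D.fst ≫ T.f₁₂ :=
  E.isPullback.lift_fst _ _ _

theorem prodMap_snd : D.prodMap E T.f₁₂ T.f₃₄ T.fac ≫ E.snd = D.snd ≫ T.f₁₂ :=
  E.isPullback.lift_snd _ _ _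

theorem isPullback_derived [Mono T.f₁₂] : (derived D E).IsPullback := by
  refine ⟨⟨(derived D E).fac⟩, ⟨PullbackCone.IsLimit.mk _ (fun s => s.snd ≫ D.fst)
    (fun s => ?_) (fun s => ?_) fun s m h₁ h₂ => ?_⟩⟩
  · have h := s.condition =≫ E.fst
    simp only [Category.assoc, IsPullback.lift_fst, Category.comp_id, prodMap_fst] at h
    rw [Category.assoc, h]
  · have h₁ := s.condition =≫ E.fst
    have h₂ := s.condition =≫ E.snd
    simp only [Category.assoc, IsPullback.lift_fst, IsPullback.lift_snd, Category.comp_id,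
      prodMap_fst, prodMap_snd] at h₁ h₂
    have h : s.snd ≫ D.fst = s.snd ≫ D.snd := by
      rw [← cancel_mono T.f₁₂, Category.assoc, Category.assoc, ← h₁, ← h₂]
    apply D.isPullback.hom_ext
    · simp
    · simp [h]
  · rw [← h₂]
    simp

theorem nonempty_iso_derivedSquare [HasPullback T.f₂₄ T.f₂₄] [HasPullback T.f₁₃ T.f₁₃] :
    Nonempty (derived D E ≅ derivedSquare T) := by
  have h : D.prodMap E T.f₁₂ T.f₃₄ T.fac ≫ E.isPullback.isoPullback.hom =
      D.isPullback.isoPullback.hom ≫ pullback.map T.f₁₃ T.f₁₃ T.f₂₄ T.f₂₄ T.f₁₂ T.f₁₂ T.f₃₄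
        T.fac.symm T.fac.symm := by
    apply pullback.hom_ext
    · rw [Category.assoc, IsPullback.isoPullback_hom_fst, prodMap_fst, Category.assoc,
        pullback.map, pullback.lift_fst, IsPullback.isoPullback_hom_fst_assoc]
    · rw [Category.assoc, IsPullback.isoPullback_hom_snd, prodMap_snd, Category.assoc,
        pullback.map, pullback.lift_snd, IsPullback.isoPullback_hom_snd_assoc]
  refine ⟨Square.isoMk (Iso.refl _) (Iso.refl _) D.isPullback.isoPullback E.isPullback.isoPullback
    ?_ ?_ ?_ h⟩
  · simp [derivedSquare]
  · apply pullback.hom_ext <;> simp [derivedSquare]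
  · apply pullback.hom_ext <;> simp [derivedSquare]

end OffDiagonal

/-! ### A Zariski square attached to a clopen decomposition -/

/-- Given a clopen decomposition `X = O₁ ⊔ O₂` and an open `W` of `O₁`, the opens `O₁` and `W ⊔ O₂`
form a Zariski covering of `X` with intersection `W`, which is an elementary Nisnevich square. -/
theorem isElementaryNisnevich_of_isCompl {X : Scheme.{u}} {O₁ O₂ W : X.Opens} (h : IsCompl O₁ O₂)
    (hW : W ≤ O₁) (hW' : W ≤ W ⊔ O₂) :
    IsElementaryNisnevich ⟨X.homOfLE hW, X.homOfLE hW', O₁.ι, (W ⊔ O₂).ι, by simp⟩ := by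
  have hinf : O₁ ⊓ (W ⊔ O₂) ≤ W := by
    rw [inf_sup_left, h.inf_eq_bot, sup_bot_eq]
    exact inf_le_right
  have hpb : IsPullback (X.homOfLE hW) (X.homOfLE hW') O₁.ι (W ⊔ O₂).ι := by
    have hr (s : PullbackCone O₁.ι (W ⊔ O₂).ι) : Set.range (s.fst ≫ O₁.ι) ⊆ Set.range W.ι := by
      rintro _ ⟨x, rfl⟩
      rw [Scheme.Opens.range_ι]
      refine hinf ⟨(s.fst x).2, ?_⟩
      rw [s.condition]
      exact (s.snd x).2
    refine ⟨⟨by simp⟩, ⟨PullbackCone.IsLimit.mk _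
      (fun s => IsOpenImmersion.lift W.ι (s.fst ≫ O₁.ι) (hr s)) (fun s => ?_) (fun s => ?_)
      fun s m h₁ _ => ?_⟩⟩
    · rw [← cancel_mono O₁.ι, Category.assoc, X.homOfLE_ι hW]
      exact IsOpenImmersion.lift_fac _ _ _
    · rw [← cancel_mono (W ⊔ O₂).ι, Category.assoc, X.homOfLE_ι hW']
      exact (IsOpenImmersion.lift_fac _ _ _).trans s.condition
    · rw [← cancel_mono W.ι]
      refine Eq.trans ?_ (IsOpenImmersion.lift_fac _ _ _).symm
      rw [← h₁, Category.assoc, X.homOfLE_ι hW]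
  -- both complements are the reduced closed subscheme of `X` on the complement of `W ⊔ O₂`
  have himage : O₁.ι '' ((X.homOfLE hW).opensRange : Set O₁)ᶜ =
      ((W ⊔ O₂).ι.opensRange : Set X)ᶜ := by
    have hmem (x : O₁) : x ∈ (X.homOfLE hW).opensRange ↔ O₁.ι x ∈ W := by
      constructor
      · rintro ⟨y, rfl⟩
        rw [← Scheme.Hom.comp_apply, X.homOfLE_ι hW]
        exact y.2
      · exact fun hx => ⟨⟨x.1, hx⟩, Subtype.ext (congrArg (fun f : W.toScheme ⟶ X => f ⟨x.1, hx⟩)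
          (X.homOfLE_ι hW))⟩
    rw [Scheme.Opens.opensRange_ι]
    ext x
    constructor
    · rintro ⟨y, hy, rfl⟩ hy'
      exact hy ((hmem y).mpr (hinf ⟨y.2, hy'⟩))
    · intro hx
      rcases (h.sup_eq_top.ge trivial : x ∈ O₁ ⊔ O₂) with hx' | hx'
      · exact ⟨⟨x, hx'⟩, fun hy => hx (.inl ((hmem ⟨x, hx'⟩).mp hy)), rfl⟩
      · exact (hx (.inr hx')).elim
  have := isClosedImmersion_ι_of_isCompl h
  have hker : ((reducedCompl (W ⊔ O₂).ι.opensRange).subschemeι).ker =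
      ((reducedCompl (X.homOfLE hW).opensRange).subschemeι ≫ O₁.ι).ker := by
    change _ = (reducedCompl (X.homOfLE hW).opensRange).map O₁.ι
    rw [Scheme.IdealSheafData.ker_subschemeι, reducedCompl, reducedCompl,
      Scheme.IdealSheafData.map_vanishingIdeal]
    congr 1
    apply TopologicalSpace.Closeds.ext
    change _ = closure (O₁.ι '' ((X.homOfLE hW).opensRange : Set O₁)ᶜ)
    rw [himage]
    exact ((W ⊔ O₂).ι.opensRange.isOpen.isClosed_compl.closure_eq).symm
  exact ⟨hpb, inferInstanceAs (Etale (X.homOfLE hW')), inferInstanceAs (Etale O₁.ι),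
    inferInstanceAs (IsOpenImmersion (X.homOfLE hW)),
    inferInstanceAs (IsOpenImmersion (W ⊔ O₂).ι),
    IsClosedImmersion.lift (reducedCompl (W ⊔ O₂).ι.opensRange).subschemeι
      ((reducedCompl (X.homOfLE hW).opensRange).subschemeι ≫ O₁.ι) hker.le,
    IsClosedImmersion.lift_fac _ _ _, IsClosedImmersion.isIso_lift _ _ hker⟩

namespace ModulusPair

/-- A minimal morphism whose ambient morphism lands in an open subscheme factors through the
restriction of the target to it. -/
theorem IsMinimalExtension.exists_lift {M N : ModulusPair k} {f : N ⟶ M} {φ : N.space ⟶ M.space}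
    (h : IsMinimalExtension f φ) {O : M.space.Opens} (hO : ∀ x, φ x ∈ O) :
    ∃ g : N ⟶ M.restrict O, g ≫ M.restrictι O = f := by
  have hr : Set.range φ ⊆ Set.range (M.spaceι O) := by
    rintro _ ⟨x, rfl⟩
    exact (M.opensRange_spaceι O).ge (hO x)
  have hl := IsOpenImmersion.lift_fac (M.spaceι O) φ hr
  obtain ⟨g, hg⟩ := exists_hom_of_ambient (M := N) (N := M.restrict O)
    (IsOpenImmersion.lift (M.spaceι O) φ hr) (by rw [← spaceι_str, reassoc_of% hl, h.w]) (by
      rw [divisor_restrict, ← Scheme.IdealSheafData.comap_comp, hl, h.divisor_eq])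
  refine ⟨g, hom_ext ?_⟩
  rw [comp_base, ← cancel_mono M.interior.ι, Category.assoc, restrictι_base_ι, reassoc_of% hg, hl,
    h.extends_base]

theorem isMinimalExtension_restrictι (M : ModulusPair k) (O : M.space.Opens) :
    IsMinimalExtension (M.restrictι O) (M.spaceι O) :=
  ⟨rfl, (M.restrictι_base_ι O).symm, rfl⟩

end ModulusPair

/-! ### The derived square of a square of the cd-structure -/

theorem ModulusPair.IsMinimalExtension.comp {M N L : ModulusPair k} {f : M ⟶ N} {g : N ⟶ L}
    {φ : M.space ⟶ N.space} {ψ : N.space ⟶ L.space} (h : IsMinimalExtension f φ)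
    (h' : IsMinimalExtension g ψ) : IsMinimalExtension (f ≫ g) (φ ≫ ψ) where
  w := by rw [Category.assoc, h'.w, h.w]
  extends_base := by
    rw [← Category.assoc, h.extends_base, Category.assoc, h'.extends_base, comp_base,
      Category.assoc]
  divisor_eq := by rw [h.divisor_eq, h'.divisor_eq, Scheme.IdealSheafData.comap_comp]

theorem isOpenImmersion_base_prodMap {T : Square (MSm k)} {D : OffDiagonal T.f₁₃}
    {E : OffDiagonal T.f₂₄}
    (hD : IsPullback (Hom.base D.fst.hom) (Hom.base D.snd.hom) (Hom.base T.f₁₃.hom)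
      (Hom.base T.f₁₃.hom))
    (hE : IsPullback (Hom.base E.fst.hom) (Hom.base E.snd.hom) (Hom.base T.f₂₄.hom)
      (Hom.base T.f₂₄.hom))
    [IsOpenImmersion (Hom.base T.f₁₂.hom)] [Mono (Hom.base T.f₃₄.hom)] :
    IsOpenImmersion (Hom.base (D.prodMap E T.f₁₂ T.f₃₄ T.fac).hom) := by
  have hw : Hom.base T.f₁₃.hom ≫ Hom.base T.f₃₄.hom =
      Hom.base T.f₁₂.hom ≫ Hom.base T.f₂₄.hom :=
    congrArg (fun g => Hom.base (InducedCategory.Hom.hom g)) T.fac.symm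
  have h₁ : Hom.base (D.prodMap E T.f₁₂ T.f₃₄ T.fac).hom ≫ Hom.base E.fst.hom =
      Hom.base D.fst.hom ≫ Hom.base T.f₁₂.hom :=
    congrArg (fun g => Hom.base (InducedCategory.Hom.hom g)) (D.prodMap_fst E)
  have h₂ : Hom.base (D.prodMap E T.f₁₂ T.f₃₄ T.fac).hom ≫ Hom.base E.snd.hom =
      Hom.base D.snd.hom ≫ Hom.base T.f₁₂.hom :=
    congrArg (fun g => Hom.base (InducedCategory.Hom.hom g)) (D.prodMap_snd E)
  have h : Hom.base (D.prodMap E T.f₁₂ T.f₃₄ T.fac).hom = hD.isoPullback.hom ≫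
      pullback.map _ _ _ _ (Hom.base T.f₁₂.hom) (Hom.base T.f₁₂.hom) (Hom.base T.f₃₄.hom) hw hw ≫
        hE.isoPullback.inv := by
    apply hE.hom_ext
    · rw [h₁, Category.assoc, Category.assoc, IsPullback.isoPullback_inv_fst, pullback.map,
        pullback.lift_fst, IsPullback.isoPullback_hom_fst_assoc]
    · rw [h₂, Category.assoc, Category.assoc, IsPullback.isoPullback_inv_snd, pullback.map,
        pullback.lift_snd, IsPullback.isoPullback_hom_snd_assoc]
  rw [h]
  infer_instance

/-- The derived square receives a morphism from a Nisnevich square that is an isomorphism on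
interiors and on the lower right corner. The Nisnevich square consists of the opens `O₁` and
`W ⊔ O₂` of the self fibre product of `p`, where `O₁` and `O₂` are the diagonal and the off-diagonal
part and `W` is the interior of the source of `q`. -/
theorem exists_nisnevichSquare_derived {T : Square (MSm k)} (hT : MVSquare k T)
    {D : OffDiagonal T.f₁₃} {E : OffDiagonal T.f₂₄}
    {U₁ U₂ : D.prod.obj.space.Opens} (hU : IsCompl U₁ U₂)
    (a' : T.X₁.obj ≅ D.prod.obj.restrict U₁) (b' : D.obj.obj ≅ D.prod.obj.restrict U₂)
    (ha' : a'.hom ≫ D.prod.obj.restrictι U₁ = D.diag.hom)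
    (hb' : b'.hom ≫ D.prod.obj.restrictι U₂ = D.ι.hom)
    {O₁ O₂ : E.prod.obj.space.Opens} (hO : IsCompl O₁ O₂)
    (a : T.X₂.obj ≅ E.prod.obj.restrict O₁) (b : E.obj.obj ≅ E.prod.obj.restrict O₂)
    (ha : a.hom ≫ E.prod.obj.restrictι O₁ = E.diag.hom)
    (hb : b.hom ≫ E.prod.obj.restrictι O₂ = E.ι.hom)
    (hopen : IsOpenImmersion (Hom.base (D.prodMap E T.f₁₂ T.f₃₄ T.fac).hom)) :
    ∃ S : Square (ModulusPair k), ModulusPair.IsNisnevichSquare S ∧ ModulusPair.proper k S.X₄ ∧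
      ∃ φ : S ⟶ (D.derived E).map (ModulusPair.proper k).ι,
        IsIso (Hom.base φ.τ₁) ∧ IsIso (Hom.base φ.τ₂) ∧ IsIso (Hom.base φ.τ₃) ∧
        IsIso (Hom.base φ.τ₄) ∧ IsIso φ.τ₄ := by
  let P := E.prod.obj
  have := hT.mono_f₁₂
  have := hT.base.2.2.1
  obtain ⟨e, he, _⟩ := hT.2.2 D E
  let v := T.f₁₂.hom
  let π := (D.prodMap E T.f₁₂ T.f₃₄ T.fac).hom
  have hπ : Mono π := mono_of_mono_base _
  have hvπ : D.diag.hom ≫ π = v ≫ E.diag.hom :=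
    congrArg InducedCategory.Hom.hom (D.derived E).fac.symm
  have heπ : e.hom ≫ E.ι.hom = D.ι.hom ≫ π := congrArg InducedCategory.Hom.hom he
  -- the image of the interior of `T.X₁` in the fibre product
  let κ : T.X₁.obj.interior.toScheme ⟶ P.interior.toScheme := Hom.base (v ≫ E.diag.hom)
  have hκ : κ = Hom.base v ≫ Hom.base a.hom ≫ Hom.base (P.restrictι O₁) := by
    rw [← comp_base a.hom, ha]
    rfl
  have : IsOpenImmersion κ := by
    rw [hκ]
    infer_instance
  let W : P.space.Opens := P.interior.ι ''ᵁ κ.opensRange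
  have hWκ : P.interior.ι ⁻¹ᵁ W = κ.opensRange := P.interior.ι.preimage_image_eq _
  have hW : W ≤ O₁ := by
    rintro _ ⟨_, ⟨x, rfl⟩, rfl⟩
    have h : κ x ∈ (Hom.base (P.restrictι O₁)).opensRange := by
      rw [hκ]
      exact ⟨_, rfl⟩
    rw [opensRange_restrictι] at h
    exact h
  let V : P.space.Opens := W ⊔ O₂
  have hWV : W ≤ V := le_sup_left
  have hOV : O₂ ≤ V := le_sup_right
  let S : Square (ModulusPair k) :=
    { f₁₂ := P.restrictLE hW
      f₁₃ := P.restrictLE hWV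
      f₂₄ := P.restrictι O₁
      f₃₄ := P.restrictι V
      fac := by rw [restrictLE_restrictι, restrictLE_restrictι] }
  have hS : IsFinNisnevichSquare S :=
    ⟨P.spaceLE hW, P.spaceLE hWV, P.spaceι O₁, P.spaceι V,
      by rw [spaceLE_spaceι, spaceLE_spaceι], P.isMinimalExtension_restrictLE hW,
      P.isMinimalExtension_restrictLE hWV, P.isMinimalExtension_restrictι O₁,
      P.isMinimalExtension_restrictι V, isElementaryNisnevich_of_isCompl hO hW hWV⟩
  -- the morphism to `T.X₁`; it is admissible because its source has empty divisor
  have hrange : (Hom.base (P.restrictι W)).opensRange = κ.opensRange := by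
    rw [opensRange_restrictι, hWκ]
  let i : (P.restrict W).interior.toScheme ≅ T.X₁.obj.interior.toScheme :=
    IsOpenImmersion.isoOfRangeEq (Hom.base (P.restrictι W)) κ
      (congrArg (fun Q : P.interior.toScheme.Opens => (Q : Set P.interior.toScheme)) hrange)
  let t := i.hom
  have ht : t ≫ κ = Hom.base (P.restrictι W) := IsOpenImmersion.isoOfRangeEq_hom_fac _ _ _
  have hdiv : (P.restrict W).divisor = ⊤ := by
    rw [divisor_restrict]
    refine comap_eq_top_of_le_offSupport _ fun x => ?_
    obtain ⟨y, -, hy⟩ := (P.opensRange_spaceι W).le ⟨x, rfl⟩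
    rw [← hy]
    exact y.2
  obtain ⟨τ₁, hτ₁⟩ := exists_hom_of_divisor_eq_top hdiv t (by
    have h₁ := base_w (v ≫ E.diag.hom)
    have h₂ := base_w (P.restrictι W)
    rw [← h₁, ← Category.assoc]
    exact (congrArg (· ≫ P.interior.ι ≫ P.str) ht).trans h₂)
  have hτ₁P : τ₁ ≫ v ≫ E.diag.hom = P.restrictι W :=
    ModulusPair.hom_ext (by rw [comp_base, hτ₁]; exact ht)
  -- the morphism to the fibre product, glued from the two parts of `V`
  let R := P.restrict V
  let R₁ : R.space.Opens := P.spaceι V ⁻¹ᵁ O₁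
  let R₂ : R.space.Opens := P.spaceι V ⁻¹ᵁ O₂
  have hR : IsCompl R₁ R₂ := isCompl_preimage _ hO
  have hmin (Q : R.space.Opens) := (R.isMinimalExtension_restrictι Q).comp
    (P.isMinimalExtension_restrictι V)
  have hV (x : R.space) : P.spaceι V x ∈ V := (P.opensRange_spaceι V).le ⟨x, rfl⟩
  obtain ⟨m₁, hm₁⟩ := (hmin R₁).exists_lift (O := W) fun x => by
    have h₁ : R.spaceι R₁ x ∈ R₁ := (R.opensRange_spaceι R₁).le ⟨x, rfl⟩
    rcases hV (R.spaceι R₁ x) with h | h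
    · exact h
    · exact (hO.disjoint.le_bot ⟨h₁, h⟩).elim
  obtain ⟨m₂, hm₂⟩ := (hmin R₂).exists_lift (O := O₂) fun x =>
    ((R.opensRange_spaceι R₂).le ⟨x, rfl⟩ : R.spaceι R₂ x ∈ R₂)
  obtain ⟨τ₃, hτ₃₁, hτ₃₂⟩ := exists_desc hR (m₁ ≫ τ₁ ≫ D.diag.hom)
    (m₂ ≫ b.inv ≫ inv e.hom ≫ D.ι.hom)
  have hbe : (b.inv ≫ inv e.hom ≫ D.ι.hom) ≫ π = P.restrictι O₂ := by
    rw [Category.assoc, Category.assoc, ← heπ, IsIso.inv_hom_id_assoc, ← hb,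
      Iso.inv_hom_id_assoc]
  have hτ₃ : τ₃ ≫ π = P.restrictι V := by
    refine hom_ext_of_isCompl hR ?_ ?_
    · rw [reassoc_of% hτ₃₁, hvπ, hτ₁P, hm₁]
    · rw [← Category.assoc, hτ₃₂, Category.assoc, hbe, hm₂]
  have hτ₃W : P.restrictLE hWV ≫ τ₃ = τ₁ ≫ D.diag.hom := by
    rw [← cancel_mono π, Category.assoc, Category.assoc, hτ₃, hvπ, hτ₁P, restrictLE_restrictι]
  have hτ₃O : P.restrictLE hOV ≫ τ₃ = b.inv ≫ inv e.hom ≫ D.ι.hom := by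
    rw [← cancel_mono π, Category.assoc, hτ₃, hbe, restrictLE_restrictι]
  -- on interiors it is an open immersion, and it is surjective onto both parts of the target
  have hiso : IsIso (Hom.base τ₃) := by
    have : IsOpenImmersion (Hom.base τ₃ ≫ Hom.base π) := by
      rw [← comp_base, hτ₃]
      infer_instance
    have : IsOpenImmersion (Hom.base τ₃) := .of_comp _ (Hom.base π)
    have h₁ : (Hom.base a'.inv ≫ i.inv ≫ Hom.base (P.restrictLE hWV)) ≫ Hom.base τ₃ =
        Hom.base (D.prod.obj.restrictι U₁) := by
      rw [Category.assoc, Category.assoc, ← comp_base, hτ₃W, comp_base, hτ₁, Iso.inv_hom_id_assoc,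
        ← comp_base, ← ha', Iso.inv_hom_id_assoc]
    have h₂ : Hom.base (b'.inv ≫ e.hom ≫ b.hom ≫ P.restrictLE hOV) ≫ Hom.base τ₃ =
        Hom.base (D.prod.obj.restrictι U₂) := by
      rw [← comp_base, Category.assoc, Category.assoc, Category.assoc, hτ₃O,
        Iso.hom_inv_id_assoc, IsIso.hom_inv_id_assoc, ← hb', Iso.inv_hom_id_assoc]
    have : Surjective (Hom.base τ₃) := by
      refine ⟨fun x => ?_⟩
      rcases ((isCompl_interior hU).sup_eq_top.ge trivial :
        x ∈ (Hom.base (D.prod.obj.restrictι U₁)).opensRange ⊔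
          (Hom.base (D.prod.obj.restrictι U₂)).opensRange) with ⟨y, hy⟩ | ⟨y, hy⟩
      · exact ⟨_, (congrArg (fun g : _ ⟶ D.prod.obj.interior.toScheme => g y) h₁).trans hy⟩
      · exact ⟨_, (congrArg (fun g : _ ⟶ D.prod.obj.interior.toScheme => g y) h₂).trans hy⟩
    have : Epi (Hom.base τ₃).base := (TopCat.epi_iff_surjective _).mpr (Hom.base τ₃).surjective
    exact IsOpenImmersion.isIso _
  let Φ : S ⟶ (D.derived E).map (ModulusPair.proper k).ι :=
    { τ₁ := τ₁
      τ₂ := a.inv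
      τ₃ := τ₃
      τ₄ := 𝟙 P
      comm₁₂ := by
        change P.restrictLE hW ≫ a.inv = τ₁ ≫ v
        rw [Iso.comp_inv_eq, ← cancel_mono (P.restrictι O₁), restrictLE_restrictι, Category.assoc,
          Category.assoc, ha, hτ₁P]
      comm₁₃ := hτ₃W
      comm₂₄ := by
        change P.restrictι O₁ ≫ 𝟙 _ = a.inv ≫ E.diag.hom
        rw [Category.comp_id, ← ha, Iso.inv_hom_id_assoc]
      comm₃₄ := (Category.comp_id _).trans hτ₃.symm }
  refine ⟨S, ⟨S, hS, ⟨Iso.refl _⟩⟩, E.prod.property, Φ, ?_,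
    inferInstanceAs (IsIso (Hom.base a.inv)), hiso,
    inferInstanceAs (IsIso (Hom.base (𝟙 P))), inferInstanceAs (IsIso (𝟙 P))⟩
  change IsIso (Hom.base τ₁)
  rw [hτ₁]
  exact i.isIso_hom

/-- The derived square formed with suitable fibre products belongs to the cd-structure. -/
theorem MVSquare.exists_derived {T : Square (MSm k)} (hT : MVSquare k T) :
    ∃ (D : OffDiagonal T.f₁₃) (E : OffDiagonal T.f₂₄), MVSquare k (D.derived E) := by
  obtain ⟨D, U₁, U₂, hU, a', b', ha', hb', hD⟩ := exists_offDiagonal T.f₁₃ hT.base.1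
  obtain ⟨E, O₁, O₂, hO, a, b, ha, hb, hE⟩ := exists_offDiagonal T.f₂₄ hT.base.2.1
  have := hT.mono_f₁₂
  have := hT.base.2.2.1
  have := hT.base.2.2.2
  have : Mono (D.derived E).f₁₃ :=
    mono_of_mono_fac (D.isPullback.lift_fst (𝟙 _) (𝟙 _) rfl)
  have : Mono (D.derived E).f₂₄ :=
    mono_of_mono_fac (E.isPullback.lift_fst (𝟙 _) (𝟙 _) rfl)
  exact ⟨D, E, D.isPullback_derived E,
    exists_nisnevichSquare_derived hT hU a' b' ha' hb' hO a b ha hb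
      (isOpenImmersion_base_prodMap hD hE), offDiagonalIso_of_mono _⟩

theorem MVSquare.derivedSquare {T : Square (MSm k)} (hT : MVSquare k T) :
    ∃ (_ : HasPullback T.f₂₄ T.f₂₄) (_ : HasPullback T.f₁₃ T.f₁₃),
      MVSquare k (derivedSquare T) := by
  obtain ⟨D, E, h⟩ := hT.exists_derived
  have := D.isPullback.hasPullback
  have := E.isPullback.hasPullback
  obtain ⟨i⟩ := D.nonempty_iso_derivedSquare E
  exact ⟨inferInstance, inferInstance, (MVSquare k).prop_of_iso i h⟩

/-! ### Regularity of the cd-structure -/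

section

universe v w

variable {C : Type w} [Category.{v} C] (P : ObjectProperty (Square C))

theorem ofTwoArrows_mem_cdTopology {T : Square C} (hT : P T) :
    Sieve.ofTwoArrows T.f₃₄ T.f₂₄ ∈ cdTopology P T.X₄ := by
  rw [cdTopology, GrothendieckTopology.mem_sInf]
  exact fun J hJ => hJ.2 T hT

/-- A covering pair of morphisms is jointly epimorphic on the represented sheaves: by adjunction and
the Yoneda lemma, morphisms out of `ρ(X)` are sections over `X`, and sheaves are separated. -/
theorem cdRepr_hom_ext {T : Square C} (hT : P T) {F : Sheaf (cdTopology P) (Type (max w v))}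
    {g h : (cdRepr P).obj T.X₄ ⟶ F} (h₂ : (cdRepr P).map T.f₂₄ ≫ g = (cdRepr P).map T.f₂₄ ≫ h)
    (h₃ : (cdRepr P).map T.f₃₄ ≫ g = (cdRepr P).map T.f₃₄ ≫ h) : g = h := by
  let adj := sheafificationAdjunction (cdTopology P) (Type (max w v))
  apply (adj.homEquiv _ _).injective
  apply uliftYonedaEquiv.injective
  have hF : Presieve.IsSeparated (cdTopology P) F.obj :=
    ((isSheaf_iff_isSheaf_of_type _ _).mp F.property).isSeparated
  have key {X : C} (a : X ⟶ T.X₄) (ha : (cdRepr P).map a ≫ g = (cdRepr P).map a ≫ h) :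
      F.obj.map a.op (uliftYonedaEquiv (adj.homEquiv _ _ g)) =
        F.obj.map a.op (uliftYonedaEquiv (adj.homEquiv _ _ h)) := by
    refine (uliftYonedaEquiv_naturality _ a.op).trans
      (Eq.trans (congrArg uliftYonedaEquiv ?_) (uliftYonedaEquiv_naturality _ a.op).symm)
    refine (adj.homEquiv_naturality_left _ _).symm.trans
      (Eq.trans ?_ (adj.homEquiv_naturality_left _ _))
    exact congrArg _ ha
  refine (hF _ (ofTwoArrows_mem_cdTopology P hT)).ext fun Y f hf => ?_
  rw [Sieve.ofTwoArrows, Sieve.mem_ofArrows_iff] at hf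
  obtain ⟨i, a, rfl⟩ := hf
  cases i with
  | left =>
    refine (ConcreteCategory.congr_hom (F.obj.map_comp T.f₃₄.op a.op) _).trans
      (Eq.trans ?_ (ConcreteCategory.congr_hom (F.obj.map_comp T.f₃₄.op a.op) _).symm)
    exact congrArg (F.obj.map a.op) (key T.f₃₄ h₃)
  | right =>
    refine (ConcreteCategory.congr_hom (F.obj.map_comp T.f₂₄.op a.op) _).trans
      (Eq.trans ?_ (ConcreteCategory.congr_hom (F.obj.map_comp T.f₂₄.op a.op) _).symm)
    exact congrArg (F.obj.map a.op) (key T.f₂₄ h₂)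

/-- The Yoneda embedding preserves limits, and sheafification preserves finite limits. -/
instance : PreservesLimitsOfShape WalkingCospan (cdRepr P) := by
  have : PreservesFiniteLimits (presheafToSheaf (cdTopology P) (Type (max w v))) := inferInstance
  exact inferInstanceAs (PreservesLimitsOfShape WalkingCospan
    (uliftYoneda.{w} ⋙ presheafToSheaf (cdTopology P) (Type (max w v))))

/-- If the derived square belongs to the class `P`, the diagonal and `v × v` cover the self fibre
product of `p`, which represents the fibre product of sheaves. -/
theorem isLocallySurjective_of_derived {T : Square C} (D : OffDiagonal T.f₁₃)
    (E : OffDiagonal T.f₂₄) (h : P (D.derived E)) : Sheaf.IsLocallySurjective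
    (coprod.desc (pullback.diagonal ((cdRepr P).map T.f₂₄))
      (pullback.map ((cdRepr P).map T.f₁₃) ((cdRepr P).map T.f₁₃)
        ((cdRepr P).map T.f₂₄) ((cdRepr P).map T.f₂₄)
        ((cdRepr P).map T.f₁₂) ((cdRepr P).map T.f₁₂) ((cdRepr P).map T.f₃₄)
        (by rw [← Functor.map_comp, ← Functor.map_comp, T.fac])
        (by rw [← Functor.map_comp, ← Functor.map_comp, T.fac]))) := by
  rw [Sheaf.isLocallySurjective_iff_epi]
  refine ⟨fun g₁ g₂ hg => ?_⟩
  have hE := E.isPullback.map (cdRepr P)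
  have hD := D.isPullback.map (cdRepr P)
  have e₁ := coprod.inl ≫= hg
  have e₂ := coprod.inr ≫= hg
  rw [coprod.inl_desc_assoc, coprod.inl_desc_assoc] at e₁
  rw [coprod.inr_desc_assoc, coprod.inr_desc_assoc] at e₂
  rw [← cancel_epi hE.isoPullback.hom]
  refine cdRepr_hom_ext P h ?_ ?_
  · have k : (cdRepr P).map E.diag ≫ hE.isoPullback.hom =
        pullback.diagonal ((cdRepr P).map T.f₂₄) := by
      apply pullback.hom_ext
      · rw [Category.assoc, IsPullback.isoPullback_hom_fst, ← Functor.map_comp,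
          E.isPullback.lift_fst, pullback.diagonal_fst, CategoryTheory.Functor.map_id]
      · rw [Category.assoc, IsPullback.isoPullback_hom_snd, ← Functor.map_comp,
          E.isPullback.lift_snd, pullback.diagonal_snd, CategoryTheory.Functor.map_id]
    rw [reassoc_of% k, reassoc_of% k, e₁]
  · have k : (cdRepr P).map (D.prodMap E T.f₁₂ T.f₃₄ T.fac) ≫ hE.isoPullback.hom =
        hD.isoPullback.hom ≫ pullback.map _ _ _ _ ((cdRepr P).map T.f₁₂) ((cdRepr P).map T.f₁₂)
          ((cdRepr P).map T.f₃₄) (by rw [← Functor.map_comp, ← Functor.map_comp, T.fac])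
          (by rw [← Functor.map_comp, ← Functor.map_comp, T.fac]) := by
      apply pullback.hom_ext
      · rw [Category.assoc, IsPullback.isoPullback_hom_fst, ← Functor.map_comp,
          OffDiagonal.prodMap_fst, Category.assoc, pullback.map, pullback.lift_fst,
          IsPullback.isoPullback_hom_fst_assoc, Functor.map_comp]
      · rw [Category.assoc, IsPullback.isoPullback_hom_snd, ← Functor.map_comp,
          OffDiagonal.prodMap_snd, Category.assoc, pullback.map, pullback.lift_snd,
          IsPullback.isoPullback_hom_snd_assoc, Functor.map_comp]
    rw [reassoc_of% k, reassoc_of% k, e₂]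

end

theorem isRegularCDStructure_MVSquare (k : Type u) [Field k] :
    IsRegularCDStructure (MVSquare k) where
  closedUnderIso := inferInstance
  isPullback T hT := hT.1
  mono T hT := MVSquare.mono_f₃₄ hT
  surjective T hT := by
    obtain ⟨D, E, h⟩ := MVSquare.exists_derived hT
    exact isLocallySurjective_of_derived _ D E h

end MotivicModulus

theorem mainTheorem2 (k : Type u) [Field k] :
    (∀ (M N : MotivicModulus.MSm k) (f : M ⟶ N),
      AlgebraicGeometry.Etale (MotivicModulus.ModulusPair.Hom.base f.hom) →
        Nonempty (MotivicModulus.OffDiagonal f)) ∧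
    MotivicModulus.IsRegularCDStructure (MotivicModulus.MVSquare k) ∧
    ∀ T : Square (MotivicModulus.MSm k), MotivicModulus.MVSquare k T →
      T.IsPullback ∧ Mono T.f₃₄ ∧
      ∃ (_ : HasPullback T.f₂₄ T.f₂₄) (_ : HasPullback T.f₁₃ T.f₁₃),
        MotivicModulus.MVSquare k (MotivicModulus.derivedSquare T) := by
  refine ⟨fun M N f hf => ?_, MotivicModulus.isRegularCDStructure_MVSquare k, fun T hT =>
    ⟨hT.1, MotivicModulus.MVSquare.mono_f₃₄ hT, MotivicModulus.MVSquare.derivedSquare hT⟩⟩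
  obtain ⟨D, -⟩ := MotivicModulus.exists_offDiagonal f hf
  exact ⟨D⟩
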